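/- Let $L^2=L^2(\mathbb R^2)$ and write $z=(x,y)$. For a kernel $K:\mathbb R^2\setminus\{0\}\to\mathbb R$ put $$T^\varepsilon f(z)=\int_{|w|>\varepsilon}f(z-w)K(w)\,dw,\qquad Tf(z)=\lim_{\varepsilon\to0^+}T^\varepsilon f(z)\ \text{ for a.e. } z,\qquad T^*f(z)=\sup_{\varepsilon>0}|T^\varepsilon f(z)| ,$$ and say that $K$ satisfies the $L^2$ estimate if there is a constant $C$ with $\|T^*f\|_2\le C\|Tf\|_2$ for all $f\in L^2$. A smooth homogeneous convolution singular integral operator is such a $T$, as a bounded operator on $L^2$, with $K(z)=\Omega(z)/|z|^2$, where $\Omega$ is real, homogeneous of degree $0$, $C^\infty$ on the unit circle and of mean zero there. Let $A$ be the Calderón–Zygmund algebra of operators $\lambda I+S$ on $L^2$, with $\lambda\in\mathbb R$ and $S$ a smooth homogeneous convolution singular integral operator. Let $P_4$ be a real harmonic polynomial, homogeneous of degree $4$ (possibly $0$), and let $T$ be the operator with kernel $$K(z)=-\frac1\pi\frac{xy}{|z|^4}+\frac2\pi\frac{P_4(z)}{|z|^6}.$$ If $K$ satisfies the $L^2$ estimate,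 then: 1. $P_4=\alpha(x^3y-xy^3)$ for some $\alpha\in\mathbb R$ with $|\alpha|<1$; in particular $xy$ divides $P_4$ in $\mathbb R[x,y]$. 2. $T=R_P\circ U$ on $L^2$, where $R_P$ is the operator with kernel $P(z)/|z|^4$, $P=-\frac1\pi xy$, and $U\in A$ is invertible with inverse in $A$. In particular, the $L^2$ estimate fails for $P_4=x^3y-xy^3$ (that is, $\alpha=1$); it fails for $P_4=\alpha(x^3y-xy^3)+\beta(x^4+y^4-6x^2y^2)$ whenever $\alpha,\beta\in\mathbb R$ and $\beta\ne0$; and it fails for the kernel $\dfrac{xy}{|z|^4}+\dfrac{x^4+y^4-6x^2y^2}{|z|^6}$. -/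

import Mathlib

open MeasureTheory Filter Topology
open scoped NNReal ENNReal ContDiff

noncomputable section

/-- The plane `ℝ²` with its Euclidean norm and Lebesgue measure. -/
abbrev Plane : Type := EuclideanSpace ℝ (Fin 2)

/-- `L²(ℝ²)` (complex valued functions). -/
abbrev L2Plane : Type := Lp ℂ 2 (volume : Measure Plane)

/-- The truncated integral `T^ε f(x) = ∫_{|y| > ε} f(x - y) K(y) dy`. -/
def truncatedIntegral (K : Plane → ℝ) (ε : ℝ) (f : Plane → ℂ) (x : Plane) : ℂ :=
  ∫ y in {y : Plane | ε < ‖y‖}, f (x - y) * (K y : ℂ)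

/-- The maximal singular integral `T^* f(x) = sup_{ε > 0} |T^ε f(x)|`, with values in `[0, ∞]`. -/
def maximalSingularIntegral (K : Plane → ℝ) (f : Plane → ℂ) (x : Plane) : ℝ≥0∞ :=
  ⨆ (ε : ℝ) (_ : 0 < ε), ‖truncatedIntegral K ε f x‖ₑ

/-- `g = Tf` where `T` has kernel `K`: the principal value `lim_{ε → 0+} T^ε f(x)` exists and
equals `g x` for almost every `x`. -/
def IsPrincipalValue (K : Plane → ℝ) (f g : Plane → ℂ) : Prop :=
  ∀ᵐ x : Plane, Tendsto (fun ε : ℝ => truncatedIntegral K ε f x) (𝓝[>] 0) (𝓝 (g x))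

/-- The estimate `‖T^* f‖₂ ≤ C ‖T f‖₂` for all `f ∈ L²(ℝ²)`, with a constant independent
of `f`; `g` stands for `Tf`. -/
def MaximalL2Estimate (K : Plane → ℝ) : Prop :=
  ∃ C : ℝ≥0, ∀ f g : Plane → ℂ, MemLp f 2 (volume : Measure Plane) → IsPrincipalValue K f g →
    eLpNorm (maximalSingularIntegral K f) 2 (volume : Measure Plane) ≤
      (C : ℝ≥0∞) * eLpNorm g 2 (volume : Measure Plane)

/-- The bounded operator `T` on `L²(ℝ²)` is the principal value singular integral operator
with kernel `K`. -/
def IsSingularIntegralOperator (K : Plane → ℝ) (T : L2Plane →L[ℂ] L2Plane) : Prop :=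
  ∀ f : L2Plane, IsPrincipalValue K f (T f)

/-- Kernels `Ω(x)/|x|²` with `Ω` real, homogeneous of degree `0`, smooth away from the origin
(equivalently, on the unit circle) and of mean zero on the unit circle. -/
def IsSmoothHomogeneousKernel (K : Plane → ℝ) : Prop :=
  ∃ Ω : Plane → ℝ,
    (∀ t : ℝ, 0 < t → ∀ x : Plane, Ω (t • x) = Ω x) ∧
    ContDiffOn ℝ ∞ Ω {0}ᶜ ∧
    (∫ θ in (0 : ℝ)..(2 * Real.pi), Ω !₂[Real.cos θ, Real.sin θ]) = 0 ∧
    ∀ x : Plane, x ≠ 0 → K x = Ω x / ‖x‖ ^ 2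

/-- The Calderón–Zygmund algebra `A`: the operators `c I + S` with `c` real and `S` a smooth
homogeneous convolution singular integral operator. -/
def calderonZygmundAlgebra : Set (L2Plane →L[ℂ] L2Plane) :=
  {U | ∃ (c : ℝ) (K : Plane → ℝ) (S : L2Plane →L[ℂ] L2Plane),
    IsSmoothHomogeneousKernel K ∧ IsSingularIntegralOperator K S ∧
    U = (c : ℂ) • ContinuousLinearMap.id ℂ L2Plane + S}

/-- `U` is an invertible element of the Calderón–Zygmund algebra. -/
def IsInvertibleInCZAlgebra (U : L2Plane →L[ℂ] L2Plane) : Prop :=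
  U ∈ calderonZygmundAlgebra ∧
    ∃ V ∈ calderonZygmundAlgebra,
      U ∘L V = ContinuousLinearMap.id ℂ L2Plane ∧ V ∘L U = ContinuousLinearMap.id ℂ L2Plane

/-- The polynomial `P` in two variables is harmonic. -/
def IsHarmonicPolynomial (P : MvPolynomial (Fin 2) ℝ) : Prop :=
  ∑ i : Fin 2, MvPolynomial.pderiv i (MvPolynomial.pderiv i P) = 0

/-- The kernel `P(z)/|z|^(2 + d)` of the higher Riesz transform given by a harmonic polynomial `P`
homogeneous of degree `d`. -/
def rieszKernel (d : ℕ) (P : MvPolynomial (Fin 2) ℝ) (z : Plane) : ℝ :=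
  MvPolynomial.eval (fun i => z i) P / ‖z‖ ^ (2 + d)

/-- The polynomial `-(1/π) x y`. -/
def polyP2 : MvPolynomial (Fin 2) ℝ :=
  MvPolynomial.C (-(1 / Real.pi)) * (MvPolynomial.X 0 * MvPolynomial.X 1)

/-- The polynomial `x³y - xy³`. -/
def polyA : MvPolynomial (Fin 2) ℝ :=
  MvPolynomial.X 0 ^ 3 * MvPolynomial.X 1 - MvPolynomial.X 0 * MvPolynomial.X 1 ^ 3

/-- The polynomial `x⁴ + y⁴ - 6x²y²`. -/
def polyB : MvPolynomial (Fin 2) ℝ :=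
  MvPolynomial.X 0 ^ 4 + MvPolynomial.X 1 ^ 4
    - 6 * (MvPolynomial.X 0 ^ 2 * MvPolynomial.X 1 ^ 2)

/-- The kernel `-(1/π) xy/|z|⁴ + (2/π) P₄(z)/|z|⁶`. -/
def twoTermKernel (P₄ : MvPolynomial (Fin 2) ℝ) (z : Plane) : ℝ :=
  -(1 / Real.pi) * (z 0 * z 1 / ‖z‖ ^ 4)
    + 2 / Real.pi * (MvPolynomial.eval (fun i => z i) P₄ / ‖z‖ ^ 6)

end

/-! Write P₄ = aA + bB, the general harmonic quartic, with A = x³y - xy³ and B = x⁴ + y⁴ - 6x²y²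
(`exists_eq_of_isHarmonicPolynomial`). Then T is a Fourier multiplier operator whose symbol on the
unit circle is q = p + aA + bB, where p = xy (`exists_quartic_operator`).

Necessity. Integrating T^t f against a weight φ(t) dt gives, by Fubini, the convolution of f with
K(y)∫₀^{|y|} φ, and the result is dominated pointwise by a constant times T^*f
(`exists_enorm_integral_radial_le`). For φ the derivative of t⁶exp(-πt²), the new kernel is a
polynomial times a Gaussian, so its Fourier transform M is explicit (`fourier_quarticGaussian`). The
L² estimate and Plancherel give ‖M η‖₂ ≤ C‖q η‖₂ for Schwartz η, and localising η gives |M| ≤ C|q|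
pointwise (`norm_le_mul_norm_of_eLpNorm_le`). On the unit circle M is exp(-π) times a combination of
q and p in which the coefficient of p is nonzero, hence |p| ≤ C'|q| there
(`exists_abs_le_quarticSymbol`). If b ≠ 0, then q changes sign and so vanishes somewhere; p vanishes
at that point too, but q = b wherever p = 0, a contradiction. With b = 0 one has q = p(1 + a(x² -
y²)); cancelling p shows that 1 + ac stays away from 0 for |c| < 1, which forces |a| < 1.

Factorization. For |α| < 1 the symbol is p times 1 + α(x² - y²)/|ξ|². With α = 2r/(1 + r²), |r| < 1,
the inverse of the second factor is the sum of a Poisson-kernel type geometric series in the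
Beurling symbol and its conjugate, so it is again a constant plus the symbol of a smooth homogeneous
kernel (`exists_invertible_of_abs_lt_one`).

Principal values and multipliers are matched almost everywhere on all of L² by a smooth replacement
for truncation. For holomorphic G on a disc of radius greater than 1, `discKernel` is an explicit
family adapted to the Poisson kernel. Replacing G by τ²G multiplies its Fourier transform by the
Beurling symbol (`fourier_discKernel_sq_mul`). For G(0) = 0 it differs from the sharp truncation of
e G'(e)/|z|² by a function with zero integral and a Poisson majorant, which disappears at Lebesgue
points (`isPrincipalValueOperator_boundaryKernel`). -/

noncomputable section

section

open FourierTransform SchwartzMap LineDeriv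

/-! ### Fourier analysis on `L²(ℝ²)` -/

/-- The operator `A` on `L²(ℝ²)` is given by the Fourier multiplier `m`. -/
def IsFourierMultiplier (m : Plane → ℂ) (A : L2Plane →L[ℂ] L2Plane) : Prop :=
  ∀ f : L2Plane, (𝓕 (A f) : L2Plane) =ᵐ[volume] fun ξ => m ξ * (𝓕 f : L2Plane) ξ

lemma exists_isFourierMultiplier {m : Plane → ℂ} (hm : AEStronglyMeasurable m volume) {C : ℝ}
    (hC : ∀ ξ, ‖m ξ‖ ≤ C) : ∃ A : L2Plane →L[ℂ] L2Plane, IsFourierMultiplier m A := by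
  have hmem : MemLp m ∞ (volume : Measure Plane) := memLp_top_of_bound hm C (.of_forall hC)
  let F : L2Plane ≃ₗᵢ[ℂ] L2Plane := Lp.fourierTransformₗᵢ Plane ℂ
  let M : L2Plane →L[ℂ] L2Plane :=
    (ContinuousLinearMap.mul ℂ ℂ).holderL (volume : Measure Plane) ∞ 2 2 (hmem.toLp m)
  refine ⟨(F.symm.toContinuousLinearEquiv : L2Plane →L[ℂ] L2Plane) ∘L M ∘L
    (F.toContinuousLinearEquiv : L2Plane →L[ℂ] L2Plane), fun f => ?_⟩
  have h1 : (𝓕 (F.symm (M (F f))) : L2Plane) = M (F f) := F.apply_symm_apply _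
  have h2 := ContinuousLinearMap.coeFn_holder (r := 2) (ContinuousLinearMap.mul ℂ ℂ)
    (hmem.toLp m) (F f)
  have h3 := hmem.coeFn_toLp
  change (𝓕 (F.symm (M (F f))) : L2Plane) =ᵐ[volume] _
  rw [h1]
  filter_upwards [h2, h3] with ξ h2 h3
  change (M (F f)) ξ = _ at h2
  rw [h2, h3]
  rfl

lemma fourier_injective {f g : L2Plane}
    (h : (𝓕 f : L2Plane) =ᵐ[volume] (𝓕 g : L2Plane)) : f = g :=
  (Lp.fourierTransformₗᵢ Plane ℂ).injective (Lp.ext h)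

lemma IsFourierMultiplier.unique {m : Plane → ℂ} {A B : L2Plane →L[ℂ] L2Plane}
    (hA : IsFourierMultiplier m A) (hB : IsFourierMultiplier m B) : A = B := by
  ext1 f
  exact fourier_injective ((hA f).trans (hB f).symm)

lemma IsFourierMultiplier.comp {m n : Plane → ℂ} {A B : L2Plane →L[ℂ] L2Plane}
    (hA : IsFourierMultiplier m A) (hB : IsFourierMultiplier n B) :
    IsFourierMultiplier (fun ξ => m ξ * n ξ) (A ∘L B) := by
  intro f
  filter_upwards [hA (B f), hB f] with ξ h1 h2
  change (𝓕 (A (B f)) : L2Plane) ξ = _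
  rw [h1, h2]
  ring

lemma IsFourierMultiplier.add {m n : Plane → ℂ} {A B : L2Plane →L[ℂ] L2Plane}
    (hA : IsFourierMultiplier m A) (hB : IsFourierMultiplier n B) :
    IsFourierMultiplier (fun ξ => m ξ + n ξ) (A + B) := by
  intro f
  have h : (𝓕 ((A + B) f) : L2Plane) = 𝓕 (A f) + 𝓕 (B f) := FourierTransform.fourier_add _ _
  rw [h]
  filter_upwards [hA f, hB f, Lp.coeFn_add (𝓕 (A f) : L2Plane) (𝓕 (B f))] with ξ h1 h2 h3
  rw [h3, Pi.add_apply, h1, h2]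
  ring

lemma IsFourierMultiplier.const_smul {m : Plane → ℂ} {A : L2Plane →L[ℂ] L2Plane}
    (hA : IsFourierMultiplier m A) (c : ℂ) :
    IsFourierMultiplier (fun ξ => c * m ξ) (c • A) := by
  intro f
  have h : (𝓕 ((c • A) f) : L2Plane) = c • (𝓕 (A f) : L2Plane) :=
    (Lp.fourierTransformₗᵢ Plane ℂ).map_smul c (A f)
  rw [h]
  filter_upwards [hA f, Lp.coeFn_smul c (𝓕 (A f) : L2Plane)] with ξ h1 h2
  rw [h2, Pi.smul_apply, h1, smul_eq_mul]
  ring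

lemma isFourierMultiplier_id :
    IsFourierMultiplier (fun _ => 1) (ContinuousLinearMap.id ℂ L2Plane) := by
  intro f
  simp

lemma IsFourierMultiplier.congr_ae {m n : Plane → ℂ} {A : L2Plane →L[ℂ] L2Plane}
    (hA : IsFourierMultiplier m A) (h : m =ᵐ[volume] n) : IsFourierMultiplier n A := by
  intro f
  filter_upwards [hA f, h] with ξ h1 h2
  rw [h1, h2]

lemma continuous_integral_mul :
    Continuous fun p : L2Plane × L2Plane => ∫ x, p.1 x * p.2 x := by
  have h : Continuous fun p : L2Plane × L2Plane =>
      (ContinuousLinearMap.mul ℂ ℂ).lpPairing (volume : Measure Plane) 2 2 p.1 p.2 := by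
    fun_prop
  simpa [ContinuousLinearMap.lpPairing_eq_integral] using h

lemma integral_toLp_mul_toLp {f g f' g' : Plane → ℂ} (hf : f =ᵐ[volume] f')
    (hg : g =ᵐ[volume] g') : ∫ x, f x * g x = ∫ x, f' x * g' x := by
  apply integral_congr_ae
  filter_upwards [hf, hg] with x h1 h2
  rw [h1, h2]

/-- The Fourier transform on `L²` is self-adjoint for the bilinear pairing with Schwartz
functions. -/
lemma integral_fourier_mul_schwartz (f : L2Plane) (g : 𝓢(Plane, ℂ)) :
    ∫ ξ, (𝓕 f : L2Plane) ξ * g ξ = ∫ x, f x * 𝓕 g x := by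
  have e1 : ∀ f : L2Plane, ∫ ξ, (𝓕 f : L2Plane) ξ * g ξ
      = ∫ ξ, (𝓕 f : L2Plane) ξ * (g.toLp 2 : L2Plane) ξ := fun f =>
    integral_toLp_mul_toLp .rfl (g.coeFn_toLp 2 volume).symm
  have e2 : ∀ f : L2Plane, ∫ x, f x * 𝓕 g x = ∫ x, f x * ((𝓕 g).toLp 2 : L2Plane) x := fun f =>
    integral_toLp_mul_toLp .rfl ((𝓕 g).coeFn_toLp 2 volume).symm
  rw [e1, e2]
  -- Both sides are continuous in f, the left one by Plancherel, so it suffices to treat Schwartz f.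
  refine DenseRange.induction_on
    (p := fun f : L2Plane => ∫ ξ, (𝓕 f : L2Plane) ξ * (g.toLp 2 : L2Plane) ξ
      = ∫ x, f x * ((𝓕 g).toLp 2 : L2Plane) x)
    (SchwartzMap.denseRange_toLpCLM (p := 2) ENNReal.ofNat_ne_top) f ?_ ?_
  · refine isClosed_eq ?_ ?_
    · exact continuous_integral_mul.comp
        ((Lp.fourierTransformₗᵢ Plane ℂ).continuous.prodMk continuous_const)
    · exact continuous_integral_mul.comp (continuous_id.prodMk continuous_const)
  · intro h
    rw [SchwartzMap.toLpCLM_apply, SchwartzMap.toLp_fourier_eq, ← e2,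
      integral_toLp_mul_toLp ((𝓕 h).coeFn_toLp 2 volume) (g.coeFn_toLp 2 volume),
      integral_toLp_mul_toLp (h.coeFn_toLp 2 volume) .rfl]
    exact SchwartzMap.integral_fourier_mul_eq h g

lemma measurePreserving_const_sub (x : Plane) :
    MeasurePreserving (fun y : Plane => x - y) volume volume :=
  Measure.measurePreserving_sub_left volume x

/-- The convolution of two `L²` functions is the inverse Fourier transform of the product of their
Fourier transforms. -/
lemma integral_sub_mul_eq_fourier (f b : L2Plane) (x : Plane) :
    ∫ y, f (x - y) * b y
      = ∫ ξ, (Real.fourierChar (inner ℝ ξ x) : ℂ) * ((𝓕 f : L2Plane) ξ * (𝓕 b : L2Plane) ξ) := by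
  let e : Plane → ℂ := fun ξ => (Real.fourierChar (inner ℝ ξ x) : ℂ)
  have he : MemLp e ∞ (volume : Measure Plane) := by
    refine memLp_top_of_bound (C := 1) ?_ (.of_forall fun ξ => (Circle.norm_coe _).le)
    exact (continuous_subtype_val.comp
      (Real.continuous_fourierChar.comp (by fun_prop))).aestronglyMeasurable
  let M : L2Plane →L[ℂ] L2Plane :=
    (ContinuousLinearMap.mul ℂ ℂ).holderL (volume : Measure Plane) ∞ 2 2 (he.toLp e)
  have hM : ∀ g : L2Plane, M g =ᵐ[volume] fun ξ => e ξ * g ξ := by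
    intro g
    filter_upwards [ContinuousLinearMap.coeFn_holder (r := 2) (ContinuousLinearMap.mul ℂ ℂ)
      (he.toLp e) g, he.coeFn_toLp] with ξ h1 h2
    change (M g) ξ = _ at h1
    rw [h1, h2]
    rfl
  let r : L2Plane → L2Plane :=
    Lp.compMeasurePreserving (fun y : Plane => x - y) (measurePreserving_const_sub x)
  have hr : ∀ g : L2Plane, r g =ᵐ[volume] fun y => g (x - y) := fun g =>
    Lp.coeFn_compMeasurePreserving g (measurePreserving_const_sub x)
  have e1 : ∀ f b : L2Plane, ∫ y, f (x - y) * b y = ∫ y, r f y * b y := fun f b =>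
    integral_toLp_mul_toLp (hr f).symm .rfl
  have e2 : ∀ f b : L2Plane, ∫ ξ, e ξ * ((𝓕 f : L2Plane) ξ * (𝓕 b : L2Plane) ξ)
      = ∫ ξ, M (𝓕 f) ξ * (𝓕 b : L2Plane) ξ := by
    intro f b
    rw [integral_toLp_mul_toLp (hM (𝓕 f)) .rfl]
    simp only [mul_assoc]
  change _ = ∫ ξ, e ξ * ((𝓕 f : L2Plane) ξ * (𝓕 b : L2Plane) ξ)
  rw [e1, e2]
  -- Both sides are continuous on L² × L². On Schwartz functions the identity is the convolution
  -- theorem followed by Fourier inversion at x.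
  refine DenseRange.induction_on₂
    (p := fun f b : L2Plane => ∫ y, r f y * b y = ∫ ξ, M (𝓕 f) ξ * (𝓕 b : L2Plane) ξ)
    (SchwartzMap.denseRange_toLpCLM (p := 2) ENNReal.ofNat_ne_top) ?_ ?_ f b
  · have hF : Continuous (fun f : L2Plane => (𝓕 f : L2Plane)) :=
      (Lp.fourierTransformₗᵢ Plane ℂ).continuous
    refine isClosed_eq ?_ ?_
    · exact continuous_integral_mul.comp
        (((Lp.isometry_compMeasurePreserving _).continuous.comp continuous_fst).prodMk
          continuous_snd)
    · exact continuous_integral_mul.comp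
        ((M.continuous.comp (hF.comp continuous_fst)).prodMk (hF.comp continuous_snd))
  · intro f b
    rw [← e1, ← e2]
    simp only [SchwartzMap.toLpCLM_apply, SchwartzMap.toLp_fourier_eq]
    have h1 : (fun y => (f.toLp 2 : L2Plane) (x - y)) =ᵐ[volume] fun y => f (x - y) :=
      (measurePreserving_const_sub x).quasiMeasurePreserving.ae_eq_comp (f.coeFn_toLp 2 volume)
    rw [integral_toLp_mul_toLp h1 (b.coeFn_toLp 2 volume),
      integral_toLp_mul_toLp (f := e) .rfl
        (((𝓕 f).coeFn_toLp 2 volume).mul ((𝓕 b).coeFn_toLp 2 volume))]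
    have h2 := SchwartzMap.convolution_apply (ContinuousLinearMap.mul ℂ ℂ) b f x
    have h3 : convolution (ContinuousLinearMap.mul ℂ ℂ) b f x
        = (𝓕⁻ (𝓕 (convolution (ContinuousLinearMap.mul ℂ ℂ) b f)) : 𝓢(Plane, ℂ)) x := by simp
    rw [h3, SchwartzMap.fourier_convolution, SchwartzMap.fourierInv_coe, Real.fourierInv_eq] at h2
    simp only [MeasureTheory.convolution, pairing_apply_apply, ContinuousLinearMap.mul_apply'] at h2
    simp only [mul_comm (f _)]
    rw [← h2]
    refine integral_congr_ae (.of_forall fun ξ => ?_)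
    simp [e, Circle.smul_def, mul_comm]

/-- Multipliers can be moved from one factor of a convolution to the other. -/
lemma IsFourierMultiplier.integral_sub_mul {m : Plane → ℂ} {A : L2Plane →L[ℂ] L2Plane}
    (hA : IsFourierMultiplier m A) (f : L2Plane) {a b : L2Plane}
    (h : (𝓕 b : L2Plane) =ᵐ[volume] fun ξ => m ξ * (𝓕 a : L2Plane) ξ) (x : Plane) :
    ∫ y, f (x - y) * b y = ∫ y, (A f) (x - y) * a y := by
  rw [integral_sub_mul_eq_fourier, integral_sub_mul_eq_fourier]
  apply integral_congr_ae
  filter_upwards [h, hA f] with ξ h1 h2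
  rw [h1, h2]
  ring

/-- A first order relation `∂₁ a = ∂₂ b` in the sense of tempered distributions (with
`∂ᵢ = ∂_x + cᵢ ∂_y`) on the Fourier side. -/
lemma fourier_relation_of_integral_lineDeriv {a b : L2Plane} {c d : ℂ} (v w : Plane)
    (h : ∀ g : 𝓢(Plane, ℂ), ∫ x, a x * (∂_{v} g x + c * ∂_{w} g x)
      = ∫ x, b x * (∂_{v} g x + d * ∂_{w} g x)) :
    ∀ᵐ ξ : Plane, (𝓕 a : L2Plane) ξ * (inner ℝ ξ v + c * inner ℝ ξ w)
      = (𝓕 b : L2Plane) ξ * (inner ℝ ξ v + d * inner ℝ ξ w) := by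
  have hloc : ∀ (u : L2Plane) (c : ℂ),
      LocallyIntegrable (fun ξ : Plane => u ξ * (inner ℝ ξ v + c * inner ℝ ξ w)) volume := by
    intro u c
    have : LocallyIntegrable u volume := (Lp.memLp u).locallyIntegrable (by norm_num)
    exact this.smul_continuous (g := fun ξ : Plane => ((inner ℝ ξ v : ℝ) + c * (inner ℝ ξ w : ℝ) : ℂ))
      (by fun_prop)
  refine ae_eq_of_integral_contDiff_smul_eq (hloc _ _) (hloc _ _) ?_
  intro η hη hηc
  have hη' : ContDiff ℝ ∞ (fun x => (η x : ℂ)) := Complex.ofRealCLM.contDiff.comp hη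
  have hηc' : HasCompactSupport (fun x => (η x : ℂ)) := hηc.comp_left (g := Complex.ofReal) rfl
  let η' : 𝓢(Plane, ℂ) := hηc'.toSchwartzMap hη'
  have hv : (fun ξ : Plane => inner ℝ ξ v).HasTemperateGrowth := by fun_prop
  have hw : (fun ξ : Plane => inner ℝ ξ w).HasTemperateGrowth := by fun_prop
  -- The test functions are the Fourier transforms of bumps η: a derivative of 𝓕 η is 𝓕 of a linear
  -- function times η, and self-adjointness moves 𝓕 onto u. Since η is arbitrary, the relation holds
  -- almost everywhere.
  have key : ∀ (u : L2Plane) (c : ℂ),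
      ∫ x, u x * (∂_{v} (𝓕 η') x + c * ∂_{w} (𝓕 η') x)
      = -(2 * Real.pi * Complex.I) *
        ∫ ξ, η ξ • ((𝓕 u : L2Plane) ξ * (inner ℝ ξ v + c * inner ℝ ξ w)) := by
    intro u c
    rw [lineDerivOp_fourier_eq, lineDerivOp_fourier_eq]
    have e : ∀ x, (𝓕 (-(2 * Real.pi * Complex.I) • smulLeftCLM ℂ (fun ξ => inner ℝ ξ v) η')) x
        + c * (𝓕 (-(2 * Real.pi * Complex.I) • smulLeftCLM ℂ (fun ξ => inner ℝ ξ w) η')) x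
        = (𝓕 (-(2 * Real.pi * Complex.I) • (smulLeftCLM ℂ (fun ξ => inner ℝ ξ v) η'
          + c • smulLeftCLM ℂ (fun ξ => inner ℝ ξ w) η'))) x := by
      intro x
      simp only [FourierTransform.fourier_add, FourierTransform.fourier_smul, smul_add]
      simp
      ring
    simp_rw [e]
    rw [← integral_fourier_mul_schwartz, ← integral_const_mul]
    refine integral_congr_ae (.of_forall fun ξ => ?_)
    simp only [_root_.smul_apply, _root_.add_apply, smulLeftCLM_apply_apply hv,
      smulLeftCLM_apply_apply hw, η', HasCompactSupport.toSchwartzMap_toFun, smul_eq_mul,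
      Complex.real_smul]
    ring
  have h' := h (𝓕 η')
  rw [key, key] at h'
  exact mul_left_cancel₀ (by simp [Real.pi_ne_zero]) h'

end

section

open FourierTransform SchwartzMap LineDeriv

/-! ### Poisson type kernels -/

/-- The complex coordinate `x + w y`, where `w = ± i`. -/
def planeCoord (w : ℂ) (z : Plane) : ℂ := z 0 + w * z 1

/-- The radius `√(ε² + |z|²)`. -/
def poissonRadius (ε : ℝ) (z : Plane) : ℝ := √(ε ^ 2 + ‖z‖ ^ 2)

/-- The point `(x + w y) / (ε + √(ε² + |z|²))` of the unit disc. -/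
def discPoint (w : ℂ) (ε : ℝ) (z : Plane) : ℂ := planeCoord w z / (ε + poissonRadius ε z)

/-- The kernel `ε G(τ)/s³ + τ G'(τ)/s²` with `s = √(ε² + |z|²)` and `τ = (x + w y)/(ε + s)`. For
`G = 1` it is `2π` times the Poisson kernel. -/
def discKernel (w : ℂ) (G : ℂ → ℂ) (ε : ℝ) (z : Plane) : ℂ :=
  ε * G (discPoint w ε z) / poissonRadius ε z ^ 3
    + discPoint w ε z * deriv G (discPoint w ε z) / poissonRadius ε z ^ 2

lemma norm_sq_plane (z : Plane) : ‖z‖ ^ 2 = z 0 ^ 2 + z 1 ^ 2 := by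
  rw [EuclideanSpace.real_norm_sq_eq, Fin.sum_univ_two]

section

variable {w : ℂ} {ε : ℝ}

lemma planeCoord_mul_neg (hw : w ^ 2 = -1) (z : Plane) :
    planeCoord w z * planeCoord (-w) z = (‖z‖ ^ 2 : ℝ) := by
  rw [norm_sq_plane]
  push_cast
  simp only [planeCoord]
  linear_combination -(z 1 : ℂ) ^ 2 * hw

lemma conj_eq_neg (hw : w ^ 2 = -1) : starRingEnd ℂ w = -w := by
  have h : (w - Complex.I) * (w + Complex.I) = 0 := by
    linear_combination hw - Complex.I_sq
  rcases mul_eq_zero.1 h with h | h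
  · rw [sub_eq_zero.1 h]
    simp
  · rw [eq_neg_of_add_eq_zero_left h]
    simp

lemma conj_planeCoord (hw : w ^ 2 = -1) (z : Plane) :
    starRingEnd ℂ (planeCoord w z) = planeCoord (-w) z := by
  simp [planeCoord, conj_eq_neg hw]

lemma norm_planeCoord (hw : w ^ 2 = -1) (z : Plane) : ‖planeCoord w z‖ = ‖z‖ := by
  have h := planeCoord_mul_neg hw z
  rw [← conj_planeCoord hw, Complex.mul_conj, Complex.normSq_eq_norm_sq] at h
  have h' : ‖planeCoord w z‖ ^ 2 = ‖z‖ ^ 2 := by exact_mod_cast h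
  exact (pow_left_inj₀ (norm_nonneg _) (norm_nonneg _) two_ne_zero).1 h'

lemma planeCoord_ne_zero (hw : w ^ 2 = -1) {z : Plane} (hz : z ≠ 0) : planeCoord w z ≠ 0 := by
  rw [← norm_ne_zero_iff, norm_planeCoord hw]
  exact norm_ne_zero_iff.2 hz

lemma continuous_planeCoord : Continuous (planeCoord w) := by
  unfold planeCoord
  fun_prop

lemma poissonRadius_sq (ε : ℝ) (z : Plane) : poissonRadius ε z ^ 2 = ε ^ 2 + ‖z‖ ^ 2 :=
  Real.sq_sqrt (by positivity)

lemma poissonRadius_pos (hε : 0 < ε) (z : Plane) : 0 < poissonRadius ε z :=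
  Real.sqrt_pos.2 (by positivity)

lemma le_poissonRadius (ε : ℝ) (z : Plane) : ε ≤ poissonRadius ε z :=
  Real.le_sqrt_of_sq_le (by nlinarith [sq_nonneg ‖z‖])

lemma norm_le_poissonRadius (ε : ℝ) (z : Plane) : ‖z‖ ≤ poissonRadius ε z :=
  Real.le_sqrt_of_sq_le (by nlinarith [sq_nonneg ε])

lemma poissonRadius_le (hε : 0 < ε) (z : Plane) : poissonRadius ε z ≤ ε + ‖z‖ :=
  Real.sqrt_le_iff.2 ⟨by positivity, by nlinarith [norm_nonneg z]⟩

lemma continuous_poissonRadius : Continuous (poissonRadius ε) := by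
  unfold poissonRadius
  fun_prop

lemma norm_discPoint (hw : w ^ 2 = -1) (hε : 0 < ε) (z : Plane) :
    ‖discPoint w ε z‖ = ‖z‖ / (ε + poissonRadius ε z) := by
  have := poissonRadius_pos hε z
  rw [discPoint, norm_div, norm_planeCoord hw, ← Complex.ofReal_add, Complex.norm_real,
    Real.norm_of_nonneg (by positivity)]

lemma norm_discPoint_lt_one (hw : w ^ 2 = -1) (hε : 0 < ε) (z : Plane) :
    ‖discPoint w ε z‖ < 1 := by
  have := poissonRadius_pos hε z
  rw [norm_discPoint hw hε, div_lt_one (by positivity)]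
  linarith [norm_le_poissonRadius ε z]

lemma continuous_discPoint (hε : 0 < ε) : Continuous (discPoint w ε) := by
  refine continuous_planeCoord.div₀ (continuous_const.add
    (Complex.continuous_ofReal.comp continuous_poissonRadius)) fun z => ?_
  have := poissonRadius_pos hε z
  rw [← Complex.ofReal_add]
  exact_mod_cast (by positivity : ε + poissonRadius ε z ≠ 0)

lemma hasDerivAt_poissonRadius (hε : 0 < ε) (z v : Plane) :
    HasDerivAt (fun t : ℝ => poissonRadius ε (z + t • v)) (inner ℝ z v / poissonRadius ε z) 0 := by
  have h1 : HasDerivAt (fun t : ℝ => z + t • v) v 0 := by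
    simpa using ((hasDerivAt_id (0 : ℝ)).smul_const v).const_add z
  have h2 := (h1.norm_sq.const_add (ε ^ 2)).sqrt (by positivity)
  have hs : √(ε ^ 2 + ‖z + (0 : ℝ) • v‖ ^ 2) = poissonRadius ε z := by simp [poissonRadius]
  rw [hs] at h2
  convert! h2 using 1
  rw [zero_smul, add_zero, mul_div_mul_left _ _ two_ne_zero]

lemma hasDerivAt_planeCoord (z v : Plane) :
    HasDerivAt (fun t : ℝ => planeCoord w (z + t • v)) (planeCoord w v) 0 := by
  have h : (fun t : ℝ => planeCoord w (z + t • v))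
      = fun t : ℝ => planeCoord w z + (t : ℂ) * planeCoord w v := by
    ext t
    simp [planeCoord]
    ring
  rw [h]
  simpa using ((Complex.ofRealCLM.hasDerivAt (x := 0)).mul_const (planeCoord w v)).const_add
    (planeCoord w z)

lemma hasDerivAt_discPoint (hε : 0 < ε) (z v : Plane) :
    HasDerivAt (fun t : ℝ => discPoint w ε (z + t • v))
      ((planeCoord w v - discPoint w ε z * inner ℝ z v / poissonRadius ε z)
        / (ε + poissonRadius ε z)) 0 := by
  have hs := poissonRadius_pos hε z
  have hs' : (ε : ℂ) + poissonRadius ε z ≠ 0 := by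
    exact_mod_cast (by positivity : ε + poissonRadius ε z ≠ 0)
  have h := (hasDerivAt_planeCoord (w := w) z v).div
    ((hasDerivAt_poissonRadius hε z v).ofReal_comp.const_add (ε : ℂ)) (by simpa using hs')
  convert! h using 1
  simp only [zero_smul, add_zero, discPoint]
  push_cast
  field_simp

variable {G : ℂ → ℂ} {R : ℝ}

lemma discPoint_mem_ball (hw : w ^ 2 = -1) (hε : 0 < ε) (hR : 1 < R) (z : Plane) :
    discPoint w ε z ∈ Metric.ball (0 : ℂ) R := by
  rw [mem_ball_zero_iff]
  exact (norm_discPoint_lt_one hw hε z).trans hR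

lemma hasDerivAt_of_differentiableOn_ball (hG : DifferentiableOn ℂ G (Metric.ball 0 R)) {τ : ℂ}
    (hτ : τ ∈ Metric.ball (0 : ℂ) R) : HasDerivAt G (deriv G τ) τ :=
  (hG.differentiableAt (Metric.isOpen_ball.mem_nhds hτ)).hasDerivAt

/-- The directional derivative of `τ G(τ)/s`. -/
def poissonPotentialDeriv (w : ℂ) (G : ℂ → ℂ) (ε : ℝ) (v z : Plane) : ℂ :=
  (G (discPoint w ε z) + discPoint w ε z * deriv G (discPoint w ε z))
      * (planeCoord w v - discPoint w ε z * inner ℝ z v / poissonRadius ε z)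
      / (ε + poissonRadius ε z) / poissonRadius ε z
    - discPoint w ε z * G (discPoint w ε z) * inner ℝ z v / poissonRadius ε z ^ 3

lemma hasLineDerivAt_poissonPotential (hw : w ^ 2 = -1) (hε : 0 < ε) (hR : 1 < R)
    (hG : DifferentiableOn ℂ G (Metric.ball 0 R)) (z v : Plane) :
    HasLineDerivAt ℝ (fun z => discPoint w ε z * G (discPoint w ε z) / poissonRadius ε z)
      (poissonPotentialDeriv w G ε v z) z v := by
  have hs := poissonRadius_pos hε z
  have hs0 : (poissonRadius ε z : ℂ) ≠ 0 := by exact_mod_cast hs.ne'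
  have hs' : (ε : ℂ) + poissonRadius ε z ≠ 0 := by
    exact_mod_cast (by positivity : ε + poissonRadius ε z ≠ 0)
  have hτ := hasDerivAt_discPoint (w := w) hε z v
  have hGτ := HasDerivAt.scomp_of_eq (y := discPoint w ε z) 0
    (hasDerivAt_of_differentiableOn_ball hG (discPoint_mem_ball hw hε hR z)) hτ (by simp)
  have h := (hτ.mul hGτ).div (hasDerivAt_poissonRadius hε z v).ofReal_comp (by simpa using hs0)
  unfold HasLineDerivAt
  convert! h using 1
  simp only [zero_smul, add_zero, Function.comp, smul_eq_mul, poissonPotentialDeriv, Pi.mul_apply]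
  push_cast
  field_simp

end

/-- The coordinate vectors of the plane. -/
def planeBasis (i : Fin 2) : Plane := EuclideanSpace.single i 1

lemma inner_planeBasis (z : Plane) (i : Fin 2) : inner ℝ z (planeBasis i) = z i := by
  simp [planeBasis, EuclideanSpace.inner_single_right]

lemma planeCoord_planeBasis_zero (w : ℂ) : planeCoord w (planeBasis 0) = 1 := by
  simp [planeCoord, planeBasis]

lemma planeCoord_planeBasis_one (w : ℂ) : planeCoord w (planeBasis 1) = w := by
  simp [planeCoord, planeBasis]

section

variable {w : ℂ} {ε : ℝ} {G : ℂ → ℂ} {R : ℝ}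

/-- |z|² = (s - ε)(s + ε), and the second factor is the denominator of τ. -/
lemma discPoint_mul_neg (hw : w ^ 2 = -1) (hε : 0 < ε) (z : Plane) :
    discPoint w ε z * planeCoord (-w) z = poissonRadius ε z - ε := by
  have hs := poissonRadius_pos hε z
  have hs' : (ε : ℂ) + poissonRadius ε z ≠ 0 := by
    exact_mod_cast (by positivity : ε + poissonRadius ε z ≠ 0)
  have h := planeCoord_mul_neg hw z
  have h2 : (‖z‖ ^ 2 : ℝ) = (poissonRadius ε z : ℂ) ^ 2 - ε ^ 2 := by
    have := poissonRadius_sq ε z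
    rw [show ‖z‖ ^ 2 = poissonRadius ε z ^ 2 - ε ^ 2 by linarith]
    push_cast
    ring
  rw [discPoint, div_mul_eq_mul_div, h, h2]
  field_simp
  ring

/-- `discKernel` is the image of the potential τG(τ)/s under ∂_x - w∂_y. Here 1 - w² = 2, and the
radial terms combine through τ(x - wy) = s - ε. -/
lemma poissonPotentialDeriv_sub (hw : w ^ 2 = -1) (hε : 0 < ε) (z : Plane) :
    poissonPotentialDeriv w G ε (planeBasis 0) z - w * poissonPotentialDeriv w G ε (planeBasis 1) z
      = discKernel w G ε z := by
  have hs := poissonRadius_pos hε z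
  have hs0 : (poissonRadius ε z : ℂ) ≠ 0 := by exact_mod_cast hs.ne'
  have hs' : (ε : ℂ) + poissonRadius ε z ≠ 0 := by
    exact_mod_cast (by positivity : ε + poissonRadius ε z ≠ 0)
  have h := discPoint_mul_neg hw hε z
  have h1 : discPoint w ε z * z 0 - w * (discPoint w ε z * z 1) = poissonRadius ε z - ε := by
    rw [← h, planeCoord]
    ring
  simp only [poissonPotentialDeriv, discKernel, inner_planeBasis, planeCoord_planeBasis_zero,
    planeCoord_planeBasis_one]
  generalize discPoint w ε z = τ at *
  generalize (poissonRadius ε z : ℂ) = s at *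
  have h2 : (G τ + τ * deriv G τ) * (2 - (s - ε) / s) / (ε + s) / s - G τ * (s - ε) / s ^ 3
      = ε * G τ / s ^ 3 + τ * deriv G τ / s ^ 2 := by
    field_simp
    ring
  linear_combination h2 - (G τ + τ * deriv G τ) / (ε + s) / s * hw
    - ((G τ + τ * deriv G τ) / (ε + s) / s ^ 2 + G τ / s ^ 3) * h1

/-- The conjugate operator ∂_x + w∂_y kills x + wy because 1 + w² = 0; what remains is radial and
simplifies by x + wy = τ(ε + s). The same potential thus links the kernels of G and of τ²G. -/
lemma poissonPotentialDeriv_add (hw : w ^ 2 = -1) (hε : 0 < ε) (hR : 1 < R)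
    (hG : DifferentiableOn ℂ G (Metric.ball 0 R)) (z : Plane) :
    poissonPotentialDeriv w G ε (planeBasis 0) z + w * poissonPotentialDeriv w G ε (planeBasis 1) z
      = - discKernel w (fun τ => τ ^ 2 * G τ) ε z := by
  have hs := poissonRadius_pos hε z
  have hs0 : (poissonRadius ε z : ℂ) ≠ 0 := by exact_mod_cast hs.ne'
  have hs' : (ε : ℂ) + poissonRadius ε z ≠ 0 := by
    exact_mod_cast (by positivity : ε + poissonRadius ε z ≠ 0)
  have h : planeCoord w z = discPoint w ε z * (ε + poissonRadius ε z) := by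
    rw [discPoint, div_mul_cancel₀ _ hs']
  have h1 : z 0 + w * z 1 = discPoint w ε z * (ε + poissonRadius ε z) := by
    rw [← h, planeCoord]
  have hd : deriv (fun τ => τ ^ 2 * G τ) (discPoint w ε z)
      = 2 * discPoint w ε z * G (discPoint w ε z)
        + discPoint w ε z ^ 2 * deriv G (discPoint w ε z) := by
    have := (hasDerivAt_pow 2 (discPoint w ε z)).mul
      (hasDerivAt_of_differentiableOn_ball hG (discPoint_mem_ball hw hε hR z))
    rw [show (fun τ => τ ^ 2 * G τ) = (fun τ => τ ^ 2) * G from rfl, this.deriv]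
    simp
  simp only [poissonPotentialDeriv, discKernel, inner_planeBasis, planeCoord_planeBasis_zero,
    planeCoord_planeBasis_one, hd]
  generalize discPoint w ε z = τ at *
  generalize (poissonRadius ε z : ℂ) = s at *
  have h2 : (G τ + τ * deriv G τ) * (0 - τ * (τ * (ε + s)) / s) / (ε + s) / s
      - τ * G τ * (τ * (ε + s)) / s ^ 3
      = -(ε * (τ ^ 2 * G τ) / s ^ 3
        + τ * (2 * τ * G τ + τ ^ 2 * deriv G τ) / s ^ 2) := by
    field_simp
    ring
  linear_combination h2 + (G τ + τ * deriv G τ) / (ε + s) / s * hw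
    - ((G τ + τ * deriv G τ) * τ / (ε + s) / s ^ 2 + τ * G τ / s ^ 3) * h1
end

end

/-! ### Bounds, integration by parts and the Beurling relation for the disc kernels -/

section

open FourierTransform SchwartzMap LineDeriv

/-- On the Fourier side both derivatives are multiplications by linear functions, which commute. -/
lemma SchwartzMap.lineDerivOp_comm (g : 𝓢(Plane, ℂ)) (v w : Plane) :
    ∂_{v} (∂_{w} g) = ∂_{w} (∂_{v} g) := by
  have h : (𝓕 (∂_{v} (∂_{w} g)) : 𝓢(Plane, ℂ)) = 𝓕 (∂_{w} (∂_{v} g)) := by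
    have hv : (fun ξ : Plane => inner ℝ ξ v).HasTemperateGrowth := by fun_prop
    have hw : (fun ξ : Plane => inner ℝ ξ w).HasTemperateGrowth := by fun_prop
    ext ξ
    simp only [fourier_lineDerivOp_eq, _root_.smul_apply, smulLeftCLM_apply_apply hv,
      smulLeftCLM_apply_apply hw, smul_eq_mul, Complex.real_smul]
    ring
  exact (fourierEquiv ℂ 𝓢(Plane, ℂ)).injective h

section

variable {w : ℂ} {ε : ℝ} {G : ℂ → ℂ} {R : ℝ}

/-- With c = min(1, ε), s ≥ c√(1 + |z|²), and a power above the dimension 2 is integrable. -/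
lemma integrable_inv_poissonRadius_pow (hε : 0 < ε) {n : ℕ} (hn : 2 < n) :
    Integrable (fun z : Plane => (poissonRadius ε z ^ n)⁻¹) volume := by
  have h1 : Integrable (fun z : Plane => (1 + ‖z‖ ^ 2) ^ (-(n : ℝ) / 2)) volume :=
    integrable_rpow_neg_one_add_norm_sq (by simpa using hn)
  let c : ℝ := min 1 ε
  have hc : 0 < c := lt_min one_pos hε
  refine (h1.const_mul (c ^ n)⁻¹).mono' ?_ (.of_forall fun z => ?_)
  · exact ((continuous_poissonRadius.pow n).inv₀
      fun z => (pow_pos (poissonRadius_pos hε z) n).ne').aestronglyMeasurable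
  · have hs := poissonRadius_pos hε z
    have h2 : c * √(1 + ‖z‖ ^ 2) ≤ poissonRadius ε z := by
      apply Real.le_sqrt_of_sq_le
      rw [mul_pow, Real.sq_sqrt (by positivity)]
      have h3 : c ^ 2 ≤ 1 := pow_le_one₀ hc.le (min_le_left _ _)
      have h4 : c ^ 2 ≤ ε ^ 2 := pow_le_pow_left₀ hc.le (min_le_right _ _) 2
      nlinarith [sq_nonneg ‖z‖]
    have h5 : (1 + ‖z‖ ^ 2) ^ (-(n : ℝ) / 2) = (√(1 + ‖z‖ ^ 2) ^ n)⁻¹ := by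
      rw [Real.sqrt_eq_rpow, ← Real.rpow_natCast _ n, ← Real.rpow_mul (by positivity),
        ← Real.rpow_neg (by positivity)]
      congr 1
      ring
    rw [h5, Real.norm_of_nonneg (by positivity), ← mul_inv, ← mul_pow]
    gcongr

lemma memLp_two_of_norm_le_poissonRadius {f : Plane → ℂ} (hε : 0 < ε)
    (hf : AEStronglyMeasurable f volume) {C : ℝ} (h : ∀ z, ‖f z‖ ≤ C / poissonRadius ε z ^ 2) :
    MemLp f 2 volume := by
  rw [memLp_two_iff_integrable_sq_norm hf]
  refine ((integrable_inv_poissonRadius_pow hε (n := 4) (by norm_num)).const_mul (C ^ 2)).mono'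
    (hf.norm.pow 2) (.of_forall fun z => ?_)
  rw [Real.norm_of_nonneg (by positivity)]
  calc ‖f z‖ ^ 2 ≤ (C / poissonRadius ε z ^ 2) ^ 2 := pow_le_pow_left₀ (norm_nonneg _) (h z) 2
    _ = C ^ 2 * (poissonRadius ε z ^ 4)⁻¹ := by rw [div_pow, ← pow_mul, div_eq_mul_inv]

/-- The margin R > 1 makes the closed unit disc a compact subset of the domain; it contains every τ
as well as the limiting unit vectors e. -/
lemma exists_bound_of_differentiableOn_ball (hR : 1 < R)
    (hG : DifferentiableOn ℂ G (Metric.ball 0 R)) :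
    ∃ C : ℝ, 0 ≤ C ∧ ∀ τ : ℂ, ‖τ‖ ≤ 1 → ‖G τ‖ ≤ C ∧ ‖deriv G τ‖ ≤ C := by
  have hsub : Metric.closedBall (0 : ℂ) 1 ⊆ Metric.ball 0 R := Metric.closedBall_subset_ball hR
  obtain ⟨C₁, h₁⟩ := (isCompact_closedBall (0 : ℂ) 1).exists_bound_of_continuousOn
    (hG.continuousOn.mono hsub)
  obtain ⟨C₂, h₂⟩ := (isCompact_closedBall (0 : ℂ) 1).exists_bound_of_continuousOn
    ((hG.deriv Metric.isOpen_ball).continuousOn.mono hsub)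
  refine ⟨max (max C₁ C₂) 0, le_max_right _ _, fun τ hτ => ?_⟩
  have hτ' : τ ∈ Metric.closedBall (0 : ℂ) 1 := mem_closedBall_zero_iff.2 hτ
  exact ⟨(h₁ τ hτ').trans ((le_max_left _ _).trans (le_max_left _ _)),
    (h₂ τ hτ').trans ((le_max_right _ _).trans (le_max_left _ _))⟩

lemma continuous_comp_discPoint (hw : w ^ 2 = -1) (hε : 0 < ε) (hR : 1 < R)
    (hG : DifferentiableOn ℂ G (Metric.ball 0 R)) : Continuous fun z => G (discPoint w ε z) :=
  hG.continuousOn.comp_continuous (continuous_discPoint hε) (discPoint_mem_ball hw hε hR)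

lemma continuous_ofReal_poissonRadius : Continuous fun z => (poissonRadius ε z : ℂ) :=
  Complex.continuous_ofReal.comp continuous_poissonRadius

lemma ofReal_poissonRadius_ne_zero (hε : 0 < ε) (z : Plane) : (poissonRadius ε z : ℂ) ≠ 0 := by
  exact_mod_cast (poissonRadius_pos hε z).ne'

lemma add_ofReal_poissonRadius_ne_zero (hε : 0 < ε) (z : Plane) :
    (ε : ℂ) + poissonRadius ε z ≠ 0 := by
  have := poissonRadius_pos hε z
  exact_mod_cast (by positivity : ε + poissonRadius ε z ≠ 0)

lemma continuous_discKernel (hw : w ^ 2 = -1) (hε : 0 < ε) (hR : 1 < R)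
    (hG : DifferentiableOn ℂ G (Metric.ball 0 R)) : Continuous (discKernel w G ε) := by
  have h1 := continuous_comp_discPoint hw hε hR hG
  have h2 := continuous_comp_discPoint hw hε hR (hG.deriv Metric.isOpen_ball)
  have h3 := continuous_discPoint (w := w) hε
  have h4 := continuous_ofReal_poissonRadius (ε := ε)
  unfold discKernel
  exact ((continuous_const.mul h1).div₀ (h4.pow 3)
      fun z => pow_ne_zero _ (ofReal_poissonRadius_ne_zero hε z)).add
    ((h3.mul h2).div₀ (h4.pow 2) fun z => pow_ne_zero _ (ofReal_poissonRadius_ne_zero hε z))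

/-- In the first term ε ≤ s absorbs one power of s, and in the second |τ| < 1. The constant does not
depend on ε. -/
lemma exists_norm_discKernel_le (hw : w ^ 2 = -1) (hR : 1 < R)
    (hG : DifferentiableOn ℂ G (Metric.ball 0 R)) :
    ∃ C : ℝ, 0 ≤ C ∧ ∀ ε : ℝ, 0 < ε → ∀ z, ‖discKernel w G ε z‖ ≤ C / poissonRadius ε z ^ 2 := by
  obtain ⟨C, hC0, hC⟩ := exists_bound_of_differentiableOn_ball hR hG
  refine ⟨C + C, by positivity, fun ε hε z => ?_⟩
  have hs := poissonRadius_pos hε z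
  have hτ := (norm_discPoint_lt_one hw hε z).le
  obtain ⟨h1, h2⟩ := hC _ hτ
  refine (norm_add_le _ _).trans ?_
  rw [add_div]
  refine add_le_add ?_ ?_
  · rw [norm_div, norm_mul, norm_pow, Complex.norm_real, Complex.norm_real,
      Real.norm_of_nonneg hε.le, Real.norm_of_nonneg hs.le, div_le_div_iff₀ (by positivity)
      (by positivity)]
    have h3 : ε * ‖G (discPoint w ε z)‖ ≤ poissonRadius ε z * C :=
      mul_le_mul (le_poissonRadius ε z) h1 (norm_nonneg _) hs.le
    nlinarith [pow_pos hs 2]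
  · rw [norm_div, norm_mul, norm_pow, Complex.norm_real, Real.norm_of_nonneg hs.le]
    gcongr
    calc _ ≤ 1 * C := mul_le_mul hτ h2 (norm_nonneg _) zero_le_one
      _ = C := one_mul C

lemma memLp_discKernel (hw : w ^ 2 = -1) (hε : 0 < ε) (hR : 1 < R)
    (hG : DifferentiableOn ℂ G (Metric.ball 0 R)) : MemLp (discKernel w G ε) 2 volume := by
  obtain ⟨C, -, hC⟩ := exists_norm_discKernel_le hw hR hG
  exact memLp_two_of_norm_le_poissonRadius hε
    (continuous_discKernel hw hε hR hG).aestronglyMeasurable (hC ε hε)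

lemma exists_norm_poissonPotentialDeriv_le (hw : w ^ 2 = -1) (hε : 0 < ε) (hR : 1 < R)
    (hG : DifferentiableOn ℂ G (Metric.ball 0 R)) (v : Plane) :
    ∃ C : ℝ, ∀ z, ‖poissonPotentialDeriv w G ε v z‖ ≤ C := by
  obtain ⟨C, hC0, hC⟩ := exists_bound_of_differentiableOn_ball hR hG
  refine ⟨(C + 1 * C) * (‖v‖ + 1 * ‖v‖) / ε / ε + 1 * C * ‖v‖ / ε ^ 2, fun z => ?_⟩
  have hs := poissonRadius_pos hε z
  have hτ := (norm_discPoint_lt_one hw hε z).le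
  obtain ⟨h1, h2⟩ := hC _ hτ
  have hin : ‖((inner ℝ z v : ℝ) : ℂ)‖ ≤ poissonRadius ε z * ‖v‖ := by
    rw [Complex.norm_real]
    exact (norm_inner_le_norm z v).trans (by gcongr; exact norm_le_poissonRadius ε z)
  have hsε := le_poissonRadius ε z
  refine (norm_sub_le _ _).trans (add_le_add ?_ ?_)
  · rw [norm_div, norm_div, norm_mul, ← Complex.ofReal_add, Complex.norm_real, Complex.norm_real,
      Real.norm_of_nonneg hs.le, Real.norm_of_nonneg (by positivity)]
    have h3 : ‖G (discPoint w ε z) + discPoint w ε z * deriv G (discPoint w ε z)‖ ≤ C + 1 * C := by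
      refine (norm_add_le _ _).trans (add_le_add h1 ?_)
      rw [norm_mul]
      exact mul_le_mul hτ h2 (norm_nonneg _) zero_le_one
    have h4 : ‖planeCoord w v - discPoint w ε z * (inner ℝ z v : ℝ) / poissonRadius ε z‖
        ≤ ‖v‖ + 1 * ‖v‖ := by
      refine (norm_sub_le _ _).trans (add_le_add (norm_planeCoord hw v).le ?_)
      rw [mul_div_assoc, norm_mul]
      refine mul_le_mul hτ ?_ (norm_nonneg _) zero_le_one
      rw [norm_div, Complex.norm_real (poissonRadius ε z), Real.norm_of_nonneg hs.le,
        div_le_iff₀ hs, mul_comm]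
      exact hin
    gcongr
    linarith
  · rw [norm_div, norm_mul, norm_mul, norm_pow, Complex.norm_real (poissonRadius ε z),
      Real.norm_of_nonneg hs.le, div_le_div_iff₀ (by positivity) (by positivity)]
    have h3 : ‖discPoint w ε z‖ * ‖G (discPoint w ε z)‖ ≤ 1 * C :=
      mul_le_mul hτ h1 (norm_nonneg _) zero_le_one
    calc _ ≤ (1 * C) * (poissonRadius ε z * ‖v‖) * poissonRadius ε z ^ 2 := by gcongr
      _ = _ := by ring

lemma continuous_poissonPotentialDeriv (hw : w ^ 2 = -1) (hε : 0 < ε) (hR : 1 < R)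
    (hG : DifferentiableOn ℂ G (Metric.ball 0 R)) (v : Plane) :
    Continuous (poissonPotentialDeriv w G ε v) := by
  have h1 := continuous_comp_discPoint hw hε hR hG
  have h2 := continuous_comp_discPoint hw hε hR (hG.deriv Metric.isOpen_ball)
  have h3 := continuous_discPoint (w := w) hε
  have h4 := continuous_ofReal_poissonRadius (ε := ε)
  have h5 : Continuous fun z : Plane => ((inner ℝ z v : ℝ) : ℂ) := by fun_prop
  have hs := ofReal_poissonRadius_ne_zero hε
  have hs' := add_ofReal_poissonRadius_ne_zero hε
  unfold poissonPotentialDeriv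
  exact ((((h1.add (h3.mul h2)).mul (continuous_const.sub ((h3.mul h5).div₀ h4 hs))).div₀
    (continuous_const.add h4) hs').div₀ h4 hs).sub
    (((h3.mul h1).mul h5).div₀ (h4.pow 3) fun z => pow_ne_zero _ (hs z))

lemma integrable_mul_schwartz {f : Plane → ℂ} (hf : Continuous f) {C : ℝ} (hC : ∀ z, ‖f z‖ ≤ C)
    (g : 𝓢(Plane, ℂ)) : Integrable (fun z => f z * g z) volume :=
  g.integrable.bdd_mul hf.aestronglyMeasurable (.of_forall hC)

lemma integrable_poissonPotential_mul (hw : w ^ 2 = -1) (hε : 0 < ε) (hR : 1 < R)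
    (hG : DifferentiableOn ℂ G (Metric.ball 0 R)) (g : 𝓢(Plane, ℂ)) :
    Integrable (fun z => discPoint w ε z * G (discPoint w ε z) / poissonRadius ε z * g z)
      volume := by
  obtain ⟨C, hC0, hC⟩ := exists_bound_of_differentiableOn_ball hR hG
  have hcont : Continuous fun z => discPoint w ε z * G (discPoint w ε z) / poissonRadius ε z :=
    ((continuous_discPoint hε).mul (continuous_comp_discPoint hw hε hR hG)).div₀
      continuous_ofReal_poissonRadius (ofReal_poissonRadius_ne_zero hε)
  refine integrable_mul_schwartz hcont (C := 1 * C / ε) (fun z => ?_) g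
  have hs := poissonRadius_pos hε z
  have hτ := (norm_discPoint_lt_one hw hε z).le
  rw [norm_div, norm_mul, Complex.norm_real, Real.norm_of_nonneg hs.le]
  have := (hC _ hτ).1
  have := le_poissonRadius ε z
  gcongr

lemma integrable_poissonPotentialDeriv_mul (hw : w ^ 2 = -1) (hε : 0 < ε) (hR : 1 < R)
    (hG : DifferentiableOn ℂ G (Metric.ball 0 R)) (v : Plane) (g : 𝓢(Plane, ℂ)) :
    Integrable (fun z => poissonPotentialDeriv w G ε v z * g z) volume := by
  obtain ⟨C', hC'⟩ := exists_norm_poissonPotentialDeriv_le hw hε hR hG v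
  exact integrable_mul_schwartz (continuous_poissonPotentialDeriv hw hε hR hG v) hC' g

lemma integral_poissonPotential_mul_lineDeriv (hw : w ^ 2 = -1) (hε : 0 < ε) (hR : 1 < R)
    (hG : DifferentiableOn ℂ G (Metric.ball 0 R)) (v : Plane) (g : 𝓢(Plane, ℂ)) :
    ∫ z, discPoint w ε z * G (discPoint w ε z) / poissonRadius ε z * ∂_{v} g z
      = -∫ z, poissonPotentialDeriv w G ε v z * g z := by
  refine integral_bilinear_hasLineDerivAt_right_eq_neg_left_of_integrable (μ := volume)
    (B := ContinuousLinearMap.mul ℝ ℂ) (f := fun z => discPoint w ε z * G (discPoint w ε z) /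
      poissonRadius ε z) (f' := poissonPotentialDeriv w G ε v) (g := g)
      (g' := fun z => ∂_{v} g z) (v := v) ?_ ?_ ?_ ?_ ?_
  · exact integrable_poissonPotentialDeriv_mul hw hε hR hG v g
  · exact integrable_poissonPotential_mul hw hε hR hG (∂_{v} g)
  · exact integrable_poissonPotential_mul hw hε hR hG g
  · intro x _
    exact hasLineDerivAt_poissonPotential hw hε hR hG x v
  · intro x _
    rw [SchwartzMap.lineDerivOp_apply]
    exact (g.differentiableAt.lineDifferentiableAt).hasLineDerivAt

lemma integral_poissonPotential_mul_lineDeriv_add (hw : w ^ 2 = -1) (hε : 0 < ε) (hR : 1 < R)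
    (hG : DifferentiableOn ℂ G (Metric.ball 0 R)) (c : ℂ) (g : 𝓢(Plane, ℂ)) :
    ∫ z, discPoint w ε z * G (discPoint w ε z) / poissonRadius ε z
        * (∂_{planeBasis 0} g + c • ∂_{planeBasis 1} g) z
      = -∫ z, (poissonPotentialDeriv w G ε (planeBasis 0) z
          + c * poissonPotentialDeriv w G ε (planeBasis 1) z) * g z := by
  have e1 : ∀ z, discPoint w ε z * G (discPoint w ε z) / poissonRadius ε z
        * (∂_{planeBasis 0} g + c • ∂_{planeBasis 1} g) z
      = discPoint w ε z * G (discPoint w ε z) / poissonRadius ε z * ∂_{planeBasis 0} g z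
        + c * (discPoint w ε z * G (discPoint w ε z) / poissonRadius ε z
          * ∂_{planeBasis 1} g z) := by
    intro z
    simp only [_root_.add_apply, _root_.smul_apply, smul_eq_mul]
    ring
  have e2 : ∀ z, (poissonPotentialDeriv w G ε (planeBasis 0) z
          + c * poissonPotentialDeriv w G ε (planeBasis 1) z) * g z
      = poissonPotentialDeriv w G ε (planeBasis 0) z * g z
        + c * (poissonPotentialDeriv w G ε (planeBasis 1) z * g z) := fun z => by ring
  simp_rw [e1, e2]
  rw [integral_add (integrable_poissonPotential_mul hw hε hR hG _)
      ((integrable_poissonPotential_mul hw hε hR hG _).const_mul c),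
    integral_add (integrable_poissonPotentialDeriv_mul hw hε hR hG _ _)
      ((integrable_poissonPotentialDeriv_mul hw hε hR hG _ _).const_mul c),
    integral_const_mul, integral_const_mul, integral_poissonPotential_mul_lineDeriv hw hε hR hG,
    integral_poissonPotential_mul_lineDeriv hw hε hR hG]
  ring

/-- Multiplying `G` by `τ²` amounts to applying, up to sign, the Beurling transform. -/
lemma fourier_discKernel_sq_mul (hw : w ^ 2 = -1) (hε : 0 < ε) (hR : 1 < R)
    (hG : DifferentiableOn ℂ G (Metric.ball 0 R)) {a b : L2Plane}
    (ha : a =ᵐ[volume] discKernel w G ε)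
    (hb : b =ᵐ[volume] discKernel w (fun τ => τ ^ 2 * G τ) ε) :
    (𝓕 b : L2Plane) =ᵐ[volume]
      fun ξ => -(planeCoord w ξ / planeCoord (-w) ξ) * (𝓕 a : L2Plane) ξ := by
  have key : ∀ g : 𝓢(Plane, ℂ),
      ∫ x, a x * (∂_{planeBasis 0} g x + w * ∂_{planeBasis 1} g x)
      = ∫ x, (-b) x * (∂_{planeBasis 0} g x + (-w) * ∂_{planeBasis 1} g x) := by
    intro g
    have h1 : ∀ c : ℂ, ∀ x, (∂_{planeBasis 0} g x + c * ∂_{planeBasis 1} g x)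
        = (∂_{planeBasis 0} g + c • ∂_{planeBasis 1} g) x := fun c x => by simp
    -- The potential is tested against the second order expression (∂_x - w∂_y)(∂_x + w∂_y)g. Since
    -- the factors commute, either one can be moved onto the potential; one choice yields a, the
    -- other -b.
    have e1 := integral_poissonPotential_mul_lineDeriv_add hw hε hR hG (-w)
      (∂_{planeBasis 0} g + w • ∂_{planeBasis 1} g)
    have e2 := integral_poissonPotential_mul_lineDeriv_add hw hε hR hG w
      (∂_{planeBasis 0} g + (-w) • ∂_{planeBasis 1} g)
    have comm : (∂_{planeBasis 0} (∂_{planeBasis 0} g + w • ∂_{planeBasis 1} g)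
          + (-w) • ∂_{planeBasis 1} (∂_{planeBasis 0} g + w • ∂_{planeBasis 1} g) : 𝓢(Plane, ℂ))
        = ∂_{planeBasis 0} (∂_{planeBasis 0} g + (-w) • ∂_{planeBasis 1} g)
          + w • ∂_{planeBasis 1} (∂_{planeBasis 0} g + (-w) • ∂_{planeBasis 1} g) := by
      simp only [lineDerivOp_add, lineDerivOp_smul, lineDerivOp_comm g (planeBasis 1)]
      module
    rw [comm, e2, neg_inj] at e1
    simp_rw [h1]
    have e3 : ∫ x, a x * (∂_{planeBasis 0} g + w • ∂_{planeBasis 1} g) x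
        = ∫ x, (poissonPotentialDeriv w G ε (planeBasis 0) x
          + -w * poissonPotentialDeriv w G ε (planeBasis 1) x)
            * (∂_{planeBasis 0} g + w • ∂_{planeBasis 1} g) x := by
      refine integral_toLp_mul_toLp (ha.trans (.of_eq ?_)) .rfl
      ext x
      rw [← poissonPotentialDeriv_sub hw hε]
      ring
    have e4 : ∫ x, (-b) x * (∂_{planeBasis 0} g + (-w) • ∂_{planeBasis 1} g) x
        = ∫ x, (poissonPotentialDeriv w G ε (planeBasis 0) x
          + w * poissonPotentialDeriv w G ε (planeBasis 1) x)
            * (∂_{planeBasis 0} g + (-w) • ∂_{planeBasis 1} g) x := by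
      refine integral_toLp_mul_toLp ((Lp.coeFn_neg b).trans (hb.neg.trans (.of_eq ?_))) .rfl
      ext x
      rw [poissonPotentialDeriv_add hw hε hR hG]
      rfl
    rw [e3, e4, e1]
  have hne : ∀ᵐ ξ : Plane, ξ ≠ 0 := by simp [ae_iff]
  have hneg : (𝓕 (-b) : L2Plane) = -(𝓕 b : L2Plane) :=
    (Lp.fourierTransformₗᵢ Plane ℂ).map_neg b
  have hrel := fourier_relation_of_integral_lineDeriv (planeBasis 0) (planeBasis 1) key
  rw [hneg] at hrel
  filter_upwards [hrel, hne, Lp.coeFn_neg (𝓕 b : L2Plane)] with ξ h1 h2 h3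
  have h4 : planeCoord (-w) ξ ≠ 0 := planeCoord_ne_zero (by simpa using hw) h2
  rw [h3, Pi.neg_apply, inner_planeBasis, inner_planeBasis] at h1
  change _ * planeCoord w ξ = _ * planeCoord (-w) ξ at h1
  field_simp
  linear_combination h1

end

end

/-! ### Lebesgue points and Poisson majorants -/

/-- The mean oscillation of `g` at `x` on the scale `r`. -/
def meanOscillation (g : Plane → ℂ) (x : Plane) (r : ℝ) : ℝ≥0∞ :=
  (∫⁻ y in Metric.closedBall x r, ‖g y - g x‖ₑ) / volume (Metric.closedBall x r)

lemma ae_tendsto_meanOscillation {g : Plane → ℂ} (hg : MemLp g 2 volume) :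
    ∀ᵐ x : Plane, Tendsto (meanOscillation g x) (𝓝[>] 0) (𝓝 0) := by
  have hloc : LocallyIntegrable g volume := hg.locallyIntegrable (by norm_num)
  filter_upwards [(IsUnifLocDoublingMeasure.vitaliFamily (volume : Measure Plane) 1
    ).ae_tendsto_lintegral_enorm_sub_div hloc] with x hx
  exact hx.comp (IsUnifLocDoublingMeasure.tendsto_closedBall_filterAt volume (K := 1)
    (fun _ : ℝ => x) (fun r : ℝ => r) tendsto_id (by
      filter_upwards [self_mem_nhdsWithin] with r hr
      exact Metric.mem_closedBall_self (by simpa using (le_of_lt hr))))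

lemma volume_closedBall_plane (x : Plane) (r : ℝ) :
    volume (Metric.closedBall x r) = ENNReal.ofReal r ^ 2 * ENNReal.ofReal Real.pi :=
  EuclideanSpace.volume_closedBall_fin_two x r

/-- Small radii are controlled by convergence at the Lebesgue point. Large radii use |g| ≤ 1 + |g|²,
whose last term has finite total integral. -/
lemma exists_meanOscillation_le {g : Plane → ℂ} (hg : MemLp g 2 volume) {x : Plane}
    (hx : Tendsto (meanOscillation g x) (𝓝[>] 0) (𝓝 0)) :
    ∃ M : ℝ≥0∞, M ≠ ⊤ ∧ ∀ r : ℝ, 0 < r → meanOscillation g x r ≤ M := by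
  have h1 : ∀ᶠ r in 𝓝[>] (0 : ℝ), meanOscillation g x r ≤ 1 :=
    (hx.eventually (gt_mem_nhds zero_lt_one)).mono fun _ h => h.le
  obtain ⟨r₀, hr₀, h₀⟩ := (eventually_nhdsWithin_iff.1 h1 |> Metric.eventually_nhds_iff.1)
  have hI : ∫⁻ y, ‖g y‖ₑ ^ 2 < ⊤ := by
    have := hg.eLpNorm_lt_top
    rw [eLpNorm_lt_top_iff_lintegral_rpow_enorm_lt_top (by norm_num) (by norm_num)] at this
    simpa using this
  have hv : ∀ r : ℝ, 0 < r → volume (Metric.closedBall x r) ≠ 0 := fun r hr =>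
    (Metric.measure_closedBall_pos volume x hr).ne'
  have hv' : ∀ r : ℝ, volume (Metric.closedBall x r) ≠ ⊤ := fun r =>
    measure_closedBall_lt_top.ne
  refine ⟨max 1 (1 + ‖g x‖ₑ + (∫⁻ y, ‖g y‖ₑ ^ 2) / volume (Metric.closedBall x (r₀ / 2))),
    ?_, fun r hr => ?_⟩
  · refine (max_lt ENNReal.one_lt_top (ENNReal.add_lt_top.2 ⟨?_, ?_⟩)).ne
    · exact ENNReal.add_lt_top.2 ⟨ENNReal.one_lt_top, enorm_lt_top⟩
    · exact ENNReal.div_lt_top hI.ne (hv _ (by positivity))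
  · by_cases hlt : r < r₀
    · exact (h₀ (by rwa [Real.dist_0_eq_abs, abs_of_pos hr]) hr).trans (le_max_left _ _)
    · refine le_trans ?_ (le_max_right _ _)
      have hb : ∀ y, ‖g y - g x‖ₑ ≤ (1 + ‖g x‖ₑ) + ‖g y‖ₑ ^ 2 := by
        intro y
        refine (enorm_sub_le).trans ?_
        have : ‖g y‖ₑ ≤ 1 + ‖g y‖ₑ ^ 2 := by
          rcases le_total ‖g y‖ₑ 1 with h | h
          · exact h.trans le_self_add
          · exact (le_self_pow h two_ne_zero).trans le_add_self
        calc _ ≤ (1 + ‖g y‖ₑ ^ 2) + ‖g x‖ₑ := by gcongr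
          _ = _ := by ring
      have h2 : ∫⁻ y in Metric.closedBall x r, ‖g y - g x‖ₑ
          ≤ (1 + ‖g x‖ₑ) * volume (Metric.closedBall x r) + ∫⁻ y, ‖g y‖ₑ ^ 2 := by
        refine (lintegral_mono hb).trans ?_
        rw [lintegral_add_left measurable_const, setLIntegral_const]
        gcongr
        exact Measure.restrict_le_self
      unfold meanOscillation
      refine (ENNReal.div_le_div_right h2 _).trans ?_
      rw [ENNReal.add_div, ENNReal.mul_div_cancel_right (hv r hr) (hv' r)]
      gcongr
      linarith

/-- For the least k with |y| ≤ 2^k ε one has s ≥ 2^k ε/2: for k = 0 because s ≥ ε, and for k > 0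
because |y| > 2^(k-1) ε. The k-th coefficient is ε/(2^k ε/2)³, so this single term already suffices.
-/
lemma poissonMajorant_le_tsum {ε : ℝ} (hε : 0 < ε) (y : Plane) :
    ENNReal.ofReal (ε / poissonRadius ε y ^ 3)
      ≤ ∑' k : ℕ, (Metric.closedBall (0 : Plane) (2 ^ k * ε)).indicator
          (fun _ => ENNReal.ofReal (8 * (1 / 8) ^ k / ε ^ 2)) y := by
  have hs := poissonRadius_pos hε y
  have hex : ∃ k : ℕ, ‖y‖ ≤ 2 ^ k * ε := by
    obtain ⟨k, hk⟩ := pow_unbounded_of_one_lt (‖y‖ / ε) (one_lt_two)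
    exact ⟨k, ((div_lt_iff₀ hε).1 hk).le⟩
  classical
  let k := Nat.find hex
  have hk : ‖y‖ ≤ 2 ^ k * ε := Nat.find_spec hex
  refine le_trans ?_ (ENNReal.le_tsum k)
  rw [Set.indicator_of_mem (by simpa using hk)]
  apply ENNReal.ofReal_le_ofReal
  rw [div_le_div_iff₀ (by positivity) (by positivity)]
  have hlow : 2 ^ k * ε / 2 ≤ poissonRadius ε y := by
    rcases Nat.eq_zero_or_pos k with h0 | h0
    · rw [h0]
      linarith [le_poissonRadius ε y]
    · have := Nat.find_min hex (m := k - 1) (by omega)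
      have h2 : (2 : ℝ) ^ k = 2 ^ (k - 1) * 2 := by
        rw [← pow_succ]
        congr 1
        omega
      rw [h2]
      linarith [norm_le_poissonRadius ε y]
  have h3 := pow_le_pow_left₀ (by positivity) hlow 3
  have h4 : (8 * (1 / 8) ^ k : ℝ) * (2 ^ k * ε / 2) ^ 3 = ε ^ 3 := by
    have : ((1 / 8 : ℝ)) ^ k * (2 ^ k) ^ 3 = 1 := by
      rw [← pow_mul, mul_comm k 3, pow_mul, ← mul_pow]
      norm_num
    linear_combination ε ^ 3 * this
  calc ε * ε ^ 2 = (8 * (1 / 8) ^ k : ℝ) * (2 ^ k * ε / 2) ^ 3 := by rw [h4]; ring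
    _ ≤ _ := by gcongr

/-- The dyadic disc has area π 4^k ε², which against the coefficient 8·8^(-k)/ε² leaves the summable
factor 8π 2^(-k). -/
lemma lintegral_mul_poissonMajorant_le {ε : ℝ} (hε : 0 < ε) {g : Plane → ℂ}
    (hg : AEStronglyMeasurable g volume) (x : Plane) :
    ∫⁻ y, ‖g (x - y) - g x‖ₑ * ENNReal.ofReal (ε / poissonRadius ε y ^ 3)
      ≤ ∑' k : ℕ, ENNReal.ofReal (8 * Real.pi * (1 / 2) ^ k)
          * meanOscillation g x (2 ^ k * ε) := by
  have hmeas : AEMeasurable (fun y => ‖g (x - y) - g x‖ₑ) volume :=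
    ((hg.comp_measurePreserving (measurePreserving_const_sub x)).sub
      aestronglyMeasurable_const).enorm
  calc _ ≤ ∫⁻ y, ∑' k : ℕ, ‖g (x - y) - g x‖ₑ *
        (Metric.closedBall (0 : Plane) (2 ^ k * ε)).indicator
          (fun _ => ENNReal.ofReal (8 * (1 / 8) ^ k / ε ^ 2)) y := by
        refine lintegral_mono fun y => ?_
        rw [ENNReal.tsum_mul_left]
        gcongr
        exact poissonMajorant_le_tsum hε y
    _ = ∑' k : ℕ, ∫⁻ y, ‖g (x - y) - g x‖ₑ *
        (Metric.closedBall (0 : Plane) (2 ^ k * ε)).indicator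
          (fun _ => ENNReal.ofReal (8 * (1 / 8) ^ k / ε ^ 2)) y :=
        lintegral_tsum fun k => hmeas.mul
          (aemeasurable_const.indicator Metric.isClosed_closedBall.measurableSet)
    _ = _ := by
        congr 1 with k
        have hr : 0 < 2 ^ k * ε := by positivity
        have e1 : ∀ y, ‖g (x - y) - g x‖ₑ *
            (Metric.closedBall (0 : Plane) (2 ^ k * ε)).indicator
              (fun _ => ENNReal.ofReal (8 * (1 / 8) ^ k / ε ^ 2)) y
            = (fun u => (Metric.closedBall x (2 ^ k * ε)).indicator
              (fun u => ‖g u - g x‖ₑ * ENNReal.ofReal (8 * (1 / 8) ^ k / ε ^ 2)) u) (x - y) := by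
          intro y
          have hmem : x - y ∈ Metric.closedBall x (2 ^ k * ε) ↔ ‖y‖ ≤ 2 ^ k * ε := by
            rw [Metric.mem_closedBall, dist_eq_norm, sub_sub_cancel_left, norm_neg]
          by_cases hy : ‖y‖ ≤ 2 ^ k * ε
          · simp only [Set.indicator_of_mem (hmem.2 hy),
              Set.indicator_of_mem (mem_closedBall_zero_iff.2 hy)]
          · simp only [Set.indicator_of_notMem (mt hmem.1 hy),
              Set.indicator_of_notMem (mt mem_closedBall_zero_iff.1 hy), mul_zero]
        simp_rw [e1]
        rw [lintegral_sub_left_eq_self _ x,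
          lintegral_indicator Metric.isClosed_closedBall.measurableSet,
          lintegral_mul_const' _ _ ENNReal.ofReal_ne_top, meanOscillation, ENNReal.div_eq_inv_mul,
          volume_closedBall_plane, ← ENNReal.ofReal_pow hr.le, ← ENNReal.ofReal_mul (by positivity),
          ← ENNReal.ofReal_inv_of_pos (by positivity), mul_left_comm, mul_comm]
        rw [← mul_assoc, ← ENNReal.ofReal_mul (by positivity)]
        congr 2
        have : ((1 / 8 : ℝ)) ^ k * (2 ^ k) ^ 2 = (1 / 2) ^ k := by
          rw [← pow_mul, mul_comm k 2, pow_mul, ← mul_pow]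
          norm_num
        field_simp
        linear_combination this

/-- This is dominated convergence in the dyadic index k: each term tends to 0, and 8π 2^(-k) M
dominates with M a bound for the oscillation at all scales. -/
lemma tendsto_lintegral_mul_poissonMajorant {g : Plane → ℂ} (hg : MemLp g 2 volume) {x : Plane}
    (hx : Tendsto (meanOscillation g x) (𝓝[>] 0) (𝓝 0)) :
    Tendsto (fun ε => ∫⁻ y, ‖g (x - y) - g x‖ₑ * ENNReal.ofReal (ε / poissonRadius ε y ^ 3))
      (𝓝[>] 0) (𝓝 0) := by
  obtain ⟨M, hM, hbd⟩ := exists_meanOscillation_le hg hx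
  have hlim : Tendsto (fun ε : ℝ => ∑' k : ℕ, ENNReal.ofReal (8 * Real.pi * (1 / 2) ^ k)
      * meanOscillation g x (2 ^ k * ε)) (𝓝[>] 0) (𝓝 0) := by
    simp_rw [← lintegral_count]
    have h0 : (0 : ℝ≥0∞) = ∫⁻ _ : ℕ, (0 : ℝ≥0∞) ∂Measure.count := by simp
    rw [h0]
    refine tendsto_lintegral_filter_of_dominated_convergence
      (fun k : ℕ => ENNReal.ofReal (8 * Real.pi * (1 / 2) ^ k) * M) ?_ ?_ ?_ ?_
    · exact .of_forall fun ε => measurable_from_top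
    · filter_upwards [self_mem_nhdsWithin] with ε hε
      refine .of_forall fun k => ?_
      gcongr
      exact hbd _ (mul_pos (by positivity) hε)
    · rw [lintegral_count, ENNReal.tsum_mul_right]
      refine ENNReal.mul_ne_top ?_ hM
      rw [← ENNReal.ofReal_tsum_of_nonneg (fun k => by positivity)
        ((summable_geometric_of_lt_one (by norm_num) (by norm_num)).mul_left _)]
      exact ENNReal.ofReal_ne_top
    · refine .of_forall fun k => ?_
      have h1 : Tendsto (fun ε : ℝ => 2 ^ k * ε) (𝓝[>] 0) (𝓝[>] 0) := by
        refine tendsto_nhdsWithin_iff.2 ⟨?_, ?_⟩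
        · have : Tendsto (fun ε : ℝ => 2 ^ k * ε) (𝓝 0) (𝓝 (2 ^ k * 0)) :=
            tendsto_id.const_mul _
          rw [mul_zero] at this
          exact this.mono_left nhdsWithin_le_nhds
        · filter_upwards [self_mem_nhdsWithin] with ε hε
          exact mul_pos (pow_pos two_pos k) (Set.mem_Ioi.1 hε)
      have h2 := ENNReal.Tendsto.const_mul (a := ENNReal.ofReal (8 * Real.pi * (1 / 2) ^ k))
        (hx.comp h1) (Or.inr ENNReal.ofReal_ne_top)
      rw [mul_zero] at h2
      exact h2
  refine tendsto_of_tendsto_of_tendsto_of_le_of_le' tendsto_const_nhds hlim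
    (.of_forall fun _ => zero_le) ?_
  filter_upwards [self_mem_nhdsWithin] with ε hε
  exact lintegral_mul_poissonMajorant_le hε hg.1 x

/-- A family of kernels with constant integral `κ` and a Poisson majorant converges to `κ` times
the identity at every Lebesgue point. -/
lemma tendsto_integral_sub_mul_of_poissonMajorant {g : Plane → ℂ} (hg : MemLp g 2 volume)
    {x : Plane} (hx : Tendsto (meanOscillation g x) (𝓝[>] 0) (𝓝 0)) {h : ℝ → Plane → ℂ} {C : ℝ}
    {κ : ℂ} (hmeas : ∀ ε, 0 < ε → AEStronglyMeasurable (h ε) volume)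
    (hbd : ∀ ε, 0 < ε → ∀ y, ‖h ε y‖ ≤ C * (ε / poissonRadius ε y ^ 3))
    (hint : ∀ ε, 0 < ε → ∫ y, h ε y = κ) :
    Tendsto (fun ε => ∫ y, g (x - y) * h ε y) (𝓝[>] 0) (𝓝 (κ * g x)) := by
  have hlim := tendsto_lintegral_mul_poissonMajorant hg hx
  have hlimC := ENNReal.Tendsto.const_mul (a := ENNReal.ofReal C) hlim
    (Or.inr ENNReal.ofReal_ne_top)
  rw [mul_zero] at hlimC
  have hfin : ∀ᶠ ε in 𝓝[>] (0 : ℝ),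
      ∫⁻ y, ‖g (x - y) - g x‖ₑ * ENNReal.ofReal (ε / poissonRadius ε y ^ 3) < ⊤ :=
    hlim.eventually (gt_mem_nhds ENNReal.zero_lt_top)
  have hint' : ∀ ε, 0 < ε → Integrable (h ε) volume := fun ε hε =>
    (((integrable_inv_poissonRadius_pow hε (n := 3) (by norm_num)).const_mul ε).const_mul C).mono'
      (hmeas ε hε) (.of_forall fun y => by simpa [div_eq_mul_inv] using hbd ε hε y)
  have hle : ∀ ε, 0 < ε → ∫⁻ y, ‖(g (x - y) - g x) * h ε y‖ₑ
      ≤ ENNReal.ofReal C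
        * ∫⁻ y, ‖g (x - y) - g x‖ₑ * ENNReal.ofReal (ε / poissonRadius ε y ^ 3) := by
    intro ε hε
    rw [← lintegral_const_mul' _ _ ENNReal.ofReal_ne_top]
    refine lintegral_mono fun y => ?_
    have hs := poissonRadius_pos hε y
    rw [enorm_mul, mul_left_comm]
    gcongr
    rw [← ENNReal.ofReal_mul' (by positivity), ← ofReal_norm]
    exact ENNReal.ofReal_le_ofReal (hbd ε hε y)
  have hzero : Tendsto (fun ε => ∫ y, (g (x - y) - g x) * h ε y) (𝓝[>] 0) (𝓝 0) := by
    rw [tendsto_zero_iff_enorm_tendsto_zero]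
    refine tendsto_of_tendsto_of_tendsto_of_le_of_le' tendsto_const_nhds hlimC
      (.of_forall fun _ => zero_le) ?_
    filter_upwards [self_mem_nhdsWithin] with ε hε
    exact (enorm_integral_le_lintegral_enorm _).trans (hle ε hε)
  have hsum : Tendsto (fun ε => (∫ y, (g (x - y) - g x) * h ε y) + κ * g x) (𝓝[>] 0)
      (𝓝 (κ * g x)) := by
    simpa using hzero.add_const (κ * g x)
  refine hsum.congr' ?_
  filter_upwards [self_mem_nhdsWithin, hfin] with ε hε hf
  have hA : Integrable (fun y => (g (x - y) - g x) * h ε y) volume := by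
    refine ⟨((hg.1.comp_measurePreserving (measurePreserving_const_sub x)).sub
      aestronglyMeasurable_const).mul (hmeas ε hε), ?_⟩
    exact (hle ε hε).trans_lt (ENNReal.mul_lt_top ENNReal.ofReal_lt_top hf)
  have hB : Integrable (fun y => g x * h ε y) volume := (hint' ε hε).const_mul _
  have e : ∀ y, g (x - y) * h ε y = (g (x - y) - g x) * h ε y + g x * h ε y := fun y => by ring
  simp_rw [e]
  rw [integral_add hA hB, integral_const_mul, hint ε hε, mul_comm]

/-! ### Rotations and circle means -/

/-- The complex coordinate as a linear isometry between the plane and `ℂ`. -/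
def planeEquiv (w : ℂ) (hw : w ^ 2 = -1) : Plane ≃ₗᵢ[ℝ] ℂ :=
  LinearIsometry.toLinearIsometryEquiv
    { toFun := planeCoord w
      map_add' := fun x y => by simp [planeCoord]; ring
      map_smul' := fun c x => by simp [planeCoord]; ring
      norm_map' := norm_planeCoord hw } (by simp)

lemma planeEquiv_apply (w : ℂ) (hw : w ^ 2 = -1) (z : Plane) :
    planeEquiv w hw z = planeCoord w z := rfl

/-- The rotation of the plane by the angle `θ`. -/
def planeRotation (w : ℂ) (hw : w ^ 2 = -1) (θ : ℝ) : Plane ≃ₗᵢ[ℝ] Plane :=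
  ((planeEquiv w hw).trans (rotation (Circle.exp θ))).trans (planeEquiv w hw).symm

section

variable {w : ℂ} {ε : ℝ} {G : ℂ → ℂ} {R : ℝ}

lemma planeCoord_planeRotation (hw : w ^ 2 = -1) (θ : ℝ) (z : Plane) :
    planeCoord w (planeRotation w hw θ z) = circleMap 0 1 θ * planeCoord w z := by
  have h : planeRotation w hw θ z
      = (planeEquiv w hw).symm (rotation (Circle.exp θ) (planeEquiv w hw z)) := rfl
  rw [h, ← planeEquiv_apply w hw, LinearIsometryEquiv.apply_symm_apply, rotation_apply,
    Circle.coe_exp, planeEquiv_apply, circleMap_zero, Complex.ofReal_one, one_mul]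

lemma continuous_planeRotation (hw : w ^ 2 = -1) :
    Continuous fun p : ℝ × Plane => planeRotation w hw p.1 p.2 := by
  have h : (fun p : ℝ × Plane => planeRotation w hw p.1 p.2)
      = fun p => (planeEquiv w hw).symm (circleMap 0 1 p.1 * planeCoord w p.2) := by
    ext1 p
    rw [← planeCoord_planeRotation hw, ← planeEquiv_apply w hw, LinearIsometryEquiv.symm_apply_apply]
  rw [h]
  exact (planeEquiv w hw).symm.continuous.comp (((continuous_circleMap 0 1).comp
    continuous_fst).mul (continuous_planeCoord.comp continuous_snd))

/-- Rotations preserve Lebesgue measure, so averaging the integral over all angles does not change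
it. By Fubini, justified by the rotation invariant majorant ψ, the average is the integral of the
circle means. -/
lemma integral_eq_zero_of_forall_circle_mean (hw : w ^ 2 = -1) {h : Plane → ℂ} {ψ : Plane → ℝ}
    (hm : Measurable h) (hψ : Integrable ψ volume) (hbd : ∀ z, ‖h z‖ ≤ ψ z)
    (hrot : ∀ θ z, ψ (planeRotation w hw θ z) = ψ z)
    (hmean : ∀ z, ∫ θ in (0 : ℝ)..2 * Real.pi, h (planeRotation w hw θ z) = 0) :
    ∫ z, h z = 0 := by
  have h1 : ∀ θ, ∫ z, h (planeRotation w hw θ z) = ∫ z, h z := fun θ =>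
    (planeRotation w hw θ).measurePreserving.integral_comp
      (planeRotation w hw θ).toHomeomorph.measurableEmbedding h
  have h2 : ∫ θ in (0 : ℝ)..2 * Real.pi, ∫ z, h (planeRotation w hw θ z)
      = ∫ z, ∫ θ in (0 : ℝ)..2 * Real.pi, h (planeRotation w hw θ z) := by
    apply intervalIntegral_integral_swap
    have : IsFiniteMeasure (volume.restrict (Set.uIoc 0 (2 * Real.pi))) :=
      ⟨by rw [Measure.restrict_apply_univ, Set.uIoc_of_le (by positivity)]; exact measure_Ioc_lt_top⟩
    have h3 : Integrable (fun p : ℝ × Plane => ψ p.2)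
        ((volume.restrict (Set.uIoc 0 (2 * Real.pi))).prod volume) := hψ.comp_snd _
    refine h3.mono' (hm.comp (continuous_planeRotation hw).measurable).aestronglyMeasurable
      (.of_forall fun p => ?_)
    exact (hbd _).trans (hrot _ _).le
  simp only [h1, hmean, intervalIntegral.integral_const, integral_zero, sub_zero, smul_eq_zero,
    mul_eq_zero, OfNat.ofNat_ne_zero, Real.pi_ne_zero, or_self, false_or] at h2
  exact h2

/-- This is the mean value property of u ↦ G(uc), which is holomorphic on the disc of radius R
because |c| ≤ 1. -/
lemma intervalIntegral_circleMap_mul (hR : 1 < R) (hG : DifferentiableOn ℂ G (Metric.ball 0 R))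
    {c : ℂ} (hc : ‖c‖ ≤ 1) :
    ∫ θ in (0 : ℝ)..2 * Real.pi, G (circleMap 0 1 θ * c) = 2 * Real.pi * G 0 := by
  have hd : DifferentiableOn ℂ (fun u => G (u * c)) (Metric.ball 0 R) := by
    refine hG.comp (by fun_prop) fun u hu => ?_
    rw [mem_ball_zero_iff] at hu ⊢
    rw [norm_mul]
    nlinarith [norm_nonneg u, norm_nonneg c]
  have h := DiffContOnCl.circleAverage (f := fun u => G (u * c)) (c := 0) (R := 1)
    (hd.mono (by
      rw [abs_one, closure_ball _ one_ne_zero]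
      exact Metric.closedBall_subset_ball hR)).diffContOnCl
  rw [Real.circleAverage_def, zero_mul, inv_smul_eq_iff₀ (by positivity)] at h
  rw [h, Complex.real_smul]
  push_cast
  ring

lemma continuous_comp_circleMap_mul (hR : 1 < R) (hG : DifferentiableOn ℂ G (Metric.ball 0 R))
    {c : ℂ} (hc : ‖c‖ ≤ 1) : Continuous fun θ => G (circleMap 0 1 θ * c) := by
  refine hG.continuousOn.comp_continuous ((continuous_circleMap 0 1).mul continuous_const)
    fun θ => ?_
  rw [mem_ball_zero_iff, norm_mul, norm_circleMap_zero, abs_one, one_mul]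
  linarith

/-! ### Truncated homogeneous kernels -/

/-- The kernel `e G'(e)/|z|²`, where `e = (x + w y)/|z|`. -/
def boundaryKernel (w : ℂ) (G : ℂ → ℂ) (z : Plane) : ℂ :=
  planeCoord w z / ‖z‖ * deriv G (planeCoord w z / ‖z‖) / ‖z‖ ^ 2

/-- The difference between the truncation of `boundaryKernel` and `discKernel`. -/
def truncationRemainder (w : ℂ) (G : ℂ → ℂ) (ε : ℝ) (z : Plane) : ℂ :=
  {z : Plane | ε < ‖z‖}.indicator (boundaryKernel w G) z - discKernel w G ε z

lemma measurableSet_lt_norm (ε : ℝ) : MeasurableSet {z : Plane | ε < ‖z‖} :=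
  measurableSet_lt measurable_const measurable_norm

lemma measurable_boundaryKernel : Measurable (boundaryKernel w G) := by
  have h : Measurable fun z : Plane => planeCoord w z / ‖z‖ :=
    continuous_planeCoord.measurable.div (Complex.measurable_ofReal.comp measurable_norm)
  exact (h.mul ((measurable_deriv G).comp h)).div
    ((Complex.measurable_ofReal.comp measurable_norm).pow_const 2)

lemma measurable_truncationRemainder (hw : w ^ 2 = -1) (hε : 0 < ε) (hR : 1 < R)
    (hG : DifferentiableOn ℂ G (Metric.ball 0 R)) : Measurable (truncationRemainder w G ε) :=
  (measurable_boundaryKernel.indicator (measurableSet_lt_norm ε)).sub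
    (continuous_discKernel hw hε hR hG).measurable

lemma differentiableOn_mul_deriv (hG : DifferentiableOn ℂ G (Metric.ball 0 R)) :
    DifferentiableOn ℂ (fun τ => τ * deriv G τ) (Metric.ball 0 R) :=
  differentiableOn_id.mul (hG.deriv Metric.isOpen_ball)

/-- Put F(τ) = τG'(τ). For |z| > ε the error consists of F(e) - F(τ), small by the Lipschitz bound
on F, of 1/|z|² - 1/s² = ε²/(|z|²s²), and of the term εG/s³. For |z| ≤ ε there is no truncated
kernel, and s ≤ 2ε turns 1/s² into a multiple of ε/s³. -/
lemma exists_norm_truncationRemainder_le (hw : w ^ 2 = -1) (hR : 1 < R)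
    (hG : DifferentiableOn ℂ G (Metric.ball 0 R)) :
    ∃ C : ℝ, ∀ ε, 0 < ε → ∀ z,
      ‖truncationRemainder w G ε z‖ ≤ C * (ε / poissonRadius ε z ^ 3) := by
  obtain ⟨B₁, hB₁, h₁⟩ := exists_bound_of_differentiableOn_ball hR hG
  have hF := differentiableOn_mul_deriv hG
  obtain ⟨B₂, hB₂, h₂⟩ := exists_bound_of_differentiableOn_ball hR hF
  set F : ℂ → ℂ := fun τ => τ * deriv G τ with hFdef
  have hlip : ∀ a b : ℂ, ‖a‖ ≤ 1 → ‖b‖ ≤ 1 → ‖F a - F b‖ ≤ B₂ * ‖a - b‖ := by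
    intro a b ha hb
    have hsub : Metric.closedBall (0 : ℂ) 1 ⊆ Metric.ball 0 R := Metric.closedBall_subset_ball hR
    exact (convex_closedBall (0 : ℂ) 1).norm_image_sub_le_of_norm_deriv_le
      (fun x hx => hF.differentiableAt (Metric.isOpen_ball.mem_nhds (hsub hx)))
      (fun x hx => (h₂ x (mem_closedBall_zero_iff.1 hx)).2)
      (mem_closedBall_zero_iff.2 hb) (mem_closedBall_zero_iff.2 ha)
  refine ⟨B₁ + 4 * B₂, fun ε hε z => ?_⟩
  have hs := poissonRadius_pos hε z
  have hτ := (norm_discPoint_lt_one hw hε z).le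
  have hs2 := poissonRadius_sq ε z
  have hsε := le_poissonRadius ε z
  have hsr := poissonRadius_le hε z
  have hGterm : ‖(ε : ℂ) * G (discPoint w ε z) / poissonRadius ε z ^ 3‖
      ≤ B₁ * (ε / poissonRadius ε z ^ 3) := by
    rw [norm_div, norm_mul, norm_pow, Complex.norm_real, Complex.norm_real,
      Real.norm_of_nonneg hε.le, Real.norm_of_nonneg hs.le]
    rw [← mul_div_assoc, mul_comm B₁]
    have := (h₁ _ hτ).1
    gcongr
  have hnorm2 : ∀ c : ℂ, ‖c / (poissonRadius ε z : ℂ) ^ 2‖ = ‖c‖ / poissonRadius ε z ^ 2 := by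
    intro c
    rw [norm_div, norm_pow, Complex.norm_real, Real.norm_of_nonneg hs.le]
  by_cases hz : ε < ‖z‖
  · have hr : 0 < ‖z‖ := hε.trans hz
    have hr0 : (‖z‖ : ℂ) ≠ 0 := by exact_mod_cast hr.ne'
    have hs0 := ofReal_poissonRadius_ne_zero hε z
    set e : ℂ := planeCoord w z / ‖z‖ with he
    have he1 : ‖e‖ ≤ 1 := by
      rw [he, norm_div, norm_planeCoord hw, Complex.norm_real, norm_norm, div_self hr.ne']
    have heq : truncationRemainder w G ε z = (F e - F (discPoint w ε z)) / poissonRadius ε z ^ 2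
        + F e * (ε ^ 2 / (‖z‖ ^ 2 * poissonRadius ε z ^ 2) : ℝ)
        - ε * G (discPoint w ε z) / poissonRadius ε z ^ 3 := by
      have h3 : ((ε ^ 2 / (‖z‖ ^ 2 * poissonRadius ε z ^ 2) : ℝ) : ℂ)
          = 1 / (‖z‖ : ℂ) ^ 2 - 1 / (poissonRadius ε z : ℂ) ^ 2 := by
        rw [div_sub_div _ _ (pow_ne_zero _ hr0) (pow_ne_zero _ hs0)]
        have : (poissonRadius ε z : ℂ) ^ 2 = ε ^ 2 + ‖z‖ ^ 2 := by exact_mod_cast hs2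
        push_cast
        rw [this]
        congr 1
        ring
      rw [h3, truncationRemainder, Set.indicator_of_mem (by exact hz), boundaryKernel, discKernel,
        ← he]
      simp only [hFdef]
      ring
    -- The points e and τ lie on one ray, so their distance is (ε + s - |z|)/(ε + s), and s ≤ ε +
    -- |z|.
    have hdist : ‖e - discPoint w ε z‖ ≤ 2 * ε / poissonRadius ε z := by
      have h4 : e - discPoint w ε z
          = planeCoord w z * ((‖z‖⁻¹ - (ε + poissonRadius ε z)⁻¹ : ℝ) : ℂ) := by
        rw [he, discPoint]
        push_cast
        ring
      have h5 : 0 ≤ ‖z‖⁻¹ - (ε + poissonRadius ε z)⁻¹ := by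
        rw [sub_nonneg]
        exact inv_anti₀ hr (by linarith [norm_le_poissonRadius ε z])
      rw [h4, norm_mul, norm_planeCoord hw, Complex.norm_real, Real.norm_of_nonneg h5, mul_sub,
        mul_inv_cancel₀ hr.ne', ← div_eq_mul_inv, one_sub_div (by positivity),
        div_le_div_iff₀ (by positivity) hs]
      nlinarith
    rw [heq]
    refine (norm_sub_le _ _).trans ?_
    have h6 : ‖(F e - F (discPoint w ε z)) / (poissonRadius ε z : ℂ) ^ 2‖
        ≤ 2 * B₂ * (ε / poissonRadius ε z ^ 3) := by
      rw [hnorm2]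
      calc _ ≤ B₂ * (2 * ε / poissonRadius ε z) / poissonRadius ε z ^ 2 := by
            have := (hlip e _ he1 hτ).trans (mul_le_mul_of_nonneg_left hdist hB₂)
            gcongr
        _ = _ := by field_simp
    have h7 : ‖F e * (ε ^ 2 / (‖z‖ ^ 2 * poissonRadius ε z ^ 2) : ℝ)‖
        ≤ 2 * B₂ * (ε / poissonRadius ε z ^ 3) := by
      rw [norm_mul, Complex.norm_real, Real.norm_of_nonneg (by positivity)]
      have h8 : ε ^ 2 / (‖z‖ ^ 2 * poissonRadius ε z ^ 2) ≤ 2 * (ε / poissonRadius ε z ^ 3) := by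
        rw [← mul_div_assoc, div_le_div_iff₀ (by positivity) (by positivity)]
        have h9 : poissonRadius ε z ^ 2 ≤ 2 * ‖z‖ ^ 2 := by nlinarith
        calc ε ^ 2 * poissonRadius ε z ^ 3
            = ε * (ε * poissonRadius ε z) * poissonRadius ε z ^ 2 := by ring
          _ ≤ ε * (poissonRadius ε z * poissonRadius ε z) * (2 * ‖z‖ ^ 2) := by gcongr
          _ = _ := by ring
      calc _ ≤ B₂ * (2 * (ε / poissonRadius ε z ^ 3)) := by
            have := (h₂ e he1).1
            gcongr
        _ = _ := by ring
    have h10 := (norm_add_le _ _).trans (add_le_add h6 h7)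
    linarith
  · rw [truncationRemainder, Set.indicator_of_notMem (by exact hz), zero_sub, norm_neg]
    refine (norm_add_le _ _).trans ?_
    have h11 : ‖F (discPoint w ε z) / (poissonRadius ε z : ℂ) ^ 2‖
        ≤ 2 * B₂ * (ε / poissonRadius ε z ^ 3) := by
      rw [hnorm2]
      have h12 : poissonRadius ε z ≤ 2 * ε := by linarith
      calc _ ≤ B₂ / poissonRadius ε z ^ 2 := by
            have := (h₂ _ hτ).1
            gcongr
        _ ≤ _ := by
            rw [← mul_div_assoc, div_le_div_iff₀ (by positivity) (by positivity)]
            calc B₂ * poissonRadius ε z ^ 3 = B₂ * poissonRadius ε z ^ 2 * poissonRadius ε z := by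
                  ring
              _ ≤ B₂ * poissonRadius ε z ^ 2 * (2 * ε) := by gcongr
              _ = _ := by ring
    have h13 : 0 ≤ 2 * B₂ * (ε / poissonRadius ε z ^ 3) := by positivity
    change _ + ‖F (discPoint w ε z) / (poissonRadius ε z : ℂ) ^ 2‖ ≤ _
    linarith

lemma poissonRadius_planeRotation (hw : w ^ 2 = -1) (θ : ℝ) (z : Plane) :
    poissonRadius ε (planeRotation w hw θ z) = poissonRadius ε z := by
  rw [poissonRadius, LinearIsometryEquiv.norm_map, poissonRadius]

/-- On each circle about the origin the remainder is a combination of G and τG'(τ) along circles in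
the closed unit disc. Their means are the values at 0, and both vanish there because G(0) = 0. -/
lemma integral_truncationRemainder (hw : w ^ 2 = -1) (hε : 0 < ε) (hR : 1 < R)
    (hG : DifferentiableOn ℂ G (Metric.ball 0 R)) (hG0 : G 0 = 0) :
    ∫ z, truncationRemainder w G ε z = 0 := by
  obtain ⟨C, hC⟩ := exists_norm_truncationRemainder_le hw hR hG
  have hF := differentiableOn_mul_deriv hG
  refine integral_eq_zero_of_forall_circle_mean hw (measurable_truncationRemainder hw hε hR hG)
    (ψ := fun z => C * (ε / poissonRadius ε z ^ 3)) ?_ (hC ε hε) ?_ fun z => ?_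
  · simp_rw [div_eq_mul_inv]
    exact ((integrable_inv_poissonRadius_pow hε (n := 3) (by norm_num)).const_mul ε).const_mul C
  · intro θ z
    rw [poissonRadius_planeRotation]
  · have hτ := (norm_discPoint_lt_one hw hε z).le
    have hdp : ∀ θ, discPoint w ε (planeRotation w hw θ z)
        = circleMap 0 1 θ * discPoint w ε z := by
      intro θ
      rw [discPoint, planeCoord_planeRotation, poissonRadius_planeRotation, discPoint,
        mul_div_assoc]
    have he : ‖planeCoord w z / ‖z‖‖ ≤ 1 := by
      rw [norm_div, norm_planeCoord hw, Complex.norm_real, norm_norm]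
      exact div_self_le_one _
    have hbk : ∀ θ, {z : Plane | ε < ‖z‖}.indicator (boundaryKernel w G) (planeRotation w hw θ z)
        = (fun τ => τ * deriv G τ) (circleMap 0 1 θ * (planeCoord w z / ‖z‖))
          * {z : Plane | ε < ‖z‖}.indicator (fun z => 1 / (‖z‖ : ℂ) ^ 2) z := by
      intro θ
      by_cases hz : ε < ‖z‖
      · rw [Set.indicator_of_mem (by simpa using hz), Set.indicator_of_mem (by exact hz),
          boundaryKernel, planeCoord_planeRotation, LinearIsometryEquiv.norm_map,
          mul_div_assoc (circleMap 0 1 θ), mul_one_div]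
      · rw [Set.indicator_of_notMem (by simpa using hz), Set.indicator_of_notMem (by exact hz),
          mul_zero]
    have hdk : ∀ θ, discKernel w G ε (planeRotation w hw θ z)
        = G (circleMap 0 1 θ * discPoint w ε z) * (ε / (poissonRadius ε z : ℂ) ^ 3)
          + (fun τ => τ * deriv G τ) (circleMap 0 1 θ * discPoint w ε z)
            * (1 / (poissonRadius ε z : ℂ) ^ 2) := by
      intro θ
      rw [discKernel, hdp, poissonRadius_planeRotation]
      ring
    simp only [truncationRemainder, hbk, hdk]
    have c1 := (continuous_comp_circleMap_mul hR hF he).mul_const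
      ({z : Plane | ε < ‖z‖}.indicator (fun z => 1 / (‖z‖ : ℂ) ^ 2) z)
    have c2 := (continuous_comp_circleMap_mul hR hG hτ).mul_const
      (ε / (poissonRadius ε z : ℂ) ^ 3)
    have c3 := (continuous_comp_circleMap_mul hR hF hτ).mul_const
      (1 / (poissonRadius ε z : ℂ) ^ 2)
    have c4 : Continuous fun θ => G (circleMap 0 1 θ * discPoint w ε z)
          * (ε / (poissonRadius ε z : ℂ) ^ 3)
        + circleMap 0 1 θ * discPoint w ε z * deriv G (circleMap 0 1 θ * discPoint w ε z)
          * (1 / (poissonRadius ε z : ℂ) ^ 2) := c2.add c3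
    have m1 := intervalIntegral_circleMap_mul hR hF he
    have m2 := intervalIntegral_circleMap_mul hR hF hτ
    rw [intervalIntegral.integral_sub (c1.intervalIntegrable _ _)
        (c4.intervalIntegrable _ _),
      intervalIntegral.integral_add (c2.intervalIntegrable _ _) (c3.intervalIntegrable _ _),
      intervalIntegral.integral_mul_const, intervalIntegral.integral_mul_const,
      intervalIntegral.integral_mul_const, m1, m2, intervalIntegral_circleMap_mul hR hG hτ, hG0]
    ring

/-- In polar coordinates the radial integrand is r ε/(ε² + r²)^(3/2), with primitive -ε/√(ε² + r²).
-/
lemma integral_poisson (hε : 0 < ε) :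
    ∫ z : Plane, ε / poissonRadius ε z ^ 3 = 2 * Real.pi := by
  have h := integral_fun_norm_addHaar (volume : Measure Plane)
    (fun r : ℝ => ε / √(ε ^ 2 + r ^ 2) ^ 3)
  have h1 : ∫ r in Set.Ioi (0 : ℝ), r ^ (Module.finrank ℝ Plane - 1) • (ε / √(ε ^ 2 + r ^ 2) ^ 3)
      = 1 := by
    have hd : ∀ r ∈ Set.Ici (0 : ℝ), HasDerivAt (fun r : ℝ => -ε / √(ε ^ 2 + r ^ 2))
        (r ^ (Module.finrank ℝ Plane - 1) • (ε / √(ε ^ 2 + r ^ 2) ^ 3)) r := by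
      intro r _
      have hpos : 0 < √(ε ^ 2 + r ^ 2) := Real.sqrt_pos.2 (by positivity)
      have h2 : HasDerivAt (fun r : ℝ => √(ε ^ 2 + r ^ 2)) _ r :=
        ((hasDerivAt_pow 2 r).const_add (ε ^ 2)).sqrt (by positivity)
      have h3 := (hasDerivAt_const r (-ε)).div h2 hpos.ne'
      convert! h3 using 1
      simp
      field_simp
    have hlim : Tendsto (fun r : ℝ => -ε / √(ε ^ 2 + r ^ 2)) atTop (𝓝 0) := by
      refine Tendsto.div_atTop tendsto_const_nhds ?_
      refine tendsto_atTop_mono (fun r => ?_) tendsto_id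
      exact (le_abs_self r).trans (Real.abs_le_sqrt (by nlinarith [sq_nonneg ε]))
    rw [integral_Ioi_of_hasDerivAt_of_nonneg' hd (fun r hr => ?_) hlim]
    · simp [Real.sqrt_sq hε.le, hε.ne']
    · have : (0 : ℝ) < r := hr
      positivity
  rw [h1] at h
  change ∫ z : Plane, ε / √(ε ^ 2 + ‖z‖ ^ 2) ^ 3 = _
  rw [h]
  simp [Measure.real, EuclideanSpace.volume_ball_fin_two, Real.pi_pos.le]

end

section

open FourierTransform

/-! ### Principal value operators -/

/-- The operator `A` is the principal value convolution operator with the complex kernel `K`, whose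
truncations are square integrable. -/
def IsPrincipalValueOperator (K : Plane → ℂ) (A : L2Plane →L[ℂ] L2Plane) : Prop :=
  (∀ ε : ℝ, 0 < ε → MemLp ({z : Plane | ε < ‖z‖}.indicator K) 2 volume) ∧
    ∀ f : L2Plane, ∀ᵐ x : Plane,
      Tendsto (fun ε : ℝ => ∫ y in {y : Plane | ε < ‖y‖}, f (x - y) * K y) (𝓝[>] 0) (𝓝 (A f x))

lemma memLp_comp_const_sub {f : Plane → ℂ} (hf : MemLp f 2 volume) (x : Plane) :
    MemLp (fun y => f (x - y)) 2 volume :=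
  hf.comp_measurePreserving (measurePreserving_const_sub x)

lemma integrable_sub_mul {f k : Plane → ℂ} (hf : MemLp f 2 volume) (hk : MemLp k 2 volume)
    (x : Plane) : Integrable (fun y => f (x - y) * k y) volume :=
  (memLp_comp_const_sub hf x).integrable_mul hk

lemma setIntegral_sub_mul (K : Plane → ℂ) (f : Plane → ℂ) (ε : ℝ) (x : Plane) :
    ∫ y in {y : Plane | ε < ‖y‖}, f (x - y) * K y
      = ∫ y, f (x - y) * {z : Plane | ε < ‖z‖}.indicator K y := by
  rw [← integral_indicator (measurableSet_lt_norm ε)]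
  refine integral_congr_ae (.of_forall fun y => ?_)
  simp only [Set.indicator]
  split_ifs <;> simp

namespace IsPrincipalValueOperator

variable {K K' : Plane → ℂ} {A A' : L2Plane →L[ℂ] L2Plane}

lemma add (h : IsPrincipalValueOperator K A) (h' : IsPrincipalValueOperator K' A') :
    IsPrincipalValueOperator (fun z => K z + K' z) (A + A') := by
  have hind : ∀ ε : ℝ, {z : Plane | ε < ‖z‖}.indicator (fun z => K z + K' z)
      = {z : Plane | ε < ‖z‖}.indicator K + {z : Plane | ε < ‖z‖}.indicator K' := fun ε =>
    Set.indicator_add _ K K'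
  refine ⟨fun ε hε => ?_, fun f => ?_⟩
  · rw [hind]
    exact (h.1 ε hε).add (h'.1 ε hε)
  · filter_upwards [h.2 f, h'.2 f, Lp.coeFn_add (A f) (A' f)] with x h1 h2 h3
    change Tendsto _ _ (𝓝 ((A f + A' f : L2Plane) x))
    rw [h3]
    refine (h1.add h2).congr' ?_
    filter_upwards [self_mem_nhdsWithin] with ε hε
    rw [setIntegral_sub_mul, setIntegral_sub_mul, setIntegral_sub_mul, hind]
    simp only [Pi.add_apply, mul_add]
    rw [integral_add (integrable_sub_mul (Lp.memLp f) (h.1 ε hε) x)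
      (integrable_sub_mul (Lp.memLp f) (h'.1 ε hε) x)]

lemma const_smul (h : IsPrincipalValueOperator K A) (c : ℂ) :
    IsPrincipalValueOperator (fun z => c * K z) (c • A) := by
  have hind : ∀ ε : ℝ, {z : Plane | ε < ‖z‖}.indicator (fun z => c * K z)
      = c • {z : Plane | ε < ‖z‖}.indicator K := fun ε => by
    ext z
    simp [Set.indicator]
  refine ⟨fun ε hε => ?_, fun f => ?_⟩
  · rw [hind]
    exact (h.1 ε hε).const_smul c
  · filter_upwards [h.2 f, Lp.coeFn_smul c (A f)] with x h1 h2
    change Tendsto _ _ (𝓝 ((c • A f : L2Plane) x))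
    rw [h2]
    refine (h1.const_mul c).congr fun ε => ?_
    rw [← integral_const_mul]
    refine integral_congr_ae (.of_forall fun y => ?_)
    simp only
    ring

lemma congr_kernel (h : IsPrincipalValueOperator K A) (hK : ∀ z, z ≠ 0 → K z = K' z) :
    IsPrincipalValueOperator K' A := by
  have hind : ∀ ε : ℝ, 0 < ε →
      {z : Plane | ε < ‖z‖}.indicator K = {z : Plane | ε < ‖z‖}.indicator K' := by
    intro ε hε
    refine Set.indicator_congr fun z hz => hK z ?_
    exact norm_pos_iff.1 (hε.trans hz)
  refine ⟨fun ε hε => hind ε hε ▸ h.1 ε hε, fun f => ?_⟩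
  filter_upwards [h.2 f] with x h1
  refine h1.congr' ?_
  filter_upwards [self_mem_nhdsWithin] with ε hε
  simp only [setIntegral_sub_mul, hind ε hε]

lemma isSingularIntegralOperator {K : Plane → ℝ} {A : L2Plane →L[ℂ] L2Plane}
    (h : IsPrincipalValueOperator (fun z => (K z : ℂ)) A) : IsSingularIntegralOperator K A :=
  h.2

end IsPrincipalValueOperator

/-! ### Homogeneous kernels e G'(e)/|z|² as Fourier multiplier operators -/

section

variable {w : ℂ} {ε : ℝ} {G : ℂ → ℂ} {R : ℝ}

lemma memLp_truncationRemainder (hw : w ^ 2 = -1) (hε : 0 < ε) (hR : 1 < R)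
    (hG : DifferentiableOn ℂ G (Metric.ball 0 R)) :
    MemLp (truncationRemainder w G ε) 2 volume := by
  obtain ⟨C, hC⟩ := exists_norm_truncationRemainder_le hw hR hG
  refine memLp_two_of_norm_le_poissonRadius hε
    (measurable_truncationRemainder hw hε hR hG).aestronglyMeasurable (C := |C|) fun z => ?_
  have hs := poissonRadius_pos hε z
  refine (hC ε hε z).trans ?_
  calc C * (ε / poissonRadius ε z ^ 3) ≤ |C| * (1 / poissonRadius ε z ^ 2) := by
        refine mul_le_mul (le_abs_self C) ?_ (by positivity) (abs_nonneg C)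
        rw [div_le_div_iff₀ (by positivity) (by positivity)]
        calc ε * poissonRadius ε z ^ 2 ≤ poissonRadius ε z * poissonRadius ε z ^ 2 := by
              gcongr
              exact le_poissonRadius ε z
          _ = _ := by ring
    _ = _ := by ring

lemma discKernel_one (z : Plane) :
    discKernel w (fun _ => 1) ε z = ((ε / poissonRadius ε z ^ 3 : ℝ) : ℂ) := by
  simp [discKernel]

/-- The principal value operator with kernel `e G'(e)/|z|²` is a Fourier multiplier operator as
soon as the multiplier maps the Poisson kernel to `discKernel w G`. -/
lemma isPrincipalValueOperator_boundaryKernel (hw : w ^ 2 = -1) (hR : 1 < R)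
    (hG : DifferentiableOn ℂ G (Metric.ball 0 R)) (hG0 : G 0 = 0) {m : Plane → ℂ}
    {A : L2Plane →L[ℂ] L2Plane} (hA : IsFourierMultiplier m A)
    (hrel : ∀ ε : ℝ, 0 < ε → ∀ a b : L2Plane, a =ᵐ[volume] discKernel w (fun _ => 1) ε →
      b =ᵐ[volume] discKernel w G ε →
        (𝓕 b : L2Plane) =ᵐ[volume] fun ξ => m ξ * (𝓕 a : L2Plane) ξ) :
    IsPrincipalValueOperator (boundaryKernel w G) ((2 * Real.pi : ℂ) • A) := by
  have hone : DifferentiableOn ℂ (fun _ : ℂ => (1 : ℂ)) (Metric.ball 0 R) :=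
    differentiableOn_const _
  have hdecomp : ∀ ε : ℝ, {z : Plane | ε < ‖z‖}.indicator (boundaryKernel w G)
      = discKernel w G ε + truncationRemainder w G ε := by
    intro ε
    ext z
    simp [truncationRemainder]
  refine ⟨fun ε hε => ?_, fun f => ?_⟩
  · rw [hdecomp]
    exact (memLp_discKernel hw hε hR hG).add (memLp_truncationRemainder hw hε hR hG)
  · obtain ⟨C, hC⟩ := exists_norm_truncationRemainder_le hw hR hG
    filter_upwards [ae_tendsto_meanOscillation (Lp.memLp f),
      ae_tendsto_meanOscillation (Lp.memLp (A f)),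
      Lp.coeFn_smul (2 * Real.pi : ℂ) (A f)] with x h1 h2 h3
    have lim1 := tendsto_integral_sub_mul_of_poissonMajorant (Lp.memLp f) h1
      (fun ε hε => (measurable_truncationRemainder hw hε hR hG).aestronglyMeasurable) hC
      (fun ε hε => integral_truncationRemainder hw hε hR hG hG0)
    have lim2 := tendsto_integral_sub_mul_of_poissonMajorant (Lp.memLp (A f)) h2
      (h := discKernel w (fun _ => 1)) (C := 1) (κ := 2 * Real.pi)
      (fun ε hε => (continuous_discKernel hw hε hR hone).aestronglyMeasurable)
      (fun ε hε y => by
        have hs := poissonRadius_pos hε y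
        rw [discKernel_one, Complex.norm_real, Real.norm_of_nonneg (by positivity), one_mul])
      (fun ε hε => by
        simp_rw [discKernel_one]
        rw [integral_complex_ofReal, integral_poisson hε]
        push_cast
        rfl)
    have lim := lim2.add lim1
    rw [zero_mul, add_zero] at lim
    change Tendsto _ _ (𝓝 (((2 * Real.pi : ℂ) • A f : L2Plane) x))
    rw [h3]
    refine lim.congr' ?_
    filter_upwards [self_mem_nhdsWithin] with ε hε
    have hε : 0 < ε := hε
    have ha := (memLp_discKernel hw hε hR hone)
    have hb := (memLp_discKernel hw hε hR hG)
    -- Convolving f with the kernel of G is the same as convolving A f with 2π times the Poisson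
    -- kernel; the latter converges to 2π A f at Lebesgue points of A f.
    have e1 := hA.integral_sub_mul f
      (hrel ε hε (ha.toLp _) (hb.toLp _) ha.coeFn_toLp hb.coeFn_toLp) x
    rw [integral_toLp_mul_toLp .rfl hb.coeFn_toLp, integral_toLp_mul_toLp .rfl ha.coeFn_toLp] at e1
    rw [setIntegral_sub_mul, hdecomp, ← e1]
    simp only [Pi.add_apply, mul_add]
    rw [integral_add (integrable_sub_mul (Lp.memLp f) hb x)
      (integrable_sub_mul (Lp.memLp f) (memLp_truncationRemainder hw hε hR hG) x)]

/-- The symbol `-(x + w y)/(x - w y)` of the Beurling transform. -/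
def beurlingSymbol (w : ℂ) (ξ : Plane) : ℂ := -(planeCoord w ξ / planeCoord (-w) ξ)

lemma measurable_beurlingSymbol : Measurable (beurlingSymbol w) :=
  (continuous_planeCoord.measurable.div continuous_planeCoord.measurable).neg

lemma norm_beurlingSymbol_le (hw : w ^ 2 = -1) (ξ : Plane) : ‖beurlingSymbol w ξ‖ ≤ 1 := by
  rw [beurlingSymbol, norm_neg, norm_div, norm_planeCoord hw, norm_planeCoord (by simpa using hw)]
  exact div_self_le_one _

lemma exists_beurling (hw : w ^ 2 = -1) :
    ∃ B : L2Plane →L[ℂ] L2Plane, IsFourierMultiplier (beurlingSymbol w) B :=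
  exists_isFourierMultiplier measurable_beurlingSymbol.aestronglyMeasurable
    (norm_beurlingSymbol_le hw)

lemma isPrincipalValueOperator_sq (hw : w ^ 2 = -1) {B : L2Plane →L[ℂ] L2Plane}
    (hB : IsFourierMultiplier (beurlingSymbol w) B) :
    IsPrincipalValueOperator (boundaryKernel w fun τ => τ ^ 2) ((2 * Real.pi : ℂ) • B) := by
  refine isPrincipalValueOperator_boundaryKernel hw (R := 2) one_lt_two (by fun_prop) (by simp) hB
    fun ε hε a b ha hb => ?_
  refine fourier_discKernel_sq_mul hw hε (R := 2) one_lt_two (by fun_prop) ha ?_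
  simpa using hb

/-- The Beurling relation is used twice, along 1 → τ² → τ⁴. -/
lemma isPrincipalValueOperator_pow_four (hw : w ^ 2 = -1) {B : L2Plane →L[ℂ] L2Plane}
    (hB : IsFourierMultiplier (beurlingSymbol w) B) :
    IsPrincipalValueOperator (boundaryKernel w fun τ => τ ^ 4) ((2 * Real.pi : ℂ) • (B ∘L B)) := by
  refine isPrincipalValueOperator_boundaryKernel hw (R := 2) one_lt_two (by fun_prop) (by simp)
    (hB.comp hB) fun ε hε a b ha hb => ?_
  have hsq : DifferentiableOn ℂ (fun τ : ℂ => τ ^ 2) (Metric.ball 0 2) := by fun_prop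
  have hc := memLp_discKernel hw hε one_lt_two hsq
  have h1 := fourier_discKernel_sq_mul hw hε (R := 2) one_lt_two (G := fun _ => 1) (by fun_prop)
    ha (b := hc.toLp _) (by simpa using hc.coeFn_toLp)
  have h2 := fourier_discKernel_sq_mul hw hε (R := 2) one_lt_two hsq hc.coeFn_toLp
    (b := b) (by simpa only [← pow_add] using hb)
  filter_upwards [h1, h2] with ξ h1 h2
  rw [h2, h1, beurlingSymbol]
  ring

lemma discKernel_add_const_mul (hw : w ^ 2 = -1) (hε : 0 < ε) (hR : 1 < R) {G₁ G₂ : ℂ → ℂ}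
    (h₁ : DifferentiableOn ℂ G₁ (Metric.ball 0 R)) (h₂ : DifferentiableOn ℂ G₂ (Metric.ball 0 R))
    {q : ℂ} (h : ∀ τ ∈ Metric.ball (0 : ℂ) R, G τ = G₁ τ + q * G₂ τ) (z : Plane) :
    discKernel w G ε z = discKernel w G₁ ε z + q * discKernel w G₂ ε z := by
  have hτ := discPoint_mem_ball hw hε hR z
  have hd : deriv G (discPoint w ε z)
      = deriv G₁ (discPoint w ε z) + q * deriv G₂ (discPoint w ε z) := by
    have hev : G =ᶠ[𝓝 (discPoint w ε z)] fun τ => G₁ τ + q * G₂ τ := by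
      filter_upwards [Metric.isOpen_ball.mem_nhds hτ] with τ hτ using h τ hτ
    rw [hev.deriv_eq]
    exact ((hasDerivAt_of_differentiableOn_ball h₁ hτ).add
      ((hasDerivAt_of_differentiableOn_ball h₂ hτ).const_mul q)).deriv
  rw [discKernel, discKernel, discKernel, hd, h _ hτ]
  ring

lemma exists_one_lt_norm_mul_sq_lt_one {q : ℂ} (hq : ‖q‖ < 1) :
    ∃ R : ℝ, 1 < R ∧ ∀ τ ∈ Metric.ball (0 : ℂ) R, 1 - q * τ ^ 2 ≠ 0 := by
  have h0 := norm_nonneg q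
  have h1 : 1 < 2 / (1 + ‖q‖) := by
    rw [lt_div_iff₀ (by positivity)]
    linarith
  -- This radius satisfies R > 1 and |q|R² = 2|q|/(1 + |q|) < 1.
  refine ⟨√(2 / (1 + ‖q‖)), Real.lt_sqrt_of_sq_lt (by simpa using h1), fun τ hτ h => ?_⟩
  rw [mem_ball_zero_iff] at hτ
  have h2 : ‖τ‖ ^ 2 ≤ 2 / (1 + ‖q‖) := by
    rw [← Real.sq_sqrt (show 0 ≤ 2 / (1 + ‖q‖) by positivity)]
    exact pow_le_pow_left₀ (norm_nonneg _) hτ.le 2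
  have h3 : ‖q‖ * ‖τ‖ ^ 2 = 1 := by
    rw [← norm_pow, ← norm_mul, ← sub_eq_zero.1 h, norm_one]
  have h4 : ‖q‖ * (2 / (1 + ‖q‖)) < 1 := by
    rw [mul_div_assoc', div_lt_one (by positivity)]
    linarith
  nlinarith

lemma norm_one_sub_mul_beurlingSymbol (hw : w ^ 2 = -1) (q : ℂ) (ξ : Plane) :
    1 - ‖q‖ ≤ ‖1 - q * beurlingSymbol w ξ‖ := by
  have h := norm_sub_norm_le (1 : ℂ) (q * beurlingSymbol w ξ)
  rw [norm_one, norm_mul] at h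
  nlinarith [norm_beurlingSymbol_le hw ξ, norm_nonneg q]

lemma exists_geometric_beurling (hw : w ^ 2 = -1) {q : ℂ} (hq : ‖q‖ < 1) :
    ∃ B : L2Plane →L[ℂ] L2Plane,
      IsFourierMultiplier
        (fun ξ => q * beurlingSymbol w ξ / (1 - q * beurlingSymbol w ξ)) B := by
  have hm : Measurable fun ξ => q * beurlingSymbol w ξ := measurable_beurlingSymbol.const_mul q
  refine exists_isFourierMultiplier (hm.div (measurable_const.sub hm)).aestronglyMeasurable
    (C := ‖q‖ / (1 - ‖q‖)) fun ξ => ?_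
  rw [norm_div, norm_mul]
  have h1 := norm_one_sub_mul_beurlingSymbol hw q ξ
  have h2 := norm_beurlingSymbol_le hw ξ
  have h3 : 0 < 1 - ‖q‖ := by linarith
  calc _ ≤ ‖q‖ * 1 / (1 - ‖q‖) := by gcongr
    _ = _ := by rw [mul_one]

/-- The function H = 1/(1 - qτ²) satisfies H = 1 + qτ²H. If d is the kernel of τ²H, a that of 1 and
σ the symbol, the Beurling relation reads 𝓕d = σ(𝓕a + q𝓕d). Solving for q𝓕d gives the stated
multiplier, without summing a series of operators. -/
lemma isPrincipalValueOperator_geometric (hw : w ^ 2 = -1) {q : ℂ} (hq : ‖q‖ < 1)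
    {B : L2Plane →L[ℂ] L2Plane}
    (hB : IsFourierMultiplier
      (fun ξ => q * beurlingSymbol w ξ / (1 - q * beurlingSymbol w ξ)) B) :
    IsPrincipalValueOperator (boundaryKernel w fun τ => q * (τ ^ 2 * (1 - q * τ ^ 2)⁻¹))
      ((2 * Real.pi : ℂ) • B) := by
  obtain ⟨R, hR, hne⟩ := exists_one_lt_norm_mul_sq_lt_one hq
  have h1 : DifferentiableOn ℂ (fun τ : ℂ => (1 - q * τ ^ 2)⁻¹) (Metric.ball 0 R) :=
    DifferentiableOn.fun_inv (by fun_prop) hne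
  have h2 : DifferentiableOn ℂ (fun τ : ℂ => τ ^ 2 * (1 - q * τ ^ 2)⁻¹) (Metric.ball 0 R) :=
    DifferentiableOn.mul (by fun_prop) h1
  have h3 : DifferentiableOn ℂ (fun τ : ℂ => q * (τ ^ 2 * (1 - q * τ ^ 2)⁻¹)) (Metric.ball 0 R) :=
    h2.const_mul q
  refine isPrincipalValueOperator_boundaryKernel hw hR h3 (by simp) hB fun ε hε a b ha hb => ?_
  have hc := memLp_discKernel hw hε hR h1
  have hd := memLp_discKernel hw hε hR h2
  have r1 := fourier_discKernel_sq_mul hw hε hR h1 hc.coeFn_toLp hd.coeFn_toLp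
  have hbd : b = q • hd.toLp _ := by
    apply Lp.ext
    filter_upwards [hb, hd.coeFn_toLp, Lp.coeFn_smul q (hd.toLp _)] with z e1 e2 e3
    rw [e1, e3, Pi.smul_apply, e2, discKernel_add_const_mul (q := q) hw hε hR
      (differentiableOn_const 0) h2 (fun τ _ => by simp)]
    simp [discKernel]
  have hcd : hc.toLp _ = a + q • hd.toLp _ := by
    apply Lp.ext
    filter_upwards [hc.coeFn_toLp, ha, hd.coeFn_toLp, Lp.coeFn_smul q (hd.toLp _),
      Lp.coeFn_add a (q • hd.toLp _)] with z e1 e2 e3 e4 e5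
    rw [e1, e5, Pi.add_apply, e4, Pi.smul_apply, e2, e3, discKernel_add_const_mul (q := q) hw hε hR
      (differentiableOn_const 1) h2 (fun τ hτ => ?_)]
    · rfl
    · have := hne τ hτ
      field_simp
      ring
  have fb : (𝓕 b : L2Plane) = q • (𝓕 (hd.toLp _) : L2Plane) := by
    rw [hbd]
    exact (Lp.fourierTransformₗᵢ Plane ℂ).map_smul q _
  have fc : (𝓕 (hc.toLp _) : L2Plane) = 𝓕 a + q • (𝓕 (hd.toLp _) : L2Plane) := by
    rw [hcd]
    exact ((Lp.fourierTransformₗᵢ Plane ℂ).map_add _ _).trans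
      (congrArg _ ((Lp.fourierTransformₗᵢ Plane ℂ).map_smul q _))
  rw [fc] at r1
  rw [fb]
  filter_upwards [r1, Lp.coeFn_smul q (𝓕 (hd.toLp _) : L2Plane),
    Lp.coeFn_add (𝓕 a : L2Plane) (q • (𝓕 (hd.toLp _) : L2Plane))] with ξ e1 e2 e3
  rw [e3, Pi.add_apply, e2, Pi.smul_apply, smul_eq_mul] at e1
  rw [e2, Pi.smul_apply, smul_eq_mul]
  change _ = beurlingSymbol w ξ * _ at e1
  have hne' : 1 - q * beurlingSymbol w ξ ≠ 0 := by
    rw [← norm_ne_zero_iff]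
    have := norm_one_sub_mul_beurlingSymbol hw q ξ
    linarith
  rw [div_mul_eq_mul_div, eq_div_iff hne']
  linear_combination q * e1

/-- The kernel `c Re(e G'(e))/|z|²` is smooth and homogeneous with mean zero. -/
lemma isSmoothHomogeneousKernel_re_boundaryKernel (hR : 1 < R)
    (hG : DifferentiableOn ℂ G (Metric.ball 0 R)) (c : ℝ) :
    IsSmoothHomogeneousKernel fun z => c * (boundaryKernel Complex.I G z).re := by
  have hw := Complex.I_sq
  have hF := differentiableOn_mul_deriv hG
  refine ⟨fun z => c * (planeCoord Complex.I z / ‖z‖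
    * deriv G (planeCoord Complex.I z / ‖z‖)).re, fun t ht z => ?_, ?_, ?_, fun z hz => ?_⟩
  · have h : planeCoord Complex.I (t • z) / ‖t • z‖ = planeCoord Complex.I z / ‖z‖ := by
      have ht' : (t : ℂ) ≠ 0 := by exact_mod_cast ht.ne'
      have : planeCoord Complex.I (t • z) = t * planeCoord Complex.I z := by
        simp [planeCoord]
        ring
      rw [this, norm_smul, Real.norm_of_nonneg ht.le]
      push_cast
      rw [mul_div_mul_left _ _ ht']
    simp only [h]
  · have hsmooth : ContDiffOn ℝ ∞ (fun τ => τ * deriv G τ) (Metric.ball 0 R) :=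
      (hF.contDiffOn Metric.isOpen_ball).restrict_scalars ℝ
    have hcoord : ContDiff ℝ ∞ (planeCoord Complex.I) :=
      (planeEquiv Complex.I hw).toContinuousLinearEquiv.contDiff
    have hnorm : ContDiffOn ℝ ∞ (fun z : Plane => ‖z‖⁻¹) {0}ᶜ := by
      intro z hz
      exact ((contDiffAt_norm ℝ hz).inv (norm_ne_zero_iff.2 hz)).contDiffWithinAt
    have he : ContDiffOn ℝ ∞ (fun z : Plane => planeCoord Complex.I z / (‖z‖ : ℂ)) {0}ᶜ := by
      refine (hnorm.smul hcoord.contDiffOn).congr fun z _ => ?_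
      change _ = ‖z‖⁻¹ • planeCoord Complex.I z
      rw [Complex.real_smul, Complex.ofReal_inv, div_eq_inv_mul]
    have hmaps : Set.MapsTo (fun z : Plane => planeCoord Complex.I z / (‖z‖ : ℂ)) {0}ᶜ
        (Metric.ball 0 R) := by
      intro z hz
      rw [mem_ball_zero_iff, norm_div, norm_planeCoord hw, Complex.norm_real, norm_norm,
        div_self (norm_ne_zero_iff.2 hz)]
      exact hR
    exact contDiffOn_const.mul (Complex.reCLM.contDiff.comp_contDiffOn (hsmooth.comp he hmaps))
  · have hn : ∀ θ : ℝ, ‖(!₂[Real.cos θ, Real.sin θ] : Plane)‖ = 1 := by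
      intro θ
      have h := norm_sq_plane !₂[Real.cos θ, Real.sin θ]
      simp only [Matrix.cons_val_zero, Matrix.cons_val_one, Real.cos_sq_add_sin_sq]
        at h
      exact (pow_eq_one_iff_of_nonneg (norm_nonneg _) two_ne_zero).1 h
    have hc : ∀ θ : ℝ, planeCoord Complex.I !₂[Real.cos θ, Real.sin θ]
        / (‖(!₂[Real.cos θ, Real.sin θ] : Plane)‖ : ℂ) = circleMap 0 1 θ * 1 := by
      intro θ
      rw [hn]
      simp only [planeCoord, circleMap_zero, Complex.exp_mul_I, Matrix.cons_val_zero,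
        Matrix.cons_val_one]
      push_cast
      ring
    have hcont := continuous_comp_circleMap_mul hR hF (c := 1) (by simp)
    have hint := intervalIntegral_circleMap_mul hR hF (c := 1) (by simp)
    simp only [hc]
    rw [intervalIntegral.integral_const_mul]
    have hre := Complex.reCLM.intervalIntegral_comp_comm
      (hcont.intervalIntegrable (μ := volume) 0 (2 * Real.pi))
    simp only [Complex.reCLM_apply] at hre
    -- The mean is 2π times the value of τG'(τ) at τ = 0.
    rw [hre, hint]
    simp
  · change c * (boundaryKernel Complex.I G z).re = _
    rw [boundaryKernel, ← Complex.ofReal_pow, Complex.div_ofReal_re, mul_div_assoc]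

end

end

section

open FourierTransform

/-! ### The operators with harmonic polynomial kernels -/

section

variable {w : ℂ}

lemma boundaryKernel_sq (w : ℂ) (z : Plane) :
    boundaryKernel w (fun τ => τ ^ 2) z = 2 * planeCoord w z ^ 2 / (‖z‖ : ℂ) ^ 4 := by
  rw [boundaryKernel, deriv_pow_field]
  push_cast
  ring

lemma boundaryKernel_pow_four (w : ℂ) (z : Plane) :
    boundaryKernel w (fun τ => τ ^ 4) z = 4 * planeCoord w z ^ 4 / (‖z‖ : ℂ) ^ 6 := by
  rw [boundaryKernel, deriv_pow_field]
  push_cast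
  ring

lemma neg_I_sq : (-Complex.I) ^ 2 = -1 := by simp

/-- When G commutes with conjugation, so does G', and w = -i gives the conjugate of w = i. Adding
the two kernels therefore produces a real one, as the Calderón–Zygmund algebra demands. -/
lemma boundaryKernel_neg_I {G : ℂ → ℂ}
    (hG : ∀ τ, G (starRingEnd ℂ τ) = starRingEnd ℂ (G τ)) (z : Plane) :
    boundaryKernel (-Complex.I) G z = starRingEnd ℂ (boundaryKernel Complex.I G z) := by
  have hG' : G = starRingEnd ℂ ∘ G ∘ starRingEnd ℂ := by
    ext τ
    simp [hG]
  have hd : ∀ τ, deriv G (starRingEnd ℂ τ) = starRingEnd ℂ (deriv G τ) := by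
    intro τ
    conv_lhs => rw [hG', deriv_conj_conj]
    simp
  have hc := conj_planeCoord Complex.I_sq z
  simp only [boundaryKernel, map_div₀, map_mul, map_pow, Complex.conj_ofReal, ← hd, hc]

lemma boundaryKernel_I_add_neg_I {G : ℂ → ℂ}
    (hG : ∀ τ, G (starRingEnd ℂ τ) = starRingEnd ℂ (G τ)) (z : Plane) :
    boundaryKernel Complex.I G z + boundaryKernel (-Complex.I) G z
      = 2 * ((boundaryKernel Complex.I G z).re : ℂ) := by
  rw [boundaryKernel_neg_I hG, Complex.add_conj]
  push_cast
  rfl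

lemma beurlingSymbol_eq (hw : w ^ 2 = -1) {ξ : Plane} (hξ : ξ ≠ 0) :
    beurlingSymbol w ξ = -(planeCoord w ξ ^ 2 / (‖ξ‖ : ℂ) ^ 2) := by
  have h := planeCoord_mul_neg hw ξ
  have h0 : planeCoord (-w) ξ ≠ 0 := planeCoord_ne_zero (by simpa using hw) hξ
  have hn : (‖ξ‖ : ℂ) ≠ 0 := by exact_mod_cast norm_ne_zero_iff.2 hξ
  rw [beurlingSymbol]
  push_cast at h
  field_simp
  linear_combination planeCoord w ξ * h

/-- The symbols for w and -w are mutually inverse, which allows the computation with geometric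
series to be carried out with s and t subject to st = 1. -/
lemma beurlingSymbol_mul_neg (hw : w ^ 2 = -1) {ξ : Plane} (hξ : ξ ≠ 0) :
    beurlingSymbol w ξ * beurlingSymbol (-w) ξ = 1 := by
  have h0 : planeCoord (-w) ξ ≠ 0 := planeCoord_ne_zero (by simpa using hw) hξ
  have h1 : planeCoord w ξ ≠ 0 := planeCoord_ne_zero hw hξ
  rw [beurlingSymbol, beurlingSymbol, neg_neg]
  field_simp

end

/-- The Fourier multiplier of the operator with kernel
`-(1/π) xy/|z|⁴ + (2/π) (a (x³y - xy³) + b (x⁴ + y⁴ - 6x²y²))/|z|⁶`. -/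
def quarticSymbol (a b : ℝ) (ξ : Plane) : ℝ :=
  ξ 0 * ξ 1 / ‖ξ‖ ^ 2 + (a * (ξ 0 ^ 3 * ξ 1 - ξ 0 * ξ 1 ^ 3)
    + b * (ξ 0 ^ 4 + ξ 1 ^ 4 - 6 * (ξ 0 ^ 2 * ξ 1 ^ 2))) / ‖ξ‖ ^ 4

lemma ae_ne_zero_plane : ∀ᵐ ξ : Plane, ξ ≠ 0 := by simp [ae_iff]

lemma twoTermKernel_eq (a b : ℝ) (z : Plane) :
    twoTermKernel (MvPolynomial.C a * polyA + MvPolynomial.C b * polyB) z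
      = -(1 / Real.pi) * (z 0 * z 1 / ‖z‖ ^ 4)
        + 2 / Real.pi * ((a * (z 0 ^ 3 * z 1 - z 0 * z 1 ^ 3)
          + b * (z 0 ^ 4 + z 1 ^ 4 - 6 * (z 0 ^ 2 * z 1 ^ 2))) / ‖z‖ ^ 6) := by
  simp [twoTermKernel, polyA, polyB]

lemma planeCoord_sq_sub (z : Plane) :
    planeCoord Complex.I z ^ 2 - planeCoord (-Complex.I) z ^ 2 = 4 * Complex.I * (z 0 * z 1) := by
  simp only [planeCoord]
  ring

lemma planeCoord_sq_add (z : Plane) :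
    planeCoord Complex.I z ^ 2 + planeCoord (-Complex.I) z ^ 2 = 2 * (z 0 ^ 2 - z 1 ^ 2) := by
  simp only [planeCoord]
  linear_combination 2 * (z 1 : ℂ) ^ 2 * Complex.I_sq

lemma planeCoord_pow_four_sub (z : Plane) :
    planeCoord Complex.I z ^ 4 - planeCoord (-Complex.I) z ^ 4
      = 8 * Complex.I * (z 0 ^ 3 * z 1 - z 0 * z 1 ^ 3) := by
  linear_combination (planeCoord Complex.I z ^ 2 + planeCoord (-Complex.I) z ^ 2)
    * planeCoord_sq_sub z + 4 * Complex.I * (z 0 * z 1) * planeCoord_sq_add z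

lemma planeCoord_pow_four_add (z : Plane) :
    planeCoord Complex.I z ^ 4 + planeCoord (-Complex.I) z ^ 4
      = 2 * (z 0 ^ 4 + z 1 ^ 4 - 6 * (z 0 ^ 2 * z 1 ^ 2)) := by
  have h1 := planeCoord_sq_sub z
  have h2 := planeCoord_sq_add z
  have h : 2 * (planeCoord Complex.I z ^ 4 + planeCoord (-Complex.I) z ^ 4)
      = 4 * (z 0 ^ 4 + z 1 ^ 4 - 6 * (z 0 ^ 2 * z 1 ^ 2)) := by
    linear_combination (planeCoord Complex.I z ^ 2 - planeCoord (-Complex.I) z ^ 2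
      + 4 * Complex.I * (z 0 * z 1)) * h1
      + (planeCoord Complex.I z ^ 2 + planeCoord (-Complex.I) z ^ 2
        + 2 * (z 0 ^ 2 - z 1 ^ 2)) * h2 + 16 * (z 0 * z 1 : ℂ) ^ 2 * Complex.I_sq
  linear_combination h / 2

/-- With u = x + iy, the quadratic kernel 2u²/|z|⁴ has symbol -2πu²/|ξ|² and the quartic kernel
4u⁴/|z|⁶ has symbol 2πu⁴/|ξ|⁴; the same holds for the conjugate of u. The coefficients come from xy
= (u² - ū²)/(4i), x³y - xy³ = (u⁴ - ū⁴)/(8i) and x⁴ + y⁴ - 6x²y² = (u⁴ + ū⁴)/2. -/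
lemma exists_quartic_operator (a b : ℝ) {B B' : L2Plane →L[ℂ] L2Plane}
    (hB : IsFourierMultiplier (beurlingSymbol Complex.I) B)
    (hB' : IsFourierMultiplier (beurlingSymbol (-Complex.I)) B') :
    ∃ T : L2Plane →L[ℂ] L2Plane,
      IsPrincipalValueOperator (fun z =>
        (twoTermKernel (MvPolynomial.C a * polyA + MvPolynomial.C b * polyB) z : ℂ)) T ∧
      IsFourierMultiplier (fun ξ => (quarticSymbol a b ξ : ℂ)) T := by
  have hI := Complex.I_sq
  have hπ : (Real.pi : ℂ) ≠ 0 := by exact_mod_cast Real.pi_ne_zero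
  set c₁ : ℂ := Complex.I / (8 * Real.pi)
  set c₃ : ℂ := (b / 2 - a * Complex.I / 8) / (2 * Real.pi)
  set c₄ : ℂ := (b / 2 + a * Complex.I / 8) / (2 * Real.pi)
  refine ⟨(c₁ • ((2 * Real.pi : ℂ) • B) + (-c₁) • ((2 * Real.pi : ℂ) • B'))
    + (c₃ • ((2 * Real.pi : ℂ) • (B ∘L B)) + c₄ • ((2 * Real.pi : ℂ) • (B' ∘L B'))), ?_, ?_⟩
  · refine ((((isPrincipalValueOperator_sq hI hB).const_smul c₁).add
      ((isPrincipalValueOperator_sq neg_I_sq hB').const_smul (-c₁))).add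
      (((isPrincipalValueOperator_pow_four hI hB).const_smul c₃).add
      ((isPrincipalValueOperator_pow_four neg_I_sq hB').const_smul c₄))).congr_kernel fun z hz => ?_
    have hn : (‖z‖ : ℂ) ≠ 0 := by exact_mod_cast norm_ne_zero_iff.2 hz
    simp only [boundaryKernel_sq, boundaryKernel_pow_four, twoTermKernel_eq, c₁, c₃, c₄]
    push_cast
    linear_combination Complex.I / (4 * Real.pi) / (‖z‖ : ℂ) ^ 4 * planeCoord_sq_sub z
      + b / Real.pi / (‖z‖ : ℂ) ^ 6 * planeCoord_pow_four_add z
      - a * Complex.I / (4 * Real.pi) / (‖z‖ : ℂ) ^ 6 * planeCoord_pow_four_sub z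
      + (z 0 * z 1 / Real.pi / (‖z‖ : ℂ) ^ 4
        - 2 * a * (z 0 ^ 3 * z 1 - z 0 * z 1 ^ 3) / Real.pi / (‖z‖ : ℂ) ^ 6) * Complex.I_sq
  · refine ((((hB.const_smul _).const_smul c₁).add ((hB'.const_smul _).const_smul (-c₁))).add
      ((((hB.comp hB).const_smul _).const_smul c₃).add
        (((hB'.comp hB').const_smul _).const_smul c₄))).congr_ae ?_
    filter_upwards [ae_ne_zero_plane] with ξ hξ
    have hn : (‖ξ‖ : ℂ) ≠ 0 := by exact_mod_cast norm_ne_zero_iff.2 hξ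
    have h₁ : c₁ * (2 * Real.pi) = Complex.I / 4 := by
      simp only [c₁]
      field_simp
      norm_num
    have h₃ : c₃ * (2 * Real.pi) = b / 2 - a * Complex.I / 8 :=
      div_mul_cancel₀ _ (mul_ne_zero two_ne_zero hπ)
    have h₄ : c₄ * (2 * Real.pi) = b / 2 + a * Complex.I / 8 :=
      div_mul_cancel₀ _ (mul_ne_zero two_ne_zero hπ)
    simp only [beurlingSymbol_eq hI hξ, beurlingSymbol_eq neg_I_sq hξ, quarticSymbol]
    push_cast
    linear_combination (planeCoord (-Complex.I) ξ ^ 2 - planeCoord Complex.I ξ ^ 2)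
        / (‖ξ‖ : ℂ) ^ 2 * h₁
      + planeCoord Complex.I ξ ^ 4 / (‖ξ‖ : ℂ) ^ 4 * h₃
      + planeCoord (-Complex.I) ξ ^ 4 / (‖ξ‖ : ℂ) ^ 4 * h₄
      - Complex.I / 4 / (‖ξ‖ : ℂ) ^ 2 * planeCoord_sq_sub ξ
      + b / 2 / (‖ξ‖ : ℂ) ^ 4 * planeCoord_pow_four_add ξ
      - a * Complex.I / 8 / (‖ξ‖ : ℂ) ^ 4 * planeCoord_pow_four_sub ξ
      - (ξ 0 * ξ 1 / (‖ξ‖ : ℂ) ^ 2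
        + a * (ξ 0 ^ 3 * ξ 1 - ξ 0 * ξ 1 ^ 3) / (‖ξ‖ : ℂ) ^ 4) * Complex.I_sq

/-- The operator with kernel `-(1/π) xy/|z|⁴`. -/
lemma exists_riesz_operator {B B' : L2Plane →L[ℂ] L2Plane}
    (hB : IsFourierMultiplier (beurlingSymbol Complex.I) B)
    (hB' : IsFourierMultiplier (beurlingSymbol (-Complex.I)) B') :
    ∃ T : L2Plane →L[ℂ] L2Plane, IsSingularIntegralOperator (rieszKernel 2 polyP2) T ∧
      IsFourierMultiplier (fun ξ => ((ξ 0 * ξ 1 / ‖ξ‖ ^ 2 : ℝ) : ℂ)) T := by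
  obtain ⟨T, h1, h2⟩ := exists_quartic_operator 0 0 hB hB'
  refine ⟨T, (h1.congr_kernel fun z _ => ?_).isSingularIntegralOperator, ?_⟩
  · rw [twoTermKernel_eq]
    simp [rieszKernel, polyP2]
    ring
  · simpa [quarticSymbol] using h2

/-- For `|α| < 1` the Fourier multiplier `1 + α (x² - y²)/|ξ|²` defines an invertible element of the
Calderón–Zygmund algebra. -/
lemma exists_invertible_of_abs_lt_one {α : ℝ} (hα : |α| < 1) {B B' : L2Plane →L[ℂ] L2Plane}
    (hB : IsFourierMultiplier (beurlingSymbol Complex.I) B)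
    (hB' : IsFourierMultiplier (beurlingSymbol (-Complex.I)) B') :
    ∃ U : L2Plane →L[ℂ] L2Plane, IsInvertibleInCZAlgebra U ∧
      IsFourierMultiplier (fun ξ => ((1 + α * ((ξ 0 ^ 2 - ξ 1 ^ 2) / ‖ξ‖ ^ 2) : ℝ) : ℂ)) U := by
  have hI := Complex.I_sq
  have hπ : (Real.pi : ℂ) ≠ 0 := by exact_mod_cast Real.pi_ne_zero
  -- The root of αq² - 2q + α = 0 inside the unit interval. With σ the Beurling symbol, 1 + α(x² -
  -- y²)/|ξ|² = 1 - α(σ + σ⁻¹)/2 then becomes (1 - qσ)(1 - qσ⁻¹)/(1 + q²).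
  obtain ⟨q, hq, hαq⟩ : ∃ q : ℝ, |q| < 1 ∧ α * (1 + q ^ 2) = 2 * q := by
    have h1 : α ^ 2 < 1 := (sq_lt_one_iff_abs_lt_one α).2 hα
    have h2 : 0 < √(1 - α ^ 2) := Real.sqrt_pos.2 (by linarith)
    have h3 : √(1 - α ^ 2) ^ 2 = 1 - α ^ 2 := Real.sq_sqrt (by linarith)
    refine ⟨α / (1 + √(1 - α ^ 2)), ?_, ?_⟩
    · rw [abs_div, abs_of_pos (show 0 < 1 + √(1 - α ^ 2) by positivity),
        div_lt_one (by positivity)]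
      linarith
    · field_simp
      linear_combination α * h3
  have hq' : ‖(q : ℂ)‖ < 1 := by rwa [Complex.norm_real]
  have hq2 : q ^ 2 < 1 := (sq_lt_one_iff_abs_lt_one q).2 hq
  obtain ⟨Bq, hBq⟩ := exists_geometric_beurling hI hq'
  obtain ⟨Bq', hBq'⟩ := exists_geometric_beurling neg_I_sq hq'
  -- The constant term of the inverse symbol, whose nonconstant part is c times the two geometric
  -- sums in qσ and qσ⁻¹.
  set c : ℝ := (1 + q ^ 2) / (1 - q ^ 2) with hc
  let S : L2Plane →L[ℂ] L2Plane := (-(α : ℂ) / (4 * Real.pi)) • ((2 * Real.pi : ℂ) • B)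
    + (-(α : ℂ) / (4 * Real.pi)) • ((2 * Real.pi : ℂ) • B')
  let S' : L2Plane →L[ℂ] L2Plane := ((c : ℂ) / (2 * Real.pi)) • ((2 * Real.pi : ℂ) • Bq)
    + ((c : ℂ) / (2 * Real.pi)) • ((2 * Real.pi : ℂ) • Bq')
  let U : L2Plane →L[ℂ] L2Plane := ((1 : ℝ) : ℂ) • ContinuousLinearMap.id ℂ L2Plane + S
  let V : L2Plane →L[ℂ] L2Plane := (c : ℂ) • ContinuousLinearMap.id ℂ L2Plane + S'
  have hU := (isFourierMultiplier_id.const_smul ((1 : ℝ) : ℂ)).add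
    (((hB.const_smul (2 * Real.pi : ℂ)).const_smul (-(α : ℂ) / (4 * Real.pi))).add
      ((hB'.const_smul (2 * Real.pi : ℂ)).const_smul (-(α : ℂ) / (4 * Real.pi))))
  have hV := (isFourierMultiplier_id.const_smul (c : ℂ)).add
    (((hBq.const_smul (2 * Real.pi : ℂ)).const_smul ((c : ℂ) / (2 * Real.pi))).add
      ((hBq'.const_smul (2 * Real.pi : ℂ)).const_smul ((c : ℂ) / (2 * Real.pi))))
  have hUV : ∀ ξ : Plane, ξ ≠ 0 →
      (((1 : ℝ) : ℂ) * 1 + (-(α : ℂ) / (4 * Real.pi) * (2 * Real.pi * beurlingSymbol Complex.I ξ)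
        + -(α : ℂ) / (4 * Real.pi) * (2 * Real.pi * beurlingSymbol (-Complex.I) ξ)))
      * ((c : ℂ) * 1 + ((c : ℂ) / (2 * Real.pi) * (2 * Real.pi * (q * beurlingSymbol Complex.I ξ
          / (1 - q * beurlingSymbol Complex.I ξ)))
        + (c : ℂ) / (2 * Real.pi) * (2 * Real.pi * (q * beurlingSymbol (-Complex.I) ξ
          / (1 - q * beurlingSymbol (-Complex.I) ξ))))) = 1 := by
    intro ξ hξ
    have h1 := beurlingSymbol_mul_neg hI hξ
    have hne : ∀ w : ℂ, w ^ 2 = -1 → 1 - (q : ℂ) * beurlingSymbol w ξ ≠ 0 := by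
      intro w hw
      rw [← norm_ne_zero_iff]
      have := norm_one_sub_mul_beurlingSymbol hw q ξ
      linarith
    have hn1 := hne _ hI
    have hn2 := hne _ neg_I_sq
    have hq3 : (1 - (q : ℂ) ^ 2) ≠ 0 := by
      have : (1 - q ^ 2 : ℝ) ≠ 0 := by linarith
      exact_mod_cast this
    have hq4 : (1 + (q : ℂ) ^ 2) ≠ 0 := by
      have : (1 + q ^ 2 : ℝ) ≠ 0 := by positivity
      exact_mod_cast this
    have hα' : (α : ℂ) = 2 * q / (1 + q ^ 2) := by
      rw [eq_div_iff hq4]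
      exact_mod_cast hαq
    have hc' : (c : ℂ) = (1 + q ^ 2) / (1 - q ^ 2) := by
      rw [hc]
      push_cast
      rfl
    rw [hα', hc']
    push_cast
    generalize beurlingSymbol Complex.I ξ = s at *
    generalize beurlingSymbol (-Complex.I) ξ = t at *
    -- The Poisson kernel identity: the two-sided geometric series with ratio q in s and t = s⁻¹,
    -- summed in closed form.
    have hsum : (1 : ℂ) + (q * s / (1 - q * s) + q * t / (1 - q * t))
        = (1 - q ^ 2) / ((1 - q * s) * (1 - q * t)) := by
      rw [eq_div_iff (mul_ne_zero hn1 hn2)]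
      field_simp
      linear_combination -(q : ℂ) ^ 2 * h1
    have hprod : (1 - q * s) * (1 - q * t) = 1 + (q : ℂ) ^ 2 - q * (s + t) := by
      linear_combination (q : ℂ) ^ 2 * h1
    have hπ' : (Real.pi : ℂ) * (Real.pi : ℂ)⁻¹ = 1 := mul_inv_cancel₀ hπ
    calc _ = ((1 + (q : ℂ) ^ 2 - q * (s + t)) / (1 + q ^ 2)) * ((1 + q ^ 2) / (1 - q ^ 2)
          * (1 + (q * s / (1 - q * s) + q * t / (1 - q * t)))) := by
          congr 1
          · field_simp
            ring
          · field_simp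
      _ = 1 := by
          rw [hsum, ← hprod]
          field_simp
  have hsq2 : DifferentiableOn ℂ (fun τ : ℂ => τ ^ 2) (Metric.ball 0 2) := by fun_prop
  obtain ⟨R, hR, hne⟩ := exists_one_lt_norm_mul_sq_lt_one hq'
  have hgeom : DifferentiableOn ℂ (fun τ : ℂ => q * (τ ^ 2 * (1 - q * τ ^ 2)⁻¹))
      (Metric.ball 0 R) :=
    (DifferentiableOn.mul (by fun_prop) (DifferentiableOn.fun_inv (by fun_prop) hne)).const_mul _
  have hUA : U ∈ calderonZygmundAlgebra := by
    refine ⟨1, _, S, isSmoothHomogeneousKernel_re_boundaryKernel one_lt_two hsq2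
      (-α / (2 * Real.pi)), ?_, rfl⟩
    refine IsPrincipalValueOperator.isSingularIntegralOperator
      ((((isPrincipalValueOperator_sq hI hB).const_smul _).add
      ((isPrincipalValueOperator_sq neg_I_sq hB').const_smul _)).congr_kernel fun z _ => ?_)
    rw [← mul_add, boundaryKernel_I_add_neg_I (by simp)]
    push_cast
    ring
  have hVA : V ∈ calderonZygmundAlgebra := by
    refine ⟨c, _, S', isSmoothHomogeneousKernel_re_boundaryKernel hR hgeom (c / Real.pi), ?_, rfl⟩
    refine IsPrincipalValueOperator.isSingularIntegralOperator
      ((((isPrincipalValueOperator_geometric hI hq' hBq).const_smul _).add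
      ((isPrincipalValueOperator_geometric neg_I_sq hq' hBq').const_smul _)).congr_kernel
        fun z _ => ?_)
    rw [← mul_add, boundaryKernel_I_add_neg_I (by simp)]
    push_cast
    ring
  refine ⟨U, ⟨hUA, V, hVA, ?_, ?_⟩, hU.congr_ae ?_⟩
  · refine ((hU.comp hV).congr_ae ?_).unique isFourierMultiplier_id
    filter_upwards [ae_ne_zero_plane] with ξ hξ using hUV ξ hξ
  · refine ((hV.comp hU).congr_ae ?_).unique isFourierMultiplier_id
    filter_upwards [ae_ne_zero_plane] with ξ hξ
    rw [mul_comm]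
    exact hUV ξ hξ
  · filter_upwards [ae_ne_zero_plane] with ξ hξ
    simp only [beurlingSymbol_eq hI hξ, beurlingSymbol_eq neg_I_sq hξ]
    have h1 : -(α : ℂ) / (4 * Real.pi) * (2 * Real.pi) = -α / 2 := by
      field_simp
      norm_num
    push_cast
    linear_combination -(planeCoord Complex.I ξ ^ 2 + planeCoord (-Complex.I) ξ ^ 2)
      / (‖ξ‖ : ℂ) ^ 2 * h1 + α / 2 / (‖ξ‖ : ℂ) ^ 2 * planeCoord_sq_add ξ

/-- For `|α| < 1` the operator with kernel given by `P₄ = α (x³y - xy³)` factors through the higher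
Riesz transform with an invertible factor in the Calderón–Zygmund algebra. -/
lemma exists_factorization_of_abs_lt_one {α : ℝ} (hα : |α| < 1) :
    ∃ T R U : L2Plane →L[ℂ] L2Plane,
      IsSingularIntegralOperator (twoTermKernel (MvPolynomial.C α * polyA)) T ∧
      IsSingularIntegralOperator (rieszKernel 2 polyP2) R ∧
      IsInvertibleInCZAlgebra U ∧ T = R ∘L U := by
  obtain ⟨B, hB⟩ := exists_beurling Complex.I_sq
  obtain ⟨B', hB'⟩ := exists_beurling neg_I_sq
  obtain ⟨T, hT, hTm⟩ := exists_quartic_operator α 0 hB hB'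
  obtain ⟨R, hR, hRm⟩ := exists_riesz_operator hB hB'
  obtain ⟨U, hU, hUm⟩ := exists_invertible_of_abs_lt_one hα hB hB'
  refine ⟨T, R, U, ?_, hR, hU, (hTm.congr_ae ?_).unique (hRm.comp hUm)⟩
  · have := hT.isSingularIntegralOperator
    simpa using this
  -- Since x³y - xy³ = xy(x² - y²), the symbol of T is the product of the symbols of R and U.
  · filter_upwards [ae_ne_zero_plane] with ξ hξ
    rw [← Complex.ofReal_mul]
    congr 1
    have hn := norm_ne_zero_iff.2 hξ
    simp only [quarticSymbol]
    field_simp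
    ring

end

section

open FourierTransform SchwartzMap LineDeriv

/-! ### Gaussians -/

/-- (1 + r)^k ≤ k! exp(1 + r), and 1 + r - πr² ≤ 2. -/
lemma one_add_pow_mul_exp_neg_le (k : ℕ) {r : ℝ} (hr : 0 ≤ r) :
    (1 + r) ^ k * Real.exp (-Real.pi * r ^ 2) ≤ k.factorial * Real.exp 2 := by
  have h1 := Real.pow_div_factorial_le_exp (1 + r) (by linarith) k
  have h2 : (1 + r) + (-Real.pi * r ^ 2) ≤ 2 := by nlinarith [Real.pi_gt_three, sq_nonneg (r - 1)]
  rw [div_le_iff₀ (by positivity)] at h1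
  calc (1 + r) ^ k * Real.exp (-Real.pi * r ^ 2)
      ≤ Real.exp (1 + r) * k.factorial * Real.exp (-Real.pi * r ^ 2) := by gcongr
    _ = k.factorial * Real.exp ((1 + r) + (-Real.pi * r ^ 2)) := by
        rw [Real.exp_add (1 + r)]
        ring
    _ ≤ _ := by gcongr

/-- The bound for derivatives of a composition is applied to exp(-πt) and |z|². The derivatives cost
only a power of 1 + |z|, which the remaining Gaussian factor absorbs. -/
lemma exists_pow_mul_norm_iteratedFDeriv_gaussian_le (k n : ℕ) :
    ∃ C : ℝ, ∀ z : Plane,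
      ‖z‖ ^ k * ‖iteratedFDeriv ℝ n (fun z : Plane => Real.exp (-Real.pi * ‖z‖ ^ 2)) z‖ ≤ C := by
  obtain ⟨l, D, hD0, hD⟩ :=
    (Function.hasTemperateGrowth_norm_sq Plane).norm_iteratedFDeriv_le_uniform n
  have hexp : ContDiff ℝ n (fun t : ℝ => Real.exp (-Real.pi * t)) := by fun_prop
  have hsq : ContDiff ℝ n (fun z : Plane => ‖z‖ ^ 2) := contDiff_id.norm_sq ℝ
  refine ⟨n.factorial * Real.pi ^ n * (1 + D) ^ n * ((k + l * n).factorial * Real.exp 2),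
    fun z => ?_⟩
  have hz : 1 ≤ 1 + ‖z‖ := by linarith [norm_nonneg z]
  have hπ : 1 ≤ Real.pi := by linarith [Real.pi_gt_three]
  have h1 := norm_iteratedFDeriv_comp_le (x := z) hexp hsq le_rfl
    (C := Real.pi ^ n * Real.exp (-Real.pi * ‖z‖ ^ 2)) (D := (1 + D) * (1 + ‖z‖) ^ l)
    (fun i hi => by
      rw [norm_iteratedFDeriv_eq_norm_iteratedDeriv, iteratedDeriv_exp_const_mul, norm_mul,
        norm_pow, norm_neg, Real.norm_of_nonneg Real.pi_pos.le, Real.norm_of_nonneg (Real.exp_pos _).le]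
      gcongr)
    (fun i hi hi' => by
      have h2 : 1 ≤ (1 + ‖z‖) ^ l := one_le_pow₀ hz
      have h3 : 1 ≤ (1 + D) * (1 + ‖z‖) ^ l := by nlinarith
      calc _ ≤ D * (1 + ‖z‖) ^ l := hD i hi' z
        _ ≤ (1 + D) * (1 + ‖z‖) ^ l := by nlinarith
        _ ≤ _ := le_self_pow₀ h3 (by omega))
  calc _ ≤ (1 + ‖z‖) ^ k * (n.factorial * (Real.pi ^ n * Real.exp (-Real.pi * ‖z‖ ^ 2))
        * ((1 + D) * (1 + ‖z‖) ^ l) ^ n) := by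
        gcongr
        · linarith
        · exact h1
    _ = n.factorial * Real.pi ^ n * (1 + D) ^ n
        * ((1 + ‖z‖) ^ (k + l * n) * Real.exp (-Real.pi * ‖z‖ ^ 2)) := by
        rw [pow_add, pow_mul, mul_pow]
        ring
    _ ≤ _ := by
        exact mul_le_mul_of_nonneg_left (one_add_pow_mul_exp_neg_le _ (norm_nonneg z))
          (by positivity)

/-- The Gaussian `exp(-π|z|²)` as a Schwartz function. -/
def gaussianSchwartz : 𝓢(Plane, ℂ) :=
  SchwartzMap.postcompCLM Complex.ofRealCLM
    { toFun := fun z => Real.exp (-Real.pi * ‖z‖ ^ 2)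
      smooth' := Real.contDiff_exp.comp (contDiff_const.mul (contDiff_id.norm_sq ℝ))
      decay' := exists_pow_mul_norm_iteratedFDeriv_gaussian_le }

lemma gaussianSchwartz_apply (z : Plane) :
    gaussianSchwartz z = (Real.exp (-Real.pi * ‖z‖ ^ 2) : ℂ) := by
  rfl

lemma fourier_gaussianSchwartz : 𝓕 gaussianSchwartz = gaussianSchwartz := by
  ext ξ
  have h := fourier_gaussian_innerProductSpace (V := Plane) (b := (Real.pi : ℂ))
    (by simpa using Real.pi_pos) ξ
  have hπ : (Real.pi : ℂ) ≠ 0 := by exact_mod_cast Real.pi_ne_zero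
  rw [SchwartzMap.fourier_coe]
  have e : (gaussianSchwartz : Plane → ℂ) = fun v : Plane => Complex.exp (-Real.pi * ‖v‖ ^ 2) := by
    ext v
    rw [gaussianSchwartz_apply]
    push_cast
    rfl
  rw [e, h, div_self hπ, Complex.one_cpow, one_mul]
  congr 1
  field_simp

/-- The Gaussian times a monomial in `x + w y` and `x - w y`. -/
def gaussianMonomial (w : ℂ) (j k : ℕ) : 𝓢(Plane, ℂ) :=
  smulLeftCLM ℂ (fun z => planeCoord w z ^ j * planeCoord (-w) z ^ k) gaussianSchwartz

lemma hasTemperateGrowth_planeCoord (w : ℂ) : (planeCoord w).HasTemperateGrowth := by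
  have h : planeCoord w = fun z : Plane =>
      ((inner ℝ z (planeBasis 0) : ℝ) : ℂ) + w * ((inner ℝ z (planeBasis 1) : ℝ) : ℂ) := by
    ext z
    rw [inner_planeBasis, inner_planeBasis]
    rfl
  rw [h]
  fun_prop

lemma gaussianMonomial_apply (w : ℂ) (j k : ℕ) (z : Plane) :
    gaussianMonomial w j k z
      = planeCoord w z ^ j * planeCoord (-w) z ^ k * gaussianSchwartz z := by
  have h1 := hasTemperateGrowth_planeCoord w
  have h2 := hasTemperateGrowth_planeCoord (-w)
  rw [gaussianMonomial, smulLeftCLM_apply_apply (by fun_prop), smul_eq_mul]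

/-- The first order operator `∂_x + w ∂_y`. -/
def planeDeriv (w : ℂ) (g : 𝓢(Plane, ℂ)) : 𝓢(Plane, ℂ) :=
  ∂_{planeBasis 0} g + w • ∂_{planeBasis 1} g

lemma fourier_planeDeriv (w : ℂ) (g : 𝓢(Plane, ℂ)) (ξ : Plane) :
    (𝓕 (planeDeriv w g)) ξ = 2 * Real.pi * Complex.I * planeCoord w ξ * (𝓕 g) ξ := by
  have hv : ∀ v, (fun ξ : Plane => inner ℝ ξ v).HasTemperateGrowth := fun v => by fun_prop
  simp only [planeDeriv, FourierTransform.fourier_add, FourierTransform.fourier_smul,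
    fourier_lineDerivOp_eq, _root_.add_apply, _root_.smul_apply, smulLeftCLM_apply_apply (hv _),
    smul_eq_mul, Complex.real_smul]
  rw [inner_planeBasis, inner_planeBasis, planeCoord]
  ring

lemma planeDeriv_gaussianMonomial_apply (w' w : ℂ) (j k : ℕ) (z : Plane) :
    planeDeriv w' (gaussianMonomial w j k) z
      = (j * planeCoord w z ^ (j - 1) * (1 + w' * w) * planeCoord (-w) z ^ k
          + k * planeCoord (-w) z ^ (k - 1) * (1 - w' * w) * planeCoord w z ^ j
          - 2 * Real.pi * planeCoord w' z * (planeCoord w z ^ j * planeCoord (-w) z ^ k))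
        * gaussianSchwartz z := by
  have key : ∀ v : Plane, ∂_{v} (gaussianMonomial w j k) z
      = (j * planeCoord w z ^ (j - 1) * planeCoord w v * planeCoord (-w) z ^ k
          + k * planeCoord (-w) z ^ (k - 1) * planeCoord (-w) v * planeCoord w z ^ j
          - 2 * Real.pi * inner ℝ z v * (planeCoord w z ^ j * planeCoord (-w) z ^ k))
        * gaussianSchwartz z := by
    intro v
    have h1 := (hasDerivAt_planeCoord (w := w) z v).fun_pow j
    have h2 := (hasDerivAt_planeCoord (w := -w) z v).fun_pow k
    have h3 : HasDerivAt (fun t : ℝ => z + t • v) v 0 := by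
      simpa using ((hasDerivAt_id (0 : ℝ)).smul_const v).const_add z
    have h4 := ((h3.norm_sq.const_mul (-Real.pi)).exp).ofReal_comp
    have h5 := (h1.mul h2).mul h4
    rw [SchwartzMap.lineDerivOp_apply, lineDeriv]
    have e : (fun t : ℝ => gaussianMonomial w j k (z + t • v)) = fun t : ℝ =>
        planeCoord w (z + t • v) ^ j * planeCoord (-w) (z + t • v) ^ k
          * ((Real.exp (-Real.pi * ‖z + t • v‖ ^ 2) : ℝ) : ℂ) := by
      ext t
      rw [gaussianMonomial_apply, gaussianSchwartz_apply]
    rw [e]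
    refine h5.deriv.trans ?_
    simp only [zero_smul, add_zero, gaussianSchwartz_apply, Pi.mul_apply]
    push_cast
    ring
  simp only [planeDeriv, _root_.add_apply, _root_.smul_apply, smul_eq_mul, key,
    planeCoord_planeBasis_zero, planeCoord_planeBasis_one]
  rw [inner_planeBasis, inner_planeBasis, planeCoord.eq_1 w' z]
  ring

variable {w : ℂ}

lemma planeDeriv_gaussianMonomial_zero (hw : w ^ 2 = -1) (j : ℕ) :
    planeDeriv w (gaussianMonomial w j 0) = (-(2 * Real.pi) : ℂ) • gaussianMonomial w (j + 1) 0 := by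
  ext z
  rw [planeDeriv_gaussianMonomial_apply, _root_.smul_apply, gaussianMonomial_apply, ← sq, hw,
    smul_eq_mul]
  push_cast
  ring

lemma planeDeriv_neg_gaussianMonomial (hw : w ^ 2 = -1) (j : ℕ) :
    planeDeriv (-w) (gaussianMonomial w (j + 1) 0) = (2 * (j + 1) : ℂ) • gaussianMonomial w j 0
      + (-(2 * Real.pi) : ℂ) • gaussianMonomial w (j + 1) 1 := by
  ext z
  rw [planeDeriv_gaussianMonomial_apply, _root_.add_apply, _root_.smul_apply, _root_.smul_apply,
    gaussianMonomial_apply, gaussianMonomial_apply, neg_mul, ← sq, hw, smul_eq_mul, smul_eq_mul,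
    Nat.add_sub_cancel]
  push_cast
  ring

/-- ∂_x + w∂_y annihilates powers of x + wy, so applied to such a power times the Gaussian it only
raises the exponent, with factor -2π. On the Fourier side it multiplies by 2πi(x + wy), and
induction on the exponent closes. -/
lemma fourier_gaussianMonomial_zero (hw : w ^ 2 = -1) (j : ℕ) (ξ : Plane) :
    (𝓕 (gaussianMonomial w j 0)) ξ = (-Complex.I) ^ j * gaussianMonomial w j 0 ξ := by
  have hπ : (Real.pi : ℂ) ≠ 0 := by exact_mod_cast Real.pi_ne_zero
  induction j with
  | zero =>
    have h : gaussianMonomial w 0 0 = gaussianSchwartz := by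
      ext z
      simp [gaussianMonomial_apply]
    rw [h, fourier_gaussianSchwartz, pow_zero, one_mul]
  | succ j ih =>
    have h := fourier_planeDeriv w (gaussianMonomial w j 0) ξ
    rw [planeDeriv_gaussianMonomial_zero hw, FourierTransform.fourier_smul, _root_.smul_apply, ih,
      smul_eq_mul, gaussianMonomial_apply] at h
    rw [gaussianMonomial_apply]
    refine mul_left_cancel₀ (mul_ne_zero (neg_ne_zero.2 two_ne_zero) hπ) ?_
    linear_combination h

/-- Here ∂_x - w∂_y is applied once to the preceding case. It does differentiate the power of x +
wy, and this produces the extra lower order term with factor (j + 1)/π. -/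
lemma fourier_gaussianMonomial_one (hw : w ^ 2 = -1) (j : ℕ) (ξ : Plane) :
    (𝓕 (gaussianMonomial w (j + 1) 1)) ξ = (-Complex.I) ^ j
      * ((j + 1) / Real.pi * gaussianMonomial w j 0 ξ - gaussianMonomial w (j + 1) 1 ξ) := by
  have hπ : (Real.pi : ℂ) ≠ 0 := by exact_mod_cast Real.pi_ne_zero
  have h := fourier_planeDeriv (-w) (gaussianMonomial w (j + 1) 0) ξ
  rw [planeDeriv_neg_gaussianMonomial hw, FourierTransform.fourier_add,
    FourierTransform.fourier_smul, FourierTransform.fourier_smul, _root_.add_apply,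
    _root_.smul_apply, _root_.smul_apply, fourier_gaussianMonomial_zero hw,
    fourier_gaussianMonomial_zero hw, smul_eq_mul, smul_eq_mul] at h
  have h1 : gaussianMonomial w (j + 1) 1 ξ
      = planeCoord (-w) ξ * gaussianMonomial w (j + 1) 0 ξ := by
    rw [gaussianMonomial_apply, gaussianMonomial_apply]
    ring
  rw [h1]
  have h2 : (Real.pi : ℂ) * (Real.pi : ℂ)⁻¹ = 1 := mul_inv_cancel₀ hπ
  refine mul_left_cancel₀ (mul_ne_zero (neg_ne_zero.2 two_ne_zero) hπ) ?_
  rw [div_eq_mul_inv]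
  linear_combination h + 2 * (-Complex.I) ^ j * (j + 1) * gaussianMonomial w j 0 ξ * h2
    - 2 * Real.pi * planeCoord (-w) ξ * (-Complex.I) ^ j
      * gaussianMonomial w (j + 1) 0 ξ * Complex.I_sq

/-- The Schwartz kernel
`(-(1/π) xy |z|² + (2/π) (a (x³y - xy³) + b (x⁴ + y⁴ - 6x²y²))) exp(-π|z|²)`. -/
def quarticGaussian (a b : ℝ) : 𝓢(Plane, ℂ) :=
  (Complex.I / (4 * Real.pi)) • gaussianMonomial Complex.I 3 1
    + (-(Complex.I / (4 * Real.pi))) • gaussianMonomial (-Complex.I) 3 1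
    + ((b - a * Complex.I / 4) / Real.pi) • gaussianMonomial Complex.I 4 0
    + ((b + a * Complex.I / 4) / Real.pi) • gaussianMonomial (-Complex.I) 4 0

lemma quarticGaussian_apply (a b : ℝ) (z : Plane) :
    quarticGaussian a b z = (((-(1 / Real.pi) * (z 0 * z 1 * ‖z‖ ^ 2)
      + 2 / Real.pi * (a * (z 0 ^ 3 * z 1 - z 0 * z 1 ^ 3)
        + b * (z 0 ^ 4 + z 1 ^ 4 - 6 * (z 0 ^ 2 * z 1 ^ 2))))
          * Real.exp (-Real.pi * ‖z‖ ^ 2) : ℝ) : ℂ) := by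
  have h1 := planeCoord_mul_neg Complex.I_sq z
  simp only [quarticGaussian, _root_.add_apply, _root_.smul_apply, smul_eq_mul,
    gaussianMonomial_apply, neg_neg, gaussianSchwartz_apply]
  push_cast at h1 ⊢
  generalize Complex.exp (-Real.pi * (‖z‖ : ℂ) ^ 2) = g
  linear_combination g * (Complex.I / (4 * Real.pi)
      * (planeCoord Complex.I z ^ 2 - planeCoord (-Complex.I) z ^ 2) * h1
    + Complex.I / (4 * Real.pi) * (‖z‖ : ℂ) ^ 2 * planeCoord_sq_sub z
    + b / Real.pi * planeCoord_pow_four_add z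
    - a * Complex.I / 4 / Real.pi * planeCoord_pow_four_sub z
    + (z 0 * z 1 * (‖z‖ : ℂ) ^ 2 / Real.pi
      - 2 * a * (z 0 ^ 3 * z 1 - z 0 * z 1 ^ 3) / Real.pi) * Complex.I_sq)

/-- The quartic part is fixed, since (-i)⁴ = 1. The quadratic part, being multiplied by |z|²,
acquires the correction -3/π. The quadratic-to-quartic ratio thus differs from that of the symbol of
T, and this is what isolates p. -/
lemma fourier_quarticGaussian (a b : ℝ) (ξ : Plane) :
    (𝓕 (quarticGaussian a b)) ξ = (((-(1 / Real.pi) * (ξ 0 * ξ 1 * (‖ξ‖ ^ 2 - 3 / Real.pi))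
      + 2 / Real.pi * (a * (ξ 0 ^ 3 * ξ 1 - ξ 0 * ξ 1 ^ 3)
        + b * (ξ 0 ^ 4 + ξ 1 ^ 4 - 6 * (ξ 0 ^ 2 * ξ 1 ^ 2))))
          * Real.exp (-Real.pi * ‖ξ‖ ^ 2) : ℝ) : ℂ) := by
  have h1 := planeCoord_mul_neg Complex.I_sq ξ
  simp only [quarticGaussian, FourierTransform.fourier_add,
    FourierTransform.fourier_smul, _root_.add_apply, _root_.smul_apply,
    smul_eq_mul, fourier_gaussianMonomial_zero Complex.I_sq, fourier_gaussianMonomial_zero neg_I_sq,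
    fourier_gaussianMonomial_one Complex.I_sq 2, fourier_gaussianMonomial_one neg_I_sq 2,
    gaussianMonomial_apply, neg_neg, gaussianSchwartz_apply]
  have h2 : (-Complex.I) ^ 4 = 1 := by linear_combination (Complex.I ^ 2 - 1) * Complex.I_sq
  rw [h2, neg_I_sq]
  push_cast at h1 ⊢
  generalize Complex.exp (-Real.pi * (‖ξ‖ : ℂ) ^ 2) = g
  linear_combination g * (Complex.I / (4 * Real.pi)
      * (planeCoord Complex.I ξ ^ 2 - planeCoord (-Complex.I) ξ ^ 2) * h1
    + Complex.I / (4 * Real.pi) * ((‖ξ‖ : ℂ) ^ 2 - 3 / Real.pi) * planeCoord_sq_sub ξ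
    + b / Real.pi * planeCoord_pow_four_add ξ
    - a * Complex.I / 4 / Real.pi * planeCoord_pow_four_sub ξ
    + (ξ 0 * ξ 1 * ((‖ξ‖ : ℂ) ^ 2 - 3 / Real.pi) / Real.pi
      - 2 * a * (ξ 0 ^ 3 * ξ 1 - ξ 0 * ξ 1 ^ 3) / Real.pi) * Complex.I_sq)

end

section

open FourierTransform SchwartzMap LineDeriv

/-! ### Radial averages of truncated integrals -/

lemma hasDerivAt_inv_one_add_sq (t : ℝ) :
    HasDerivAt (fun t : ℝ => -(2 * (1 + t ^ 2))⁻¹) (t / (1 + t ^ 2) ^ 2) t := by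
  have h1 : (2 * (1 + t ^ 2)) ≠ 0 := by positivity
  have h2 := ((((hasDerivAt_id t).fun_pow 2).const_add 1).const_mul 2).fun_inv h1
  convert! h2.neg using 1
  simp only [id]
  have h3 : (1 + t ^ 2) ≠ 0 := by positivity
  field_simp
  push_cast
  ring

lemma integral_div_one_add_sq_sq (r : ℝ) :
    ∫ t in (0 : ℝ)..r, t / (1 + t ^ 2) ^ 2 = r ^ 2 / (2 * (1 + r ^ 2)) := by
  rw [intervalIntegral.integral_eq_sub_of_hasDerivAt (fun t _ => hasDerivAt_inv_one_add_sq t)]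
  · have h3 : (1 + r ^ 2) ≠ 0 := by positivity
    field_simp
    ring
  · refine Continuous.intervalIntegrable ?_ _ _
    exact continuous_id.div₀ (by fun_prop) fun t => by positivity

lemma integrableOn_div_one_add_sq_sq :
    IntegrableOn (fun t : ℝ => t / (1 + t ^ 2) ^ 2) (Set.Ioi 0) := by
  refine integrableOn_Ioi_deriv_of_nonneg' (g := fun t : ℝ => -(2 * (1 + t ^ 2))⁻¹) (l := -0)
    (fun t _ => hasDerivAt_inv_one_add_sq t) (fun t ht => ?_) ?_
  · have : 0 < t := ht
    positivity
  · refine (tendsto_inv_atTop_zero.comp ?_).neg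
    refine Tendsto.const_mul_atTop two_pos (tendsto_const_nhds.add_atTop ?_)
    exact tendsto_pow_atTop two_ne_zero

section

variable {K : Plane → ℝ} {D C : ℝ} {φ : ℝ → ℝ}

/-- The majorant t/(1 + t²)² integrates to r²/(2(1 + r²)) over (0, r): the r² cancels the
singularity of K at the origin, and the product is O(1/(1 + |y|²)), hence square integrable. -/
lemma abs_kernel_mul_integral_le (hKD : ∀ y, |K y| ≤ D / ‖y‖ ^ 2) (hφ : Continuous φ)
    (hC : ∀ t, 0 < t → |φ t| ≤ C * (t / (1 + t ^ 2) ^ 2)) (y : Plane) :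
    |K y| * ∫ t in (0 : ℝ)..‖y‖, |φ t| ≤ D * C / 2 / poissonRadius 1 y ^ 2 := by
  have hC0 : 0 ≤ C := by
    have := (abs_nonneg _).trans (hC 1 one_pos)
    linarith
  have h1 : ∫ t in (0 : ℝ)..‖y‖, |φ t| ≤ C * (‖y‖ ^ 2 / (2 * (1 + ‖y‖ ^ 2))) := by
    rw [← integral_div_one_add_sq_sq, ← intervalIntegral.integral_const_mul]
    refine intervalIntegral.integral_mono_on_of_le_Ioo (norm_nonneg y)
      (hφ.abs.intervalIntegrable _ _) ?_ fun t ht => hC t ht.1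
    refine Continuous.intervalIntegrable (continuous_const.mul ?_) _ _
    exact continuous_id.div₀ (by fun_prop) fun t => by positivity
  rw [poissonRadius_sq]
  rcases eq_or_ne y 0 with rfl | hy
  · have hD : 0 ≤ D := by
      obtain ⟨y, hy⟩ := exists_ne (0 : Plane)
      have h2 := (abs_nonneg _).trans (hKD y)
      have h3 : 0 < ‖y‖ ^ 2 := by positivity
      by_contra! h4
      exact absurd h2 (not_le.2 (div_neg_of_neg_of_pos h4 h3))
    simp only [norm_zero, intervalIntegral.integral_same, mul_zero]
    positivity
  · have hy' : 0 < ‖y‖ := norm_pos_iff.2 hy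
    have h2 := hKD y
    calc |K y| * ∫ t in (0 : ℝ)..‖y‖, |φ t|
        ≤ D / ‖y‖ ^ 2 * (C * (‖y‖ ^ 2 / (2 * (1 + ‖y‖ ^ 2)))) := by
          refine mul_le_mul h2 h1 ?_ ((abs_nonneg _).trans h2)
          exact intervalIntegral.integral_nonneg hy'.le fun t _ => abs_nonneg _
      _ = _ := by
          have h3 : (1 + ‖y‖ ^ 2) ≠ 0 := by positivity
          field_simp

/-- The left side is ∫₀^∞ φ(t) T^t f(x) dt with the order of integration exchanged: a point y
contributes to T^t exactly when t < |y|. Each |T^t f(x)| is at most the maximal function, and A is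
the L¹ norm of φ. -/
lemma exists_enorm_integral_radial_le (hK : Measurable K) (hKD : ∀ y, |K y| ≤ D / ‖y‖ ^ 2)
    (hφ : Continuous φ) (hC : ∀ t, 0 < t → |φ t| ≤ C * (t / (1 + t ^ 2) ^ 2)) :
    ∃ A : ℝ≥0, ∀ (f : L2Plane) (x : Plane),
      ‖∫ y, f (x - y) * ((K y * ∫ t in (0 : ℝ)..‖y‖, φ t : ℝ) : ℂ)‖ₑ
        ≤ A * maximalSingularIntegral K f x := by
  have hφint : IntegrableOn φ (Set.Ioi 0) := by
    refine (integrableOn_div_one_add_sq_sq.const_mul C).mono' hφ.aestronglyMeasurable ?_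
    filter_upwards [ae_restrict_mem measurableSet_Ioi] with t ht using hC t ht
  refine ⟨(∫⁻ t in Set.Ioi (0 : ℝ), ‖φ t‖ₑ).toNNReal, fun f x => ?_⟩
  rw [ENNReal.coe_toNNReal hφint.2.ne]
  let F : Plane × ℝ → ℂ := fun p =>
    f (x - p.1) * (K p.1 : ℂ) * ({p : Plane × ℝ | p.2 < ‖p.1‖}.indicator (fun p => (φ p.2 : ℂ)) p)
  have hset : MeasurableSet {p : Plane × ℝ | p.2 < ‖p.1‖} :=
    measurableSet_lt measurable_snd measurable_fst.norm
  have hFm : AEStronglyMeasurable F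
      ((volume : Measure Plane).prod (volume.restrict (Set.Ioi (0 : ℝ)))) := by
    refine ((memLp_comp_const_sub (Lp.memLp f) x).1.comp_fst.mul ?_).mul ?_
    · exact (Complex.measurable_ofReal.comp (hK.comp measurable_fst)).aestronglyMeasurable
    · exact ((Complex.measurable_ofReal.comp
        (hφ.measurable.comp measurable_snd)).indicator hset).aestronglyMeasurable
  have hind : ∀ (y : Plane) (t : ℝ), F (y, t)
      = (Set.Iio ‖y‖).indicator (fun t => f (x - y) * (K y : ℂ) * (φ t : ℂ)) t := by
    intro y t
    simp only [F, Set.indicator, Set.mem_ofPred_eq, Set.mem_Iio]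
    split_ifs <;> simp
  have hIoo : ∀ y : Plane, Set.Iio ‖y‖ ∩ Set.Ioi 0 = Set.Ioo 0 ‖y‖ := fun y => by
    rw [Set.inter_comm, Set.Ioi_inter_Iio]
  have hIio : ∀ (y : Plane) (g : ℝ → ℂ),
      ∫ t in Set.Ioi (0 : ℝ), (Set.Iio ‖y‖).indicator g t = ∫ t in (0 : ℝ)..‖y‖, g t := by
    intro y g
    rw [integral_indicator measurableSet_Iio, Measure.restrict_restrict measurableSet_Iio, hIoo,
      intervalIntegral.integral_of_le (norm_nonneg y), integral_Ioc_eq_integral_Ioo]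
  have hcont : ∀ y : Plane, Continuous fun t => f (x - y) * (K y : ℂ) * (φ t : ℂ) := fun y =>
    continuous_const.mul (Complex.continuous_ofReal.comp hφ)
  have hFint : Integrable F ((volume : Measure Plane).prod (volume.restrict (Set.Ioi (0 : ℝ)))) := by
    rw [integrable_prod_iff hFm]
    constructor
    · refine .of_forall fun y => ?_
      simp only [hind]
      rw [integrable_indicator_iff measurableSet_Iio, IntegrableOn,
        Measure.restrict_restrict measurableSet_Iio, hIoo]
      exact ((hcont y).integrableOn_Icc).mono_set Set.Ioo_subset_Icc_self
    -- Integrating |F| first in t leaves |f(x - y)| times a bounded multiple of 1/(1 + |y|²), a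
    -- product of two L² functions.
    · have hs : MemLp (fun y : Plane => ((D * C / 2 / poissonRadius 1 y ^ 2 : ℝ) : ℂ)) 2 volume := by
        refine memLp_two_of_norm_le_poissonRadius one_pos (C := |D * C / 2|) ?_ fun z => ?_
        · refine (Complex.continuous_ofReal.comp ?_).aestronglyMeasurable
          exact continuous_const.div₀ (continuous_poissonRadius.pow 2)
            fun z => (pow_pos (poissonRadius_pos one_pos z) 2).ne'
        · rw [Complex.norm_real, norm_div, Real.norm_eq_abs, Real.norm_of_nonneg (by positivity)]
      refine (integrable_sub_mul (Lp.memLp f) hs x).norm.mono' hFm.norm.integral_prod_right' ?_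
      refine .of_forall fun y => ?_
      have e : ∫ t in Set.Ioi (0 : ℝ), ‖F (y, t)‖
          = ‖f (x - y)‖ * (|K y| * ∫ t in (0 : ℝ)..‖y‖, |φ t|) := by
        simp only [hind, norm_indicator_eq_indicator_norm, norm_mul, Complex.norm_real,
          Real.norm_eq_abs]
        rw [integral_indicator measurableSet_Iio, Measure.restrict_restrict measurableSet_Iio, hIoo,
          ← integral_Ioc_eq_integral_Ioo, ← intervalIntegral.integral_of_le (norm_nonneg y),
          intervalIntegral.integral_const_mul, mul_assoc]
      have h1 := abs_kernel_mul_integral_le hKD hφ hC y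
      rw [Real.norm_of_nonneg (integral_nonneg fun t => norm_nonneg _), e, norm_mul,
        Complex.norm_real]
      gcongr
      exact h1.trans (le_abs_self _)
  have hleft : ∫ y, f (x - y) * ((K y * ∫ t in (0 : ℝ)..‖y‖, φ t : ℝ) : ℂ)
      = ∫ t in Set.Ioi (0 : ℝ), ∫ y, F (y, t) := by
    rw [← integral_integral_swap (f := fun y t => F (y, t)) hFint]
    refine integral_congr_ae (.of_forall fun y => ?_)
    simp only [hind, hIio]
    rw [intervalIntegral.integral_const_mul, intervalIntegral.integral_ofReal]
    push_cast
    ring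
  have hright : ∀ t : ℝ, ∫ y, F (y, t) = φ t * truncatedIntegral K t f x := by
    intro t
    rw [truncatedIntegral, setIntegral_sub_mul (fun y => (K y : ℂ)), ← integral_const_mul]
    refine integral_congr_ae (.of_forall fun y => ?_)
    simp only [F, Set.indicator, Set.mem_ofPred_eq]
    split_ifs
    · ring
    · simp
  rw [hleft]
  calc _ ≤ ∫⁻ t in Set.Ioi (0 : ℝ), ‖∫ y, F (y, t)‖ₑ := enorm_integral_le_lintegral_enorm _
    _ ≤ ∫⁻ t in Set.Ioi (0 : ℝ), ‖φ t‖ₑ * maximalSingularIntegral K f x := by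
        refine setLIntegral_mono' measurableSet_Ioi fun t ht => ?_
        rw [hright, enorm_mul]
        refine mul_le_mul' (by simp [enorm, nnnorm]) ?_
        exact le_iSup₂ (f := fun (ε : ℝ) (_ : 0 < ε) => ‖truncatedIntegral K ε f x‖ₑ) t ht
    _ = _ := lintegral_mul_const _ hφ.measurable.enorm

end

/-! ### The multiplier inequality -/

lemma eLpNorm_fourier (f : L2Plane) :
    eLpNorm (𝓕 f : L2Plane) 2 volume = eLpNorm f 2 volume := by
  rw [← Lp.enorm_def, ← Lp.enorm_def, ← ofReal_norm, ← ofReal_norm, Lp.norm_fourier_eq]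

lemma eLpNorm_fourier_schwartz (g : 𝓢(Plane, ℂ)) :
    eLpNorm (𝓕 g : 𝓢(Plane, ℂ)) 2 (volume : Measure Plane) = eLpNorm g 2 volume := by
  have h := eLpNorm_fourier (g.toLp 2)
  rwa [SchwartzMap.toLp_fourier_eq, eLpNorm_congr_ae ((𝓕 g).coeFn_toLp 2 volume),
    eLpNorm_congr_ae (g.coeFn_toLp 2 volume)] at h

/-- Take f with Fourier transform η. By Plancherel the left side is the norm of the convolution of b
with f, dominated pointwise by T^*f, and the right side is the norm of Tf. -/
lemma exists_eLpNorm_fourier_mul_le {K : Plane → ℝ} {D C : ℝ} {φ : ℝ → ℝ}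
    (hK : Measurable K) (hKD : ∀ y, |K y| ≤ D / ‖y‖ ^ 2) (hφ : Continuous φ)
    (hC : ∀ t, 0 < t → |φ t| ≤ C * (t / (1 + t ^ 2) ^ 2)) {b : 𝓢(Plane, ℂ)}
    (hb : ∀ y, b y = ((K y * ∫ t in (0 : ℝ)..‖y‖, φ t : ℝ) : ℂ)) {m : Plane → ℂ}
    {T : L2Plane →L[ℂ] L2Plane} (hT : IsSingularIntegralOperator K T)
    (hm : IsFourierMultiplier m T) (hest : MaximalL2Estimate K) :
    ∃ A : ℝ≥0, ∀ η : 𝓢(Plane, ℂ), eLpNorm (fun ξ => (𝓕 b) ξ * η ξ) 2 (volume : Measure Plane)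
      ≤ A * eLpNorm (fun ξ => m ξ * η ξ) 2 volume := by
  obtain ⟨A₁, hA₁⟩ := exists_enorm_integral_radial_le hK hKD hφ hC
  obtain ⟨A₂, hA₂⟩ := hest
  refine ⟨A₁ * A₂, fun η => ?_⟩
  set g : 𝓢(Plane, ℂ) := 𝓕⁻ η with hg
  have hgη : 𝓕 g = η := by simp [hg]
  set f : L2Plane := g.toLp 2 with hf
  have hfη : (𝓕 f : L2Plane) =ᵐ[volume] η := by
    rw [hf, SchwartzMap.toLp_fourier_eq, hgη]
    exact η.coeFn_toLp 2 volume
  let u : 𝓢(Plane, ℂ) := convolution (ContinuousLinearMap.mul ℂ ℂ) b g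
  have hu : ∀ x, u x = ∫ y, f (x - y) * ((K y * ∫ t in (0 : ℝ)..‖y‖, φ t : ℝ) : ℂ) := by
    intro x
    have h1 : (fun y => f (x - y)) =ᵐ[volume] fun y => g (x - y) :=
      (measurePreserving_const_sub x).quasiMeasurePreserving.ae_eq_comp (g.coeFn_toLp 2 volume)
    have h2 := SchwartzMap.convolution_apply (ContinuousLinearMap.mul ℂ ℂ) b g x
    simp only [← hb]
    rw [integral_toLp_mul_toLp h1 .rfl]
    refine h2.trans ?_
    simp only [MeasureTheory.convolution, ContinuousLinearMap.mul_apply', mul_comm]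
  have hleft : eLpNorm (fun ξ => (𝓕 b) ξ * η ξ) 2 (volume : Measure Plane) = eLpNorm u 2 volume := by
    rw [← eLpNorm_fourier_schwartz u]
    congr 1
    ext ξ
    rw [SchwartzMap.fourier_convolution, hgη, pairing_apply_apply, ContinuousLinearMap.mul_apply']
  have hright : eLpNorm (fun ξ => m ξ * η ξ) 2 (volume : Measure Plane)
      = eLpNorm (T f) 2 volume := by
    rw [← eLpNorm_fourier (T f)]
    refine eLpNorm_congr_ae ?_
    filter_upwards [hm f, hfη] with ξ h1 h2
    rw [h1, h2]
  rw [hleft, hright, ENNReal.coe_mul, mul_assoc]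
  refine le_trans ?_ (mul_le_mul_right (hA₂ f (T f) (Lp.memLp f) (hT f)) _)
  refine eLpNorm_le_mul_eLpNorm_of_ae_le_mul' (.of_forall fun x => ?_) 2
  rw [hu, enorm_eq_self]
  exact hA₁ f x

/-- If the pointwise bound failed at ξ, continuity would give constants c₁ < c₂ with A|m| < c₁ and
c₂ < |M| near ξ; a bump supported there contradicts the norm inequality. -/
lemma norm_le_mul_norm_of_eLpNorm_le {M m : Plane → ℂ} {A : ℝ≥0}
    (h : ∀ η : 𝓢(Plane, ℂ), eLpNorm (fun ξ => M ξ * η ξ) 2 (volume : Measure Plane)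
      ≤ A * eLpNorm (fun ξ => m ξ * η ξ) 2 volume) {ξ : Plane} (hM : ContinuousAt M ξ)
    (hm : ContinuousAt m ξ) : ‖M ξ‖ ≤ A * ‖m ξ‖ := by
  by_contra! hlt
  obtain ⟨c₁, h1, h2⟩ := exists_between hlt
  obtain ⟨c₂, h3, h4⟩ := exists_between h2
  have hc₁ : 0 < c₁ := lt_of_le_of_lt (by positivity) h1
  have ev : ∀ᶠ ζ in 𝓝 ξ, A * ‖m ζ‖ < c₁ ∧ c₂ < ‖M ζ‖ :=
    ((hm.norm.const_mul _).eventually_lt_const h1).and (hM.norm.eventually_const_lt h4)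
  obtain ⟨r, hr, hball⟩ := Metric.eventually_nhds_iff_ball.1 ev
  let χ : ContDiffBump ξ := ⟨r / 2, r, by positivity, by linarith⟩
  have hχ : ContDiff ℝ ∞ (fun ζ => (χ ζ : ℂ)) := Complex.ofRealCLM.contDiff.comp χ.contDiff
  have hχc : HasCompactSupport (fun ζ => (χ ζ : ℂ)) :=
    χ.hasCompactSupport.comp_left (g := Complex.ofReal) rfl
  let η : 𝓢(Plane, ℂ) := hχc.toSchwartzMap hχ
  have hη : ∀ ζ, ζ ∉ Metric.ball ξ r → η ζ = 0 := by
    intro ζ hζ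
    have : χ ζ = 0 := χ.zero_of_le_dist (by simpa using hζ)
    change ((χ ζ : ℝ) : ℂ) = 0
    rw [this, Complex.ofReal_zero]
  have hη0 : eLpNorm η 2 (volume : Measure Plane) ≠ 0 := by
    intro h0
    rw [eLpNorm_eq_zero_iff η.continuous.aestronglyMeasurable two_ne_zero] at h0
    have h5 : (η : Plane → ℂ) = 0 := Continuous.ae_eq_iff_eq volume η.continuous continuous_const |>.1 h0
    have h6 : χ ξ = 1 := χ.one_of_mem_closedBall (Metric.mem_closedBall_self (by positivity))
    have h7 : ((χ ξ : ℝ) : ℂ) = 0 := congrFun h5 ξ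
    rw [h6] at h7
    simp at h7
  have hηtop : eLpNorm η 2 (volume : Measure Plane) ≠ ⊤ := (η.memLp 2 volume).eLpNorm_ne_top
  have hc₂ : 0 < c₂ := hc₁.trans h3
  have hlow : eLpNorm η 2 (volume : Measure Plane)
      ≤ ENNReal.ofReal c₂⁻¹ * eLpNorm (fun ζ => M ζ * η ζ) 2 volume := by
    refine eLpNorm_le_mul_eLpNorm_of_ae_le_mul (.of_forall fun ζ => ?_) 2
    by_cases hζ : ζ ∈ Metric.ball ξ r
    · rw [norm_mul, ← mul_assoc, ← div_eq_inv_mul]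
      refine le_mul_of_one_le_left (norm_nonneg _) ?_
      rw [one_le_div hc₂]
      exact (hball ζ hζ).2.le
    · simp [hη ζ hζ]
  have hup : A * eLpNorm (fun ζ => m ζ * η ζ) 2 (volume : Measure Plane)
      ≤ ENNReal.ofReal c₁ * eLpNorm η 2 volume := by
    have e := eLpNorm_const_smul (A : ℝ) (fun ζ => m ζ * η ζ) 2 (volume : Measure Plane)
    rw [show ‖(A : ℝ)‖ₑ = A by simp] at e
    rw [← e]
    refine eLpNorm_le_mul_eLpNorm_of_ae_le_mul (.of_forall fun ζ => ?_) 2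
    by_cases hζ : ζ ∈ Metric.ball ξ r
    · rw [Pi.smul_apply, norm_smul, norm_mul, ← mul_assoc, Real.norm_of_nonneg A.coe_nonneg]
      gcongr
      exact (hball ζ hζ).1.le
    · simp [hη ζ hζ]
  have hfin := hlow.trans (mul_le_mul_right ((h η).trans hup) _)
  rw [← mul_assoc, ← ENNReal.ofReal_mul (by positivity)] at hfin
  have hpos : 0 < (eLpNorm η 2 (volume : Measure Plane)).toReal := ENNReal.toReal_pos hη0 hηtop
  have hreal := ENNReal.toReal_mono (ENNReal.mul_ne_top ENNReal.ofReal_ne_top hηtop) hfin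
  rw [ENNReal.toReal_mul, ENNReal.toReal_ofReal (by positivity)] at hreal
  have : c₂⁻¹ * c₁ < 1 := by rwa [← div_eq_inv_mul, div_lt_one hc₂]
  nlinarith

end

/-! ### Consequences of the maximal estimate for the quartic kernels -/

/-- The derivative of `t⁶ exp(-πt²)`. -/
def averagingWeight (t : ℝ) : ℝ := (6 * t ^ 5 - 2 * Real.pi * t ^ 7) * Real.exp (-Real.pi * t ^ 2)

lemma continuous_averagingWeight : Continuous averagingWeight := by
  unfold averagingWeight
  fun_prop

lemma integral_averagingWeight (r : ℝ) :
    ∫ t in (0 : ℝ)..r, averagingWeight t = r ^ 6 * Real.exp (-Real.pi * r ^ 2) := by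
  have h : ∀ t : ℝ, HasDerivAt (fun t : ℝ => t ^ 6 * Real.exp (-Real.pi * t ^ 2))
      (averagingWeight t) t := by
    intro t
    have h1 := (hasDerivAt_pow 6 t).mul (((hasDerivAt_pow 2 t).const_mul (-Real.pi)).exp)
    convert! h1 using 1
    rw [averagingWeight]
    push_cast
    ring
  rw [intervalIntegral.integral_eq_sub_of_hasDerivAt (fun t _ => h t)
    (continuous_averagingWeight.intervalIntegrable _ _)]
  simp

lemma exists_abs_averagingWeight_le :
    ∃ C : ℝ, ∀ t, 0 < t → |averagingWeight t| ≤ C * (t / (1 + t ^ 2) ^ 2) := by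
  -- The exponent 10 is 6 + 4: after one factor t is split off, the polynomial in the weight is at
  -- most 8(1 + t)⁶, and the denominator contributes (1 + t²)² ≤ (1 + t)⁴.
  refine ⟨8 * ((10).factorial * Real.exp 2), fun t ht => ?_⟩
  have hπ := Real.pi_pos
  have h1 := one_add_pow_mul_exp_neg_le 10 ht.le
  have h2 : |6 * t ^ 5 - 2 * Real.pi * t ^ 7| ≤ t * (1 + t) ^ 4 * (8 * (1 + t) ^ 2) := by
    calc |6 * t ^ 5 - 2 * Real.pi * t ^ 7| ≤ |6 * t ^ 5| + |2 * Real.pi * t ^ 7| := abs_sub _ _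
      _ = t * t ^ 4 * (6 + 2 * Real.pi * t ^ 2) := by
          rw [abs_of_nonneg (by positivity), abs_of_nonneg (by positivity)]
          ring
      _ ≤ _ := by
          gcongr
          · linarith
          · nlinarith [Real.pi_lt_four, sq_nonneg t]
  have h3 : (1 + t ^ 2) ^ 2 ≤ (1 + t) ^ 4 := by
    rw [show (1 + t) ^ 4 = ((1 + t) ^ 2) ^ 2 by ring]
    gcongr
    nlinarith
  rw [← mul_div_assoc, le_div_iff₀ (by positivity), averagingWeight, abs_mul, Real.abs_exp]
  calc _ ≤ t * (1 + t) ^ 4 * (8 * (1 + t) ^ 2) * Real.exp (-Real.pi * t ^ 2) * (1 + t) ^ 4 := by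
        gcongr
    _ = 8 * ((1 + t) ^ 10 * Real.exp (-Real.pi * t ^ 2)) * t := by ring
    _ ≤ _ := by gcongr

lemma measurable_twoTermKernel (P : MvPolynomial (Fin 2) ℝ) : Measurable (twoTermKernel P) := by
  have h : Measurable fun z : Plane => MvPolynomial.eval (fun i => z i) P :=
    ((MvPolynomial.continuous_eval P).comp (by fun_prop)).measurable
  unfold twoTermKernel
  fun_prop

lemma exists_abs_twoTermKernel_le (a b : ℝ) : ∃ D : ℝ, ∀ z,
    |twoTermKernel (MvPolynomial.C a * polyA + MvPolynomial.C b * polyB) z| ≤ D / ‖z‖ ^ 2 := by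
  refine ⟨1 / Real.pi + 2 / Real.pi * (|a| * 2 + |b| * 8), fun z => ?_⟩
  rw [twoTermKernel_eq]
  rcases eq_or_ne z 0 with rfl | hz
  · simp
  have hn : 0 < ‖z‖ := norm_pos_iff.2 hz
  have hx : |z 0| ≤ ‖z‖ := PiLp.norm_apply_le z 0
  have hy : |z 1| ≤ ‖z‖ := PiLp.norm_apply_le z 1
  have hπ := Real.pi_pos
  have h1 : |z 0 * z 1| ≤ ‖z‖ ^ 2 := by
    rw [abs_mul, sq]
    gcongr
  have hA : |z 0 ^ 3 * z 1 - z 0 * z 1 ^ 3| ≤ 2 * ‖z‖ ^ 4 := by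
    calc _ ≤ |z 0 ^ 3 * z 1| + |z 0 * z 1 ^ 3| := abs_sub _ _
      _ = |z 0| ^ 3 * |z 1| + |z 0| * |z 1| ^ 3 := by simp only [abs_mul, abs_pow]
      _ ≤ ‖z‖ ^ 3 * ‖z‖ + ‖z‖ * ‖z‖ ^ 3 := by gcongr
      _ = _ := by ring
  have hB : |z 0 ^ 4 + z 1 ^ 4 - 6 * (z 0 ^ 2 * z 1 ^ 2)| ≤ 8 * ‖z‖ ^ 4 := by
    calc _ ≤ |z 0 ^ 4| + |z 1 ^ 4| + |6 * (z 0 ^ 2 * z 1 ^ 2)| :=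
          (abs_sub _ _).trans (by gcongr; exact abs_add_le _ _)
      _ = |z 0| ^ 4 + |z 1| ^ 4 + 6 * (|z 0| ^ 2 * |z 1| ^ 2) := by
          simp only [abs_mul, abs_pow, abs_of_pos (show (0 : ℝ) < 6 by norm_num)]
      _ ≤ ‖z‖ ^ 4 + ‖z‖ ^ 4 + 6 * (‖z‖ ^ 2 * ‖z‖ ^ 2) := by gcongr
      _ = _ := by ring
  calc _ ≤ |-(1 / Real.pi) * (z 0 * z 1 / ‖z‖ ^ 4)|
        + |2 / Real.pi * ((a * (z 0 ^ 3 * z 1 - z 0 * z 1 ^ 3)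
          + b * (z 0 ^ 4 + z 1 ^ 4 - 6 * (z 0 ^ 2 * z 1 ^ 2))) / ‖z‖ ^ 6)| := abs_add_le _ _
    _ ≤ 1 / Real.pi * (‖z‖ ^ 2 / ‖z‖ ^ 4)
        + 2 / Real.pi * ((|a| * (2 * ‖z‖ ^ 4) + |b| * (8 * ‖z‖ ^ 4)) / ‖z‖ ^ 6) := by
        rw [abs_mul, abs_mul, abs_neg, abs_div (z 0 * z 1), abs_div (_ + _),
          abs_of_pos (show 0 < 1 / Real.pi by positivity),
          abs_of_pos (show 0 < 2 / Real.pi by positivity),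
          abs_of_pos (show 0 < ‖z‖ ^ 4 by positivity), abs_of_pos (show 0 < ‖z‖ ^ 6 by positivity)]
        gcongr
        refine (abs_add_le _ _).trans ?_
        rw [abs_mul, abs_mul]
        gcongr
    _ = _ := by
        field_simp

/-- This explains the choice of weight: its primitive t⁶exp(-πt²) clears the denominators |z|⁴ and
|z|⁶, so the averaged kernel is a polynomial times a Gaussian. -/
lemma quarticGaussian_eq_mul_integral (a b : ℝ) (z : Plane) :
    quarticGaussian a b z
      = ((twoTermKernel (MvPolynomial.C a * polyA + MvPolynomial.C b * polyB) z
        * ∫ t in (0 : ℝ)..‖z‖, averagingWeight t : ℝ) : ℂ) := by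
  rw [quarticGaussian_apply, integral_averagingWeight, twoTermKernel_eq]
  congr 1
  rcases eq_or_ne z 0 with rfl | hz
  · simp
  · have hn : ‖z‖ ≠ 0 := norm_ne_zero_iff.2 hz
    field_simp

lemma continuousAt_quarticSymbol (a b : ℝ) {ξ : Plane} (hξ : ξ ≠ 0) :
    ContinuousAt (quarticSymbol a b) ξ := by
  have hn : ‖ξ‖ ≠ 0 := norm_ne_zero_iff.2 hξ
  unfold quarticSymbol
  refine ContinuousAt.add (ContinuousAt.div ?_ ?_ (pow_ne_zero _ hn))
    (ContinuousAt.div ?_ ?_ (pow_ne_zero _ hn)) <;> fun_prop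

/-- The maximal estimate bounds the multiplier of the second order term by the full multiplier. -/
lemma exists_abs_le_quarticSymbol {a b : ℝ}
    (hest : MaximalL2Estimate
      (twoTermKernel (MvPolynomial.C a * polyA + MvPolynomial.C b * polyB))) :
    ∃ A : ℝ, 0 ≤ A ∧ ∀ ξ : Plane, ‖ξ‖ = 1 → |ξ 0 * ξ 1| ≤ A * |quarticSymbol a b ξ| := by
  obtain ⟨B, hB⟩ := exists_beurling Complex.I_sq
  obtain ⟨B', hB'⟩ := exists_beurling neg_I_sq
  obtain ⟨T, hT, hTm⟩ := exists_quartic_operator a b hB hB'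
  obtain ⟨D, hD⟩ := exists_abs_twoTermKernel_le a b
  obtain ⟨C, hC⟩ := exists_abs_averagingWeight_le
  obtain ⟨A, hA⟩ := exists_eLpNorm_fourier_mul_le (measurable_twoTermKernel _) hD
    continuous_averagingWeight hC (quarticGaussian_eq_mul_integral a b)
    hT.isSingularIntegralOperator hTm hest
  have hπ := Real.pi_pos
  have hπ3 := Real.pi_gt_three
  set E := Real.exp (-Real.pi) with hE
  have hE0 : 0 < E := Real.exp_pos _
  refine ⟨Real.pi * (A / E + 2 / Real.pi), by positivity, fun ξ hξ => ?_⟩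
  have hξ0 : ξ ≠ 0 := norm_ne_zero_iff.1 (by rw [hξ]; exact one_ne_zero)
  have h := norm_le_mul_norm_of_eLpNorm_le hA (ξ := ξ) (SchwartzMap.continuous _).continuousAt
    (Complex.continuous_ofReal.continuousAt.comp (continuousAt_quarticSymbol a b hξ0))
  have hq : a * (ξ 0 ^ 3 * ξ 1 - ξ 0 * ξ 1 ^ 3) + b * (ξ 0 ^ 4 + ξ 1 ^ 4 - 6 * (ξ 0 ^ 2 * ξ 1 ^ 2))
      = quarticSymbol a b ξ - ξ 0 * ξ 1 := by
    rw [quarticSymbol, hξ]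
    ring
  rw [fourier_quarticGaussian, hq, Complex.norm_real, Complex.norm_real,
    Real.norm_eq_abs, Real.norm_eq_abs, hξ, one_pow, mul_one, ← hE, abs_mul, abs_of_pos hE0] at h
  set q := quarticSymbol a b ξ
  set p := ξ 0 * ξ 1
  rw [← le_div_iff₀ hE0] at h
  -- On the unit circle exp(π) times the transform equals (2/π)q - ((3 - 3/π)/π)p; the identity is
  -- solved for the p term.
  have h1 : (3 - 3 / Real.pi) / Real.pi * p = 2 / Real.pi * q
      - (-(1 / Real.pi) * (p * (1 - 3 / Real.pi)) + 2 / Real.pi * (q - p)) := by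
    field_simp
    ring
  -- The coefficient of p must stay away from 0, and π > 3 is enough.
  have h2 : (1 : ℝ) ≤ 3 - 3 / Real.pi := by
    have : 3 / Real.pi ≤ 1 := (div_le_one hπ).2 hπ3.le
    linarith
  have h3 : |(3 - 3 / Real.pi) / Real.pi * p| ≤ 2 / Real.pi * |q| + A * |q| / E := by
    rw [h1]
    refine (abs_sub _ _).trans (add_le_add ?_ h)
    rw [abs_mul, abs_of_pos (show 0 < 2 / Real.pi by positivity)]
  have h4 : 1 / Real.pi * |p| ≤ |(3 - 3 / Real.pi) / Real.pi * p| := by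
    rw [abs_mul _ p, abs_of_pos (show 0 < (3 - 3 / Real.pi) / Real.pi from
      div_pos (by linarith) hπ)]
    gcongr
  calc |p| = Real.pi * (1 / Real.pi * |p|) := by field_simp
    _ ≤ Real.pi * (2 / Real.pi * |q| + A * |q| / E) := by gcongr; exact h4.trans h3
    _ = _ := by ring

/-- The maximal estimate determines the quartic term up to a factor of modulus less than one. -/
lemma eq_zero_and_abs_lt_one_of_maximalL2Estimate {a b : ℝ}
    (hest : MaximalL2Estimate
      (twoTermKernel (MvPolynomial.C a * polyA + MvPolynomial.C b * polyB))) :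
    b = 0 ∧ |a| < 1 := by
  obtain ⟨A, hA0, hA⟩ := exists_abs_le_quarticSymbol hest
  have hcirc : ∀ x y : ℝ, x ^ 2 + y ^ 2 = 1 →
      |x * y| ≤ A * |x * y + (a * (x ^ 3 * y - x * y ^ 3)
        + b * (x ^ 4 + y ^ 4 - 6 * (x ^ 2 * y ^ 2)))| := by
    intro x y hxy
    have hn : ‖(!₂[x, y] : Plane)‖ = 1 := by
      rw [← sq_eq_sq₀ (norm_nonneg _) zero_le_one, norm_sq_plane]
      simpa using hxy
    have := hA !₂[x, y] hn
    rw [quarticSymbol, hn] at this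
    simpa using this
  have hb : b = 0 := by
    let s : ℝ → ℝ := fun θ => Real.cos θ * Real.sin θ
      + (a * (Real.cos θ ^ 3 * Real.sin θ - Real.cos θ * Real.sin θ ^ 3)
        + b * (Real.cos θ ^ 4 + Real.sin θ ^ 4 - 6 * (Real.cos θ ^ 2 * Real.sin θ ^ 2)))
    have hs : Continuous s := by fun_prop
    have h0 : s 0 = b := by simp [s]
    have hr : (√2 / 2) ^ 2 = 1 / 2 := by
      rw [div_pow, Real.sq_sqrt zero_le_two]
      norm_num
    have h1 : s (Real.pi / 4) = 1 / 2 - b := by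
      simp only [s, Real.cos_pi_div_four, Real.sin_pi_div_four]
      linear_combination (1 - 4 * b * ((√2 / 2) ^ 2 + 1 / 2)) * hr
    have h2 : s (-(Real.pi / 4)) = -(1 / 2) - b := by
      simp only [s, Real.cos_neg, Real.sin_neg, Real.cos_pi_div_four, Real.sin_pi_div_four]
      linear_combination (-1 - 4 * b * ((√2 / 2) ^ 2 + 1 / 2)) * hr
    -- The symbol takes the values b, 1/2 - b and -1/2 - b at 0, π/4 and -π/4, so it has a zero
    -- whatever the sign of b.
    obtain ⟨θ, hθ⟩ : ∃ θ, s θ = 0 := by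
      have hsub : ∀ u v, Set.uIcc (s u) (s v) ⊆ Set.range s := fun u v =>
        (intermediate_value_uIcc hs.continuousOn).trans (Set.image_subset_range _ _)
      rcases le_total 0 b with hb | hb
      · refine hsub 0 (-(Real.pi / 4)) (Set.mem_uIcc.2 (.inr ?_))
        rw [h0, h2]
        constructor <;> linarith
      · refine hsub 0 (Real.pi / 4) (Set.mem_uIcc.2 (.inl ?_))
        rw [h0, h1]
        constructor <;> linarith
    have hcs := Real.cos_sq_add_sin_sq θ
    have h3 := hcirc _ _ hcs
    change _ ≤ A * |s θ| at h3
    rw [hθ, abs_zero, mul_zero, abs_nonpos_iff] at h3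
    -- Where xy = 0 on the circle, x³y - xy³ vanishes too and x⁴ + y⁴ - 6x²y² = (x² + y²)² - 8x²y² =
    -- 1.
    have h4 : s θ = b := by
      simp only [s]
      linear_combination (1 + a * (Real.cos θ ^ 2 - Real.sin θ ^ 2)
        - 8 * b * (Real.cos θ * Real.sin θ)) * h3
        + b * (Real.cos θ ^ 2 + Real.sin θ ^ 2 + 1) * hcs
    rw [← h4, hθ]
  refine ⟨hb, ?_⟩
  subst hb
  by_contra! ha
  -- Parametrize by c = x² - y². Then xy > 0 for |c| < 1, and it cancels from both sides.
  have hc : ∀ c : ℝ, |c| < 1 → 1 ≤ A * |1 + a * c| := by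
    intro c hc
    obtain ⟨hc1, hc2⟩ := abs_lt.1 hc
    have hx : √((1 + c) / 2) ^ 2 = (1 + c) / 2 := Real.sq_sqrt (by linarith)
    have hy : √((1 - c) / 2) ^ 2 = (1 - c) / 2 := Real.sq_sqrt (by linarith)
    have hx0 : 0 < √((1 + c) / 2) := Real.sqrt_pos.2 (by linarith)
    have hy0 : 0 < √((1 - c) / 2) := Real.sqrt_pos.2 (by linarith)
    have h := hcirc √((1 + c) / 2) √((1 - c) / 2) (by rw [hx, hy]; ring)
    generalize √((1 + c) / 2) = x at *
    generalize √((1 - c) / 2) = y at *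
    have e : x * y + (a * (x ^ 3 * y - x * y ^ 3) + 0 * (x ^ 4 + y ^ 4 - 6 * (x ^ 2 * y ^ 2)))
        = x * y * (1 + a * c) := by
      linear_combination a * x * y * (hx - hy)
    rw [e, abs_mul (x * y), abs_of_pos (mul_pos hx0 hy0)] at h
    have hxy := mul_pos hx0 hy0
    refine le_of_mul_le_mul_left ?_ hxy
    linarith
  have ha0 : a ≠ 0 := by
    rintro rfl
    simp at ha
    linarith
  -- This c makes 1 + ac = 1/(A + 2), and it is admissible because |a| ≥ 1. The bound would then
  -- read A + 2 ≤ A.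
  have hlt : |-(1 - 1 / (A + 2)) / a| < 1 := by
    have h1 : 0 < 1 / (A + 2) := by positivity
    have h2 : 1 / (A + 2) ≤ 1 := (div_le_one (by positivity)).2 (by linarith)
    rw [abs_div, abs_neg, abs_of_nonneg (by linarith), div_lt_one (abs_pos.2 ha0)]
    linarith
  have h := hc _ hlt
  have e : 1 + a * (-(1 - 1 / (A + 2)) / a) = 1 / (A + 2) := by
    field_simp
    ring
  rw [e, abs_of_pos (by positivity), mul_one_div, le_div_iff₀ (by positivity)] at h
  linarith

/-! ### Homogeneous harmonic polynomials of degree four -/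

lemma eq_sum_monomials_of_isHomogeneous {P : MvPolynomial (Fin 2) ℝ} {n : ℕ}
    (hP : P.IsHomogeneous n) :
    P = ∑ k ∈ Finset.range (n + 1),
      MvPolynomial.C (P.coeff (Finsupp.single 0 k + Finsupp.single 1 (n - k)))
        * MvPolynomial.X 0 ^ k * MvPolynomial.X 1 ^ (n - k) := by
  have hmon : ∀ (k l : ℕ) (c : ℝ), MvPolynomial.C c * MvPolynomial.X 0 ^ k * MvPolynomial.X 1 ^ l
      = MvPolynomial.monomial (Finsupp.single (0 : Fin 2) k + Finsupp.single 1 l) c := by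
    intro k l c
    rw [MvPolynomial.monomial_add_single, MvPolynomial.C_mul_X_pow_eq_monomial]
  simp only [hmon]
  ext m
  rw [MvPolynomial.coeff_sum]
  simp only [MvPolynomial.coeff_monomial]
  by_cases hm : P.coeff m = 0
  · rw [hm]
    refine (Finset.sum_eq_zero fun k _ => ?_).symm
    split_ifs with h
    · rw [h, hm]
    · rfl
  · have hdeg := hP hm
    have hsum : m 0 + m 1 = n := by
      rw [← hdeg, Finsupp.weight_apply, Finsupp.sum_fintype _ _ (by simp)]
      simp
    have hm' : Finsupp.single 0 (m 0) + Finsupp.single 1 (n - m 0) = m := by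
      ext i
      fin_cases i
      · simp
      · simp
        omega
    rw [Finset.sum_eq_single (m 0)]
    · rw [if_pos hm', hm']
    · intro k _ hk
      refine if_neg fun h => hk ?_
      rw [← h]
      simp
    · intro h
      simp at h
      omega

/-- The Laplacian of a general quartic form is a quadratic form; evaluating it at (1,0), (0,1) and
(1,1) gives three linear relations among the five coefficients, leaving the two that multiply x³y
and x⁴. -/
lemma exists_eq_of_isHarmonicPolynomial {P : MvPolynomial (Fin 2) ℝ} (hP : P.IsHomogeneous 4)
    (hharm : IsHarmonicPolynomial P) :
    ∃ a b : ℝ, P = MvPolynomial.C a * polyA + MvPolynomial.C b * polyB := by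
  have h := eq_sum_monomials_of_isHomogeneous hP
  simp only [Finset.sum_range_succ, Finset.sum_range_zero] at h
  generalize P.coeff _ = c₀ at h
  generalize P.coeff _ = c₁ at h
  generalize P.coeff _ = c₂ at h
  generalize P.coeff _ = c₃ at h
  generalize P.coeff _ = c₄ at h
  subst h
  have hlap : ∀ x y : ℝ, (12 * c₄ + 2 * c₂) * x ^ 2 + (6 * c₃ + 6 * c₁) * (x * y)
      + (12 * c₀ + 2 * c₂) * y ^ 2 = 0 := by
    intro x y
    have h := congrArg (MvPolynomial.eval ![x, y]) hharm
    -- Differentiating powers leaves numerals as polynomials; their derivatives must be recognised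
    -- as zero.
    have hnum : ∀ (i : Fin 2) (n : ℕ) [n.AtLeastTwo],
        MvPolynomial.pderiv i (OfNat.ofNat n : MvPolynomial (Fin 2) ℝ) = 0 := fun i n _ =>
      (MvPolynomial.pderiv i).map_natCast n
    simp [MvPolynomial.pderiv_X, hnum] at h
    linear_combination h
  have h1 := hlap 1 0
  have h2 := hlap 0 1
  have h3 := hlap 1 1
  refine ⟨c₃, c₄, ?_⟩
  obtain rfl : c₂ = -6 * c₄ := by linarith
  obtain rfl : c₀ = c₄ := by linarith
  obtain rfl : c₁ = -c₃ := by linarith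
  simp only [polyA, polyB, map_neg, map_mul, map_ofNat]
  ring

/-! ### Scaling of the kernel -/

lemma truncatedIntegral_const_mul (c : ℝ) (K : Plane → ℝ) (ε : ℝ) (f : Plane → ℂ) (x : Plane) :
    truncatedIntegral (fun z => c * K z) ε f x = c * truncatedIntegral K ε f x := by
  rw [truncatedIntegral, truncatedIntegral, ← integral_const_mul]
  refine integral_congr_ae (.of_forall fun y => ?_)
  push_cast
  ring

/-- Both T^* and T scale with |c|. The lemma lets the last kernel, which has another normalization,
be compared with the family `twoTermKernel`. -/
lemma MaximalL2Estimate.of_const_mul {K : Plane → ℝ} {c : ℝ} (hc : c ≠ 0)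
    (h : MaximalL2Estimate fun z => c * K z) : MaximalL2Estimate K := by
  obtain ⟨C, hC⟩ := h
  refine ⟨‖c‖₊⁻¹ * (C * ‖c‖₊), fun f g hf hg => ?_⟩
  have hPV : IsPrincipalValue (fun z => c * K z) f ((c : ℂ) • g) := by
    filter_upwards [hg] with x hx
    simp only [truncatedIntegral_const_mul]
    exact hx.const_mul (c : ℂ)
  have h1 := hC f _ hf hPV
  rw [eLpNorm_const_smul] at h1
  have h2 : eLpNorm (maximalSingularIntegral K f) 2 (volume : Measure Plane)
      ≤ ((‖c‖₊⁻¹ : ℝ≥0) : ℝ≥0∞)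
        * eLpNorm (maximalSingularIntegral (fun z => c * K z) f) 2 volume := by
    refine eLpNorm_le_mul_eLpNorm_of_ae_le_mul' (.of_forall fun x => ?_) 2
    rw [enorm_eq_self, enorm_eq_self, maximalSingularIntegral]
    refine iSup₂_le fun ε hε => ?_
    have h3 : ‖truncatedIntegral K ε f x‖ₑ
        = ((‖c‖₊⁻¹ : ℝ≥0) : ℝ≥0∞) * ‖truncatedIntegral (fun z => c * K z) ε f x‖ₑ := by
      have hc' : ‖c‖₊ ≠ 0 := nnnorm_ne_zero_iff.2 hc
      rw [truncatedIntegral_const_mul, enorm_mul, ← mul_assoc]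
      have e : ‖(c : ℂ)‖ₑ = (‖c‖₊ : ℝ≥0∞) := by simp [enorm, nnnorm]
      rw [e, ← ENNReal.coe_mul, inv_mul_cancel₀ hc', ENNReal.coe_one, one_mul]
    rw [h3]
    gcongr
    exact le_iSup₂ (f := fun (ε : ℝ) (_ : 0 < ε) =>
      ‖truncatedIntegral (fun z => c * K z) ε f x‖ₑ) ε hε
  refine (h2.trans (mul_le_mul_right h1 _)).trans_eq ?_
  have e : ‖(c : ℂ)‖ₑ = (‖c‖₊ : ℝ≥0∞) := by simp [enorm, nnnorm]
  rw [e]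
  push_cast
  ring

theorem mainTheorem4 :
    (∀ P₄ : MvPolynomial (Fin 2) ℝ, P₄.IsHomogeneous 4 → IsHarmonicPolynomial P₄ →
      MaximalL2Estimate (twoTermKernel P₄) →
        (∃ α : ℝ, P₄ = MvPolynomial.C α * polyA ∧ |α| < 1) ∧
        (MvPolynomial.X 0 * MvPolynomial.X 1 ∣ P₄) ∧
        ∃ T R U : L2Plane →L[ℂ] L2Plane,
          IsSingularIntegralOperator (twoTermKernel P₄) T ∧
          IsSingularIntegralOperator (rieszKernel 2 polyP2) R ∧
          IsInvertibleInCZAlgebra U ∧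
          T = R ∘L U) ∧
    ¬ MaximalL2Estimate (twoTermKernel polyA) ∧
    (∀ α β : ℝ, β ≠ 0 →
      ¬ MaximalL2Estimate
        (twoTermKernel (MvPolynomial.C α * polyA + MvPolynomial.C β * polyB))) ∧
    ¬ MaximalL2Estimate (fun z : Plane =>
        z 0 * z 1 / ‖z‖ ^ 4 + (z 0 ^ 4 + z 1 ^ 4 - 6 * z 0 ^ 2 * z 1 ^ 2) / ‖z‖ ^ 6) := by
  refine ⟨fun P₄ hP hharm hest => ?_, fun hest => ?_, fun α β hβ hest => ?_, fun hest => ?_⟩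
  · obtain ⟨a, b, rfl⟩ := exists_eq_of_isHarmonicPolynomial hP hharm
    obtain ⟨rfl, ha⟩ := eq_zero_and_abs_lt_one_of_maximalL2Estimate hest
    have e : MvPolynomial.C a * polyA + MvPolynomial.C 0 * polyB = MvPolynomial.C a * polyA := by
      simp
    rw [e]
    refine ⟨⟨a, rfl, ha⟩, ?_, exists_factorization_of_abs_lt_one ha⟩
    refine ⟨MvPolynomial.C a * (MvPolynomial.X 0 ^ 2 - MvPolynomial.X 1 ^ 2), ?_⟩
    rw [polyA]
    ring
  · have h := (eq_zero_and_abs_lt_one_of_maximalL2Estimate (a := 1) (b := 0) (by simpa using hest)).2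
    simp at h
  · exact hβ (eq_zero_and_abs_lt_one_of_maximalL2Estimate hest).1
  -- Multiplying by -π normalizes the quadratic term to xy/|z|⁴ and turns 2/π into -2, so the
  -- quartic coefficient has to be -1/2.
  · have h : MaximalL2Estimate fun z => -Real.pi *
        twoTermKernel (MvPolynomial.C 0 * polyA + MvPolynomial.C (-(1 / 2)) * polyB) z := by
      convert! hest using 2 with z
      rw [twoTermKernel_eq]
      field_simp
      ring
    have h0 := (eq_zero_and_abs_lt_one_of_maximalL2Estimate
      (h.of_const_mul (neg_ne_zero.2 Real.pi_ne_zero))).1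
    norm_num at h0

end
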